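/- Let $X\in\mathbb{R}^{d_0\times n}$ be a deterministic matrix with columns $\mathbf{x}_1,\dots,\mathbf{x}_n$, and let $W\in\mathbb{R}^{d_1\times d_0}$ and $\mathbf{a}\in\mathbb{R}^{d_1}$ be random, all their entries being i.i.d. $\mathcal{N}(0,1)$. Let $\sigma:\mathbb{R}\to\mathbb{R}$ be $\lambda_\sigma$-Lipschitz, that is, $|\sigma(x)-\sigma(y)|\le\lambda_\sigma|x-y|$ for all $x,y$, with $\lambda_\sigma\ge 0$. Put $Y:=\sigma(WX)$ (entrywise), let $S\in\mathbb{R}^{d_1\times n}$ be the matrix with $\alpha$-th column $\operatorname{diag}(\sigma'(W\mathbf{x}_\alpha))\,\mathbf{a}$, and let $$H:=\frac{1}{d_1}\left(Y^\top Y+(S^\top S)\odot(X^\top X)\right)$$ be the empirical neural tangent kernel, where $\odot$ is the entrywise product. Expectations of matrices are entrywise, $\|\cdot\|$ is the spectral norm of a matrix and the Euclidean norm of a vector, and $\xi\sim\mathcal{N}(0,1)$. (The value given to $\sigma'$ at points where $\sigma$ is not differentiable is $0$; almost surely it does not affect $(S^\top S)\odot(X^\top X)$.) There is a universal constant $C>0$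 such that, whenever $d_1\ge\log n$, the following hold. 1. With probability at least $1-n^{-7/3}$, $$\left\|\frac{1}{d_1}\left(S^\top S-\mathbb{E}[S^\top S]\right)\odot(X^\top X)\right\|\le 10\,\lambda_\sigma^2\|X\|^2\sqrt{\frac{\log n}{d_1}}.$$ In particular, if $\lambda_\sigma\|X\|\ge1$, then with probability at least $1-n^{-7/3}$, $$\left\|\frac{1}{d_1}\left(S^\top S-\mathbb{E}[S^\top S]\right)\odot(X^\top X)\right\|\le 10\,\lambda_\sigma^4\|X\|^4\sqrt{\frac{\log n}{d_1}}.$$ 2. If moreover $B\ge0$ satisfies $\sum_{i=1}^n(\|\mathbf{x}_i\|^2-1)^2\le B^2$ and $\mathbb{E}[\sigma(\xi)]=0$, then with probability at least $1-n^{-7/3}-4e^{-2n}$, $$\|H-\mathbb{E}H\|\le C\left(\sqrt{\frac{n}{d_1}}+\frac{n}{d_1}\right)\lambda_\sigma^2\|X\|^2+32B\lambda_\sigma^2\|X\|\sqrt{\frac{n}{d_1}}+10\,\lambda_\sigma^4\|X\|^4\sqrt{\frac{\log n}{d_1}}.$$ -/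

import Mathlib

open MeasureTheory ProbabilityTheory
open scoped Matrix NNReal
-- With this scope `‖A‖` for a real matrix `A` is the spectral norm (the ℓ² → ℓ² operator norm).
open scoped Matrix.Norms.L2Operator

noncomputable section

namespace TwoLayerNet

variable {Ω : Type*} [MeasurableSpace Ω] {d₀ d₁ n : ℕ}

/-- All the entries of the hidden weights `W` and of the output weights `a`, taken together,
are independent and identically distributed with law `N(0,1)`. -/
structure GaussianWeights (P : Measure Ω) (W : Ω → Matrix (Fin d₁) (Fin d₀) ℝ)
    (a : Ω → Fin d₁ → ℝ) : Prop where
  law_W : ∀ r k, HasLaw (fun ω => W ω r k) (gaussianReal 0 1) P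
  law_a : ∀ r, HasLaw (fun ω => a ω r) (gaussianReal 0 1) P
  indep : iIndepFun (Sum.elim (fun (p : Fin d₁ × Fin d₀) (ω : Ω) => W ω p.1 p.2)
    (fun (r : Fin d₁) (ω : Ω) => a ω r)) P

/-- The entrywise expectation of a random matrix. -/
def expect {m k : Type*} (P : Measure Ω) (M : Ω → Matrix m k ℝ) : Matrix m k ℝ :=
  Matrix.of fun i j => ∫ ω, M ω i j ∂P

/-- The hidden layer `Y = σ(W X)`, with `σ` applied entrywise. -/
def Y (σ : ℝ → ℝ) (X : Matrix (Fin d₀) (Fin n) ℝ) (W : Matrix (Fin d₁) (Fin d₀) ℝ) :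
    Matrix (Fin d₁) (Fin n) ℝ :=
  (W * X).map σ

/-- The `d₁ × n` matrix `S` whose `α`-th column is `diag(σ'(W x_α)) a`. -/
def S (σ : ℝ → ℝ) (X : Matrix (Fin d₀) (Fin n) ℝ) (W : Matrix (Fin d₁) (Fin d₀) ℝ)
    (a : Fin d₁ → ℝ) : Matrix (Fin d₁) (Fin n) ℝ :=
  Matrix.of fun r α => deriv σ ((W * X) r α) * a r

/-- The empirical neural tangent kernel `H = (Yᵀ Y + (Sᵀ S) ⊙ (Xᵀ X)) / d₁`. -/
def H (σ : ℝ → ℝ) (X : Matrix (Fin d₀) (Fin n) ℝ) (W : Matrix (Fin d₁) (Fin d₀) ℝ)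
    (a : Fin d₁ → ℝ) : Matrix (Fin n) (Fin n) ℝ :=
  (1 / (d₁ : ℝ)) • ((Y σ X W)ᵀ * Y σ X W + ((S σ X W a)ᵀ * S σ X W a) ⊙ (Xᵀ * X))

/-- The centered derivative part `L = d₁⁻¹ (Sᵀ S - E[Sᵀ S]) ⊙ (Xᵀ X)` of the tangent kernel,
for the random weights `(W, a)`, at the outcome `ω`. -/
def L (P : Measure Ω) (σ : ℝ → ℝ) (X : Matrix (Fin d₀) (Fin n) ℝ)
    (W : Ω → Matrix (Fin d₁) (Fin d₀) ℝ) (a : Ω → Fin d₁ → ℝ) (ω : Ω) :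
    Matrix (Fin n) (Fin n) ℝ :=
  (1 / (d₁ : ℝ)) • (((S σ X (W ω) (a ω))ᵀ * S σ X (W ω) (a ω)
    - expect P (fun ω' => (S σ X (W ω') (a ω'))ᵀ * S σ X (W ω') (a ω'))) ⊙ (Xᵀ * X))

end TwoLayerNet

end

/-! Derivative part. If `s` is a row of `S` and `D = diag s`, then `(s sᵀ) ⊙ (Xᵀ X) = (X D)ᵀ (X D)`,
which lies between `0` and `a_r² λ² ‖X‖²` in the Loewner order. Hence `L` is a centered average of
`d₁` independent positive semidefinite matrices, each dominated by the square of a standard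
Gaussian. The Ahlswede–Winter method applies: the Golden–Thompson inequality
(`Matrix.trace_exp_add_le`) and independence bound the trace exponential moment of the sum by
one-matrix moments (`integral_trace_exp_sum_le`), and these are controlled by the exponential moment
of `max 1 ξ²`. Put `u = √(log n / d₁)`. For `u ≤ 1/10` each tail is at most `n⁻⁵`. For larger `u`
the lower tail is impossible, since each summand is at least minus its mean, and the upper tail
costs exactly `n^(-7/3)`.

Hidden layer. The quadratic form of `Yᵀ Y` at a unit vector `v` is a sum over the Gaussian rows `w`
of `g(w)²`, where `g(w) = ∑ α, v α * σ (x_α · w)` is `λ‖X‖`-Lipschitz. The Maurey–Pisier rotation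
argument makes `g` sub-Gaussian around its mean `μ`, so `(g - μ)²` is sub-exponential and obeys a
Bernstein bound. The cross term `2 μ (g - μ)` is sub-Gaussian, and `|μ| ≤ λ B` because `E σ(ξ) = 0`.
A `1/2`-net of at most `5 ^ n` directions turns this into a bound on the norm
(`GaussianRows.measure_gram_Y_le`).

The kernel is the sum of the two parts; as `log n ≤ n`, the error of the derivative part is absorbed
into the constant `170 = 160 + 10`. -/

theorem norm_pow_sub_pow_le_of_norm_le {𝔸 : Type*} [NormedRing 𝔸] [NormOneClass 𝔸]
    {x y : 𝔸} {c : ℝ} (hx : ‖x‖ ≤ c)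
    (hy : ‖y‖ ≤ c) (n : ℕ) : ‖x ^ (n + 1) - y ^ (n + 1)‖ ≤ (n + 1) * c ^ n * ‖x - y‖ := by
  have hc : 0 ≤ c := (norm_nonneg _).trans hx
  induction n with
  | zero => simp
  | succ n ih =>
    have e : x ^ (n + 1 + 1) - y ^ (n + 1 + 1)
        = x ^ (n + 1) * (x - y) + (x ^ (n + 1) - y ^ (n + 1)) * y := by
      rw [pow_succ x (n + 1), pow_succ y (n + 1)]; noncomm_ring
    rw [e]
    calc _ ≤ ‖x ^ (n + 1)‖ * ‖x - y‖ + ‖x ^ (n + 1) - y ^ (n + 1)‖ * ‖y‖ :=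
          (norm_add_le _ _).trans (add_le_add (norm_mul_le _ _) (norm_mul_le _ _))
      _ ≤ c ^ (n + 1) * ‖x - y‖ + ((n + 1) * c ^ n * ‖x - y‖) * c := by
          gcongr
          exact (norm_pow_le _ _).trans (by gcongr)
      _ = _ := by push_cast; ring

/-! ### Dyadic trace inequalities -/

section TraceInequalities

open Matrix Filter Topology NormedSpace

variable {ι : Type*} [Fintype ι]

theorem Matrix.trace_mul_le_sqrt (A B : Matrix ι ι ℝ) :
    (A * B).trace ≤ √((A * Aᵀ).trace) * √((B * Bᵀ).trace) := by
  have h1 : (A * B).trace = ∑ p : ι × ι, A p.1 p.2 * B p.2 p.1 := by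
    simp [Matrix.trace, Matrix.mul_apply, Fintype.sum_prod_type]
  have h2 : (A * Aᵀ).trace = ∑ p : ι × ι, A p.1 p.2 ^ 2 := by
    simp [Matrix.trace, Matrix.mul_apply, Fintype.sum_prod_type, sq]
  have h3 : (B * Bᵀ).trace = ∑ p : ι × ι, B p.2 p.1 ^ 2 := by
    simp only [Matrix.trace, Matrix.mul_apply, Fintype.sum_prod_type, sq, Matrix.diag_apply,
      Matrix.transpose_apply]
    exact Finset.sum_comm
  rw [h1, h2, h3]
  exact Real.sum_mul_le_sqrt_mul_sqrt _ _ _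

variable [DecidableEq ι]

theorem Matrix.trace_pow_mul_comm (A B : Matrix ι ι ℝ) (q : ℕ) :
    ((A * B) ^ q).trace = ((B * A) ^ q).trace := by
  rcases q with _ | q
  · simp
  · have h : ∀ q : ℕ, (A * B) ^ q * A = A * (B * A) ^ q := by
      intro q
      induction q with
      | zero => simp
      | succ q ih => rw [pow_succ', mul_assoc, ih, pow_succ']; simp only [mul_assoc]
    rw [pow_succ, ← mul_assoc, h, mul_assoc, Matrix.trace_mul_comm, mul_assoc, ← pow_succ]

/-- Dyadic trace power inequalities, for `q = 2 ^ k`. -/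
theorem Matrix.trace_pow_two_pow_aux (k : ℕ) :
    (∀ M : Matrix ι ι ℝ, (M ^ (2 * 2 ^ k)).trace ≤ ((M * Mᵀ) ^ 2 ^ k).trace) ∧
    (∀ R T : Matrix ι ι ℝ, Rᵀ = R → Tᵀ = T →
      ((R * T) ^ 2 ^ k).trace ≤
        √((R ^ (2 * 2 ^ k)).trace) * √((T ^ (2 * 2 ^ k)).trace)) := by
  induction k with
  | zero =>
    refine ⟨fun M => ?_, fun R T hR hT => ?_⟩
    · have h := Matrix.trace_mul_le_sqrt M M
      rw [Real.mul_self_sqrt] at h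
      · simpa [sq] using h
      · simpa using (Matrix.posSemidef_self_mul_conjTranspose M).trace_nonneg
    · have h := Matrix.trace_mul_le_sqrt R T
      rw [hR, hT] at h
      simpa [sq] using h
  | succ k ih =>
    obtain ⟨ihF, ihG⟩ := ih
    refine ⟨fun M => ?_, fun R T hR hT => ?_⟩
    · have h1 := ihF (M ^ 2)
      have e1 : (M ^ 2 * (M ^ 2)ᵀ) = M * (M * Mᵀ * Mᵀ) := by
        simp [sq, Matrix.mul_assoc]
      rw [← pow_mul, e1, Matrix.trace_pow_mul_comm M] at h1
      have e2 : M * Mᵀ * Mᵀ * M = (M * Mᵀ) * (Mᵀ * M) := by simp [Matrix.mul_assoc]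
      have h2 := ihG (M * Mᵀ) (Mᵀ * M) (by simp) (by simp)
      rw [Matrix.trace_pow_mul_comm Mᵀ M, Real.mul_self_sqrt] at h2
      · rw [e2] at h1
        calc _ = (M ^ (2 * (2 * 2 ^ k))).trace := by rw [pow_succ' 2 k]
          _ ≤ _ := h1.trans h2
          _ = _ := by rw [pow_succ' 2 k]
      · have : (M * Mᵀ).PosSemidef := by
          simpa using Matrix.posSemidef_self_mul_conjTranspose M
        exact (this.pow _).trace_nonneg
    · have h1 := ihF (R * T)
      have e1 : R * T * (R * T)ᵀ = R * (T * T * R) := by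
        simp [Matrix.mul_assoc, hR, hT]
      rw [e1, Matrix.trace_pow_mul_comm R (T * T * R)] at h1
      have e2 : T * T * R * R = T ^ 2 * R ^ 2 := by simp [sq, Matrix.mul_assoc]
      have h2 := ihG (T ^ 2) (R ^ 2) (by simp [Matrix.transpose_pow, hT])
        (by simp [Matrix.transpose_pow, hR])
      rw [e2] at h1
      rw [← pow_mul, ← pow_mul, mul_comm] at h2
      rw [pow_succ' 2 k]
      exact h1.trans h2

/-- Each doubling passes from `(P, Q)` to `(Q ^ 2, P ^ 2)`: the first dyadic inequality bounds the
trace by that of a power of `P Q Q P`, which is cyclically `Q ^ 2 P ^ 2`. -/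
theorem Matrix.trace_mul_pow_two_pow_le (k : ℕ) (P Q : Matrix ι ι ℝ) (hP : Pᵀ = P) (hQ : Qᵀ = Q) :
    ((P * Q) ^ 2 ^ k).trace ≤ (P ^ 2 ^ k * Q ^ 2 ^ k).trace := by
  induction k generalizing P Q with
  | zero => simp
  | succ k ih =>
    have h1 := (Matrix.trace_pow_two_pow_aux k).1 (P * Q)
    have e1 : P * Q * (P * Q)ᵀ = P * (Q * Q * P) := by simp [Matrix.mul_assoc, hP, hQ]
    rw [e1, Matrix.trace_pow_mul_comm P (Q * Q * P)] at h1
    have e2 : Q * Q * P * P = Q ^ 2 * P ^ 2 := by simp [sq, Matrix.mul_assoc]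
    have h2 := ih (Q ^ 2) (P ^ 2) (by simp [Matrix.transpose_pow, hQ])
        (by simp [Matrix.transpose_pow, hP])
    rw [e2] at h1
    rw [Matrix.trace_mul_comm, ← pow_mul, ← pow_mul] at h2
    rw [pow_succ' 2 k]
    exact h1.trans h2

end TraceInequalities

/-! ### The exponential in a Banach algebra and the Lie product formula -/

section BanachExp

open NormedSpace Filter Topology

variable {𝔸 : Type*} [NormedRing 𝔸] [NormedAlgebra ℝ 𝔸] [CompleteSpace 𝔸]

/-- Termwise comparison of the power series from order two on. It also supplies the second-order
remainder in the one-matrix moment bound. -/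
theorem norm_exp_sub_one_sub_le (x : 𝔸) : ‖exp x - 1 - x‖ ≤ Real.exp ‖x‖ - 1 - ‖x‖ := by
  have hs := NormedSpace.exp_series_hasSum_exp' (𝕂 := ℝ) x
  have hr : HasSum (fun n : ℕ => ((n.factorial : ℝ)⁻¹) • ‖x‖ ^ n) (Real.exp ‖x‖) := by
    rw [Real.exp_eq_exp_ℝ]; exact NormedSpace.exp_series_hasSum_exp' (𝕂 := ℝ) ‖x‖
  have hs2 := (hasSum_nat_add_iff' 2).mpr hs
  have hr2 := (hasSum_nat_add_iff' 2).mpr hr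
  simp [Finset.sum_range_succ] at hs2 hr2
  rw [sub_sub, sub_sub]
  refine hs2.norm_le_of_bounded hr2 fun k => ?_
  rw [norm_smul, norm_inv, Real.norm_natCast]
  gcongr
  exact norm_pow_le' x (by omega)

theorem norm_exp_le_exp_norm' [NormOneClass 𝔸] (x : 𝔸) : ‖exp x‖ ≤ Real.exp ‖x‖ := by
  have h := norm_exp_sub_one_sub_le x
  calc ‖exp x‖ = ‖(exp x - 1 - x) + (1 + x)‖ := by congr 1; abel
    _ ≤ ‖exp x - 1 - x‖ + (‖(1 : 𝔸)‖ + ‖x‖) := (norm_add_le _ _).trans (by gcongr; exact norm_add_le _ _)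
    _ ≤ _ := by rw [norm_one]; linarith

/-- The Lie product formula. -/
theorem tendsto_exp_smul_mul_exp_smul_pow [NormOneClass 𝔸] (A B : 𝔸) :
    Tendsto (fun n : ℕ => (exp ((n : ℝ)⁻¹ • A) * exp ((n : ℝ)⁻¹ • B)) ^ n) atTop
      (𝓝 (exp (A + B))) := by
  -- Both curves have derivative `A + B` at `0`, so at `t = 1/n` they differ by `o(1/n)`.
  -- Telescoping the `n`-th powers multiplies this by `n` and by a factor bounded by `exp (‖A‖ +
  -- ‖B‖)`.
  have hder : HasDerivAt (fun t : ℝ => exp (t • A) * exp (t • B) - exp (t • (A + B))) 0 0 := by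
    have h1 := (hasDerivAt_exp_smul_const (𝕂 := ℝ) A 0)
    have h2 := (hasDerivAt_exp_smul_const (𝕂 := ℝ) B 0)
    have h3 := (hasDerivAt_exp_smul_const (𝕂 := ℝ) (A + B) 0)
    have h := (h1.mul h2).sub h3
    refine h.congr_deriv ?_
    simp [exp_zero]
  have hslope := hder.tendsto_slope_zero
  have hinv : Tendsto (fun n : ℕ => ((n : ℝ))⁻¹) atTop (𝓝[≠] 0) := by
    rw [tendsto_nhdsWithin_iff]
    refine ⟨tendsto_inv_atTop_nhds_zero_nat, ?_⟩
    filter_upwards [eventually_gt_atTop 0] with n hn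
    simp; omega
  have hlim := (hslope.comp hinv).norm.mul_const (Real.exp (‖A‖ + ‖B‖))
  simp only [norm_zero, zero_mul] at hlim
  rw [tendsto_iff_norm_sub_tendsto_zero]
  refine squeeze_zero' (Eventually.of_forall fun _ => norm_nonneg _) ?_ hlim
  filter_upwards [eventually_gt_atTop 0] with n hn
  obtain ⟨m, rfl⟩ : ∃ m, n = m + 1 := ⟨n - 1, by omega⟩
  have hn0 : (0 : ℝ) < ((m + 1 : ℕ) : ℝ) := by positivity
  set r : ℝ := ((m + 1 : ℕ) : ℝ)⁻¹ with hr
  have hr0 : 0 < r := by positivity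
  let +nondep : NormedAlgebra ℚ 𝔸 := NormedAlgebra.restrictScalars ℚ ℝ 𝔸
  have hQ : exp (A + B) = exp (r • (A + B)) ^ (m + 1) := by
    rw [← NormedSpace.exp_nsmul, ← Nat.cast_smul_eq_nsmul ℝ, smul_smul, hr, mul_inv_cancel₀ hn0.ne',
      one_smul]
  set c := Real.exp (r * (‖A‖ + ‖B‖)) with hc
  have hc1 : 1 ≤ c := Real.one_le_exp (by positivity)
  have b1 : ‖exp (r • A) * exp (r • B)‖ ≤ c := by
    refine (norm_mul_le _ _).trans ?_
    rw [hc, mul_add, Real.exp_add]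
    gcongr
    · exact (norm_exp_le_exp_norm' _).trans (by rw [norm_smul, Real.norm_of_nonneg hr0.le])
    · exact (norm_exp_le_exp_norm' _).trans (by rw [norm_smul, Real.norm_of_nonneg hr0.le])
  have b2 : ‖exp (r • (A + B))‖ ≤ c := by
    refine (norm_exp_le_exp_norm' _).trans ?_
    rw [norm_smul, Real.norm_of_nonneg hr0.le, hc]
    gcongr
    exact norm_add_le _ _
  rw [hQ]
  refine (norm_pow_sub_pow_le_of_norm_le b1 b2 m).trans ?_
  have hcm : c ^ m ≤ Real.exp (‖A‖ + ‖B‖) := by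
    calc c ^ m ≤ c ^ (m + 1) := pow_le_pow_right₀ hc1 (by omega)
      _ = _ := by
        rw [hc, ← Real.exp_nat_mul, ← mul_assoc, hr, mul_inv_cancel₀ hn0.ne', one_mul]
  simp only [Function.comp, zero_add, zero_smul, exp_zero, mul_one, sub_self, sub_zero]
  rw [norm_smul, norm_inv, Real.norm_of_nonneg hr0.le, hr, inv_inv, ← hr]
  calc _ ≤ ((m : ℝ) + 1) * Real.exp (‖A‖ + ‖B‖) * ‖exp (r • A) * exp (r • B) - exp (r • (A + B))‖ := by
        gcongr
    _ = _ := by push_cast; ring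

end BanachExp

/-! ### The Golden–Thompson inequality -/

section GoldenThompson

open Matrix Filter Topology NormedSpace

variable {ι : Type*} [Fintype ι] [DecidableEq ι]

/-- The Golden–Thompson inequality for real symmetric matrices. -/
theorem Matrix.trace_exp_add_le (A B : Matrix ι ι ℝ) (hA : Aᵀ = A) (hB : Bᵀ = B) :
    (exp (A + B)).trace ≤ (exp A * exp B).trace := by
  rcases isEmpty_or_nonempty ι with hι | hι
  · simp [Matrix.trace]
  -- The Lie formula is used along exponents `2 ^ k`, where the dyadic inequality applies; there the
  -- right-hand side does not depend on `k`.
  have hpow : Tendsto (fun k : ℕ => 2 ^ k) atTop atTop := tendsto_pow_atTop_atTop_of_one_lt (by norm_num)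
  have h := (tendsto_exp_smul_mul_exp_smul_pow A B).comp hpow
  have htr : Continuous (fun M : Matrix ι ι ℝ => M.trace) := continuous_id.matrix_trace
  have h' := (htr.tendsto _).comp h
  refine le_of_tendsto h' (Eventually.of_forall fun k => ?_)
  simp only [Function.comp]
  have hsymm : ∀ (r : ℝ) (M : Matrix ι ι ℝ), Mᵀ = M → (exp (r • M))ᵀ = exp (r • M) := by
    intro r M hM
    rw [← Matrix.exp_transpose, Matrix.transpose_smul, hM]
  refine (Matrix.trace_mul_pow_two_pow_le k _ _ (hsymm _ A hA) (hsymm _ B hB)).trans (le_of_eq ?_)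
  have hk : ((2 ^ k : ℕ) : ℝ) ≠ 0 := by positivity
  have e : ∀ M : Matrix ι ι ℝ, exp ((((2 ^ k : ℕ) : ℝ))⁻¹ • M) ^ 2 ^ k = exp M := by
    intro M
    rw [← Matrix.exp_nsmul, ← Nat.cast_smul_eq_nsmul ℝ, smul_smul, mul_inv_cancel₀ hk, one_smul]
  rw [e, e]

end GoldenThompson

/-! ### Traces, eigenvectors and exponentials of symmetric matrices -/

section SymmetricMatrices

open Matrix NormedSpace

variable {ι : Type*} [Fintype ι]

/-- With `E = Rᴴ R`, the trace of `E G` is the sum of the quadratic form of `G` over the rows of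
`R`. -/
theorem Matrix.trace_mul_le_of_posSemidef {E G : Matrix ι ι ℝ} {c : ℝ} (hE : E.PosSemidef)
    (hG : ∀ v : ι → ℝ, v ⬝ᵥ G *ᵥ v ≤ c * (v ⬝ᵥ v)) : (E * G).trace ≤ c * E.trace := by
  classical
  obtain ⟨R, rfl⟩ : ∃ R, E = Rᴴ * R := by
    open scoped MatrixOrder in
    exact CStarAlgebra.nonneg_iff_eq_star_mul_self.mp hE.nonneg
  rw [Matrix.mul_assoc, Matrix.trace_mul_comm, Matrix.trace_mul_comm Rᴴ R]
  have h1 : (R * G * Rᴴ).trace = ∑ i, R i ⬝ᵥ G *ᵥ R i := by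
    simp only [Matrix.trace, Matrix.diag_apply, Matrix.mul_apply, dotProduct, Matrix.mulVec,
      Matrix.conjTranspose_apply, star_trivial, Finset.mul_sum, Finset.sum_mul]
    refine Finset.sum_congr rfl fun i _ => ?_
    rw [Finset.sum_comm]
    exact Finset.sum_congr rfl fun _ _ => Finset.sum_congr rfl fun _ _ => by ring
  have h2 : (R * Rᴴ).trace = ∑ i, R i ⬝ᵥ R i := by
    simp [Matrix.trace, Matrix.mul_apply, dotProduct]
  rw [h1, h2, Finset.mul_sum]
  exact Finset.sum_le_sum fun i _ => hG _

/-- Test the form on `e_i ± e_j`. This makes the entries integrable as soon as the trace is. -/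
theorem Matrix.PosSemidef.abs_apply_le_trace {M : Matrix ι ι ℝ} (hM : M.PosSemidef) (i j : ι) :
    |M i j| ≤ M.trace := by
  classical
  have hd : ∀ k, 0 ≤ M k k := fun k => hM.diag_nonneg
  have htr : ∀ k, M k k ≤ M.trace := fun k =>
    Finset.single_le_sum (f := fun k => M k k) (fun k _ => hd k) (Finset.mem_univ k)
  have hs : M j i = M i j := by simpa using hM.isHermitian.apply i j
  have h1 := hM.dotProduct_mulVec_nonneg (Pi.single i 1 + Pi.single j 1)
  have h2 := hM.dotProduct_mulVec_nonneg (Pi.single i 1 - Pi.single j 1)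
  simp [Matrix.mulVec_add, Matrix.mulVec_sub, add_dotProduct, sub_dotProduct] at h1 h2
  have := htr i
  have := htr j
  rw [abs_le]
  constructor <;> linarith

variable [DecidableEq ι]

theorem Matrix.posSemidef_exp {A : Matrix ι ι ℝ} (hA : Aᵀ = A) : (exp A).PosSemidef := by
  have h : exp A = (exp ((1 / 2 : ℝ) • A))ᴴ * exp ((1 / 2 : ℝ) • A) := by
    rw [← Matrix.exp_conjTranspose, Matrix.conjTranspose_smul, Matrix.conjTranspose_eq_transpose_of_trivial, hA, star_trivial,
      ← Matrix.exp_add_of_commute _ _ (Commute.refl _), ← add_smul]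
    norm_num
  rw [h]
  exact Matrix.posSemidef_conjTranspose_mul_self _

theorem Matrix.abs_dotProduct_mulVec_le (B : Matrix ι ι ℝ) (v : ι → ℝ) :
    |v ⬝ᵥ B *ᵥ v| ≤ ‖B‖ * (v ⬝ᵥ v) := by
  have h1 := Matrix.l2_opNorm_mulVec B (WithLp.toLp 2 v)
  have h2 := abs_real_inner_le_norm (WithLp.toLp 2 (B *ᵥ v)) (WithLp.toLp 2 v)
  rw [EuclideanSpace.inner_toLp_toLp] at h2
  have h3 : v ⬝ᵥ v = ‖WithLp.toLp 2 v‖ ^ 2 := by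
    rw [← real_inner_self_eq_norm_sq, EuclideanSpace.inner_toLp_toLp]; simp
  rw [h3]
  simp only [star_trivial] at h2
  refine h2.trans ?_
  have h4 : ‖WithLp.toLp 2 (B *ᵥ v)‖ ≤ ‖B‖ * ‖WithLp.toLp 2 v‖ := h1
  nlinarith [norm_nonneg (WithLp.toLp 2 v)]

theorem Matrix.IsHermitian.exists_norm_eq_abs_eigenvalues [Nonempty ι] {A : Matrix ι ι ℝ}
    (hA : A.IsHermitian) : ∃ i, ‖A‖ = |hA.eigenvalues i| := by
  have h : ‖A‖ = ‖hA.eigenvalues‖ := by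
    conv_lhs => rw [hA.spectral_theorem]
    rw [Unitary.conjStarAlgAut_apply, ← Unitary.coe_star, CStarRing.norm_mul_coe_unitary,
      CStarRing.norm_coe_unitary_mul, Matrix.l2_opNorm_diagonal]
    rfl
  obtain ⟨i, hi⟩ := Finite.exists_max fun i => ‖hA.eigenvalues i‖
  refine ⟨i, h.trans (le_antisymm ?_ (norm_le_pi_norm hA.eigenvalues i))⟩
  exact (pi_norm_le_iff_of_nonneg (norm_nonneg _)).2 hi

/-- The form in which the spectral theorem is used below: a large norm is witnessed by an eigenpair,
on which quadratic forms and exponentials are explicit. -/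
theorem Matrix.IsHermitian.exists_unit_eigenvector [Nonempty ι] {A : Matrix ι ι ℝ}
    (hA : A.IsHermitian) : ∃ (μ : ℝ) (v : ι → ℝ), A *ᵥ v = μ • v ∧ v ⬝ᵥ v = 1 ∧ ‖A‖ = |μ| := by
  obtain ⟨i, hi⟩ := hA.exists_norm_eq_abs_eigenvalues
  refine ⟨_, _, hA.mulVec_eigenvectorBasis i, ?_, hi⟩
  have h := hA.eigenvectorBasis.orthonormal.1 i
  have h3 : ‖hA.eigenvectorBasis i‖ ^ 2 = 1 := by rw [h]; norm_num
  rw [← real_inner_self_eq_norm_sq, EuclideanSpace.inner_eq_star_dotProduct] at h3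
  simpa using h3

/-- For an eigenvector with eigenvalue `μ`, the exponential has eigenvalue `e ^ μ`. -/
theorem Matrix.exp_mulVec_of_mulVec_eq_smul {A : Matrix ι ι ℝ} {μ : ℝ} {v : ι → ℝ}
    (h : A *ᵥ v = μ • v) : exp A *ᵥ v = Real.exp μ • v := by
  have hs := NormedSpace.exp_series_hasSum_exp' (𝕂 := ℝ) A
  have hr : HasSum (fun n : ℕ => ((n.factorial : ℝ)⁻¹) • μ ^ n) (Real.exp μ) := by
    rw [Real.exp_eq_exp_ℝ]; exact NormedSpace.exp_series_hasSum_exp' (𝕂 := ℝ) μ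
  have hpow : ∀ n : ℕ, (A ^ n) *ᵥ v = μ ^ n • v := by
    intro n
    induction n with
    | zero => simp
    | succ n ih => rw [pow_succ', ← Matrix.mulVec_mulVec, ih, Matrix.mulVec_smul, h, smul_smul,
        pow_succ]
  have hc : Continuous (fun M : Matrix ι ι ℝ => M *ᵥ v) :=
    continuous_id.matrix_mulVec continuous_const
  have h1 := hs.map (AddMonoidHom.mk' (fun M : Matrix ι ι ℝ => M *ᵥ v)
    (fun a b => Matrix.add_mulVec a b v)) hc
  have h2 := hr.smul_const v
  refine h1.unique ?_
  convert h2 using 2 with n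
  simp [Matrix.smul_mulVec, hpow, smul_smul]

/-- The projection `v vᵀ` is at most the identity, and `v ⬝ᵥ exp A *ᵥ v` is the trace of `exp A * v
vᵀ`. -/
theorem Matrix.exp_le_trace_exp {A : Matrix ι ι ℝ} (hA : Aᵀ = A) {μ : ℝ} {v : ι → ℝ}
    (h : A *ᵥ v = μ • v) (hv : v ⬝ᵥ v = 1) : Real.exp μ ≤ (exp A).trace := by
  have hE := Matrix.posSemidef_exp hA
  have h1 : Real.exp μ = v ⬝ᵥ exp A *ᵥ v := by
    rw [Matrix.exp_mulVec_of_mulVec_eq_smul h]; simp [hv]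
  have h2 := Matrix.trace_mul_le_of_posSemidef (E := exp A) (G := Matrix.vecMulVec v v) (c := 1) hE
    (fun w => by
      rw [Matrix.vecMulVec_mulVec]
      simp only [dotProduct_smul, op_smul_eq_smul]
      have := Finset.sum_mul_sq_le_sq_mul_sq Finset.univ v w
      have e : ∀ x : ι → ℝ, x ⬝ᵥ x = ∑ i, x i ^ 2 := fun x => by simp [dotProduct, sq]
      rw [← e, ← e, hv] at this
      simp only [smul_eq_mul]
      rw [dotProduct_comm w v, one_mul]
      calc _ = (v ⬝ᵥ w) ^ 2 := by ring
        _ ≤ _ := by simpa [dotProduct] using this)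
  rw [h1]
  have h3 : (exp A * Matrix.vecMulVec v v).trace = v ⬝ᵥ exp A *ᵥ v := by
    rw [Matrix.mul_vecMulVec, Matrix.trace_vecMulVec, dotProduct_comm]
  rw [h3] at h2
  linarith

end SymmetricMatrices

/-! ### Exponential moments of sums of independent random matrices -/

section MatrixConcentration

set_option linter.unusedSectionVars false

open Matrix NormedSpace

variable {ι : Type*} [Fintype ι] [DecidableEq ι]

theorem Matrix.continuous_exp_apply (i j : ι) :
    Continuous fun f : ι → ι → ℝ => (exp (Matrix.of f)) i j := by
  have h : Continuous fun M : Matrix ι ι ℝ => exp M := by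
    let +nondep : NormedAlgebra ℚ (Matrix ι ι ℝ) := NormedAlgebra.restrictScalars ℚ ℝ _
    exact NormedSpace.exp_continuous
  exact (h.matrix_elem i j)

theorem Matrix.measurable_exp_apply {β : Type*} [MeasurableSpace β] {F : β → Matrix ι ι ℝ}
    (hF : ∀ i j, Measurable fun b => F b i j) (i j : ι) :
    Measurable fun b => (exp (F b)) i j :=
  (Matrix.continuous_exp_apply i j).measurable.comp
    (measurable_pi_lambda _ fun i => measurable_pi_lambda _ fun j => hF i j)

variable {Ω β κ : Type*} [MeasurableSpace Ω] [MeasurableSpace β] {P : Measure Ω}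
  [IsProbabilityMeasure P]

theorem integral_quadForm {M : Ω → Matrix ι ι ℝ} (hM : ∀ i j, Integrable (fun ω => M ω i j) P)
    (v : ι → ℝ) :
    v ⬝ᵥ (Matrix.of fun i j => ∫ ω, M ω i j ∂P) *ᵥ v = ∫ ω, v ⬝ᵥ M ω *ᵥ v ∂P := by
  simp only [dotProduct, Matrix.mulVec, Matrix.of_apply]
  rw [integral_finsetSum _ fun i _ => (integrable_finsetSum _ fun j _ =>
    (hM i j).mul_const _).const_mul _]
  refine Finset.sum_congr rfl fun i _ => ?_
  rw [integral_const_mul, integral_finsetSum _ fun j _ => (hM i j).mul_const _]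
  simp only [integral_mul_const]

theorem integrable_quadForm {M : Ω → Matrix ι ι ℝ} (hM : ∀ i j, Integrable (fun ω => M ω i j) P)
    (v : ι → ℝ) : Integrable (fun ω => v ⬝ᵥ M ω *ᵥ v) P := by
  simp only [dotProduct, Matrix.mulVec]
  exact integrable_finsetSum _ fun i _ => (integrable_finsetSum _ fun j _ =>
    (hM i j).mul_const _).const_mul _

/-- Trace moment generating function of a sum of independent symmetric random matrices. -/
theorem integral_trace_exp_sum_le {q : κ → Ω → β} (hq : ∀ k, Measurable (q k))
    (hind : iIndepFun q P) {F : κ → β → Matrix ι ι ℝ}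
    (hF : ∀ k i j, Measurable fun b => F k b i j) (hsymm : ∀ k b, (F k b)ᵀ = F k b)
    (hint : ∀ k i j, Integrable (fun ω => (exp (F k (q k ω))) i j) P) {c : ℝ}
    (hc : ∀ k (v : ι → ℝ), ∫ ω, v ⬝ᵥ exp (F k (q k ω)) *ᵥ v ∂P ≤ c * (v ⬝ᵥ v))
    (s : Finset κ) :
    Integrable (fun ω => (exp (∑ k ∈ s, F k (q k ω))).trace) P ∧
      ∫ ω, (exp (∑ k ∈ s, F k (q k ω))).trace ∂P ≤ Fintype.card ι * c ^ s.card := by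
  classical
  induction s using Finset.induction_on with
  | empty => simp [NormedSpace.exp_zero]
  | insert a s ha ih =>
    obtain ⟨ih1, ih2⟩ := ih
    have hsum_symm : ∀ ω, (∑ k ∈ s, F k (q k ω))ᵀ = ∑ k ∈ s, F k (q k ω) := fun ω => by
      rw [Matrix.transpose_sum]; exact Finset.sum_congr rfl fun k _ => hsymm k _
    have hpsd : ∀ ω, (exp (∑ k ∈ s, F k (q k ω))).PosSemidef := fun ω =>
      Matrix.posSemidef_exp (hsum_symm ω)
    have hmeasS : ∀ i j, Measurable fun ω => (exp (∑ k ∈ s, F k (q k ω))) i j :=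
      Matrix.measurable_exp_apply fun i j => by
        simp only [Matrix.sum_apply]
        exact Finset.measurable_sum _ fun k _ => (hF k i j).comp (hq k)
    have hintS : ∀ i j, Integrable (fun ω => (exp (∑ k ∈ s, F k (q k ω))) i j) P := fun i j =>
      ih1.mono' (hmeasS i j).aestronglyMeasurable
        (Filter.Eventually.of_forall fun ω => (hpsd ω).abs_apply_le_trace i j)
    have hindep : ∀ i j i' j', IndepFun (fun ω => (exp (∑ k ∈ s, F k (q k ω))) i j)
        (fun ω => (exp (F a (q a ω))) i' j') P := by
      intro i j i' j'
      have h0 := hind.indepFun_finset s {a} (by simpa using ha) hq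
      have hφ : Measurable fun x : s → β => (exp (∑ k : s, F k (x k))) i j :=
        Matrix.measurable_exp_apply (fun i j => by
          simp only [Matrix.sum_apply]
          exact Finset.measurable_sum _ fun k _ => (hF k i j).comp (measurable_pi_apply k)) i j
      have hψ : Measurable fun x : ({a} : Finset κ) → β =>
          (exp (F a (x ⟨a, Finset.mem_singleton_self a⟩))) i' j' :=
        Matrix.measurable_exp_apply (fun i j => (hF a i j).comp (measurable_pi_apply _)) i' j'
      have h1 := h0.comp hφ hψ
      have e1 : (fun ω => (exp (∑ k ∈ s, F k (q k ω))) i j) =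
          (fun x : s → β => (exp (∑ k : s, F k (x k))) i j) ∘ fun ω k => q k ω := by
        funext ω
        simp only [Function.comp]
        rw [← Finset.sum_coe_sort s (fun k => F k (q k ω))]
      rw [e1]
      exact h1
    have hprod : ∀ i j i' j', Integrable (fun ω => (exp (∑ k ∈ s, F k (q k ω))) i j *
        (exp (F a (q a ω))) i' j') P := fun i j i' j' =>
      (hindep i j i' j').integrable_mul (hintS i j) (hint a i' j')
    have hmulint : Integrable
        (fun ω => (exp (∑ k ∈ s, F k (q k ω)) * exp (F a (q a ω))).trace) P := by
      simp only [Matrix.trace, Matrix.diag_apply, Matrix.mul_apply]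
      exact integrable_finsetSum _ fun i _ => integrable_finsetSum _ fun j _ => hprod _ _ _ _
    -- Golden–Thompson splits off the new summand. By independence the expected trace of the product
    -- is `(E * G).trace` for the two mean matrices, with `E` positive semidefinite and `G` bounded
    -- by `c`.
    have hGT : ∀ ω, (exp (∑ k ∈ insert a s, F k (q k ω))).trace
        ≤ (exp (∑ k ∈ s, F k (q k ω)) * exp (F a (q a ω))).trace := fun ω => by
      rw [Finset.sum_insert ha, add_comm]
      exact Matrix.trace_exp_add_le _ _ (hsum_symm ω) (hsymm a _)
    have hnn : ∀ ω, 0 ≤ (exp (∑ k ∈ insert a s, F k (q k ω))).trace := fun ω =>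
      (Matrix.posSemidef_exp (by
        rw [Matrix.transpose_sum]; exact Finset.sum_congr rfl fun k _ => hsymm k _)).trace_nonneg
    have hmeasI : Measurable fun ω => (exp (∑ k ∈ insert a s, F k (q k ω))).trace := by
      simp only [Matrix.trace, Matrix.diag_apply]
      refine Finset.measurable_sum _ fun i _ => Matrix.measurable_exp_apply (fun i j => ?_) i i
      simp only [Matrix.sum_apply]
      exact Finset.measurable_sum _ fun k _ => (hF k i j).comp (hq k)
    have hI : Integrable (fun ω => (exp (∑ k ∈ insert a s, F k (q k ω))).trace) P :=
      hmulint.mono' hmeasI.aestronglyMeasurable (Filter.Eventually.of_forall fun ω => by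
        rw [Real.norm_of_nonneg (hnn ω)]; exact hGT ω)
    refine ⟨hI, ?_⟩
    set E : Matrix ι ι ℝ := Matrix.of fun i j => ∫ ω, (exp (∑ k ∈ s, F k (q k ω))) i j ∂P with hE
    set G : Matrix ι ι ℝ := Matrix.of fun i j => ∫ ω, (exp (F a (q a ω))) i j ∂P with hG
    have hEpsd : E.PosSemidef := by
      refine .of_dotProduct_mulVec_nonneg ?_ fun v => ?_
      · ext i j
        simp only [hE, Matrix.conjTranspose_apply, Matrix.of_apply, star_trivial]
        exact integral_congr_ae (Filter.Eventually.of_forall fun ω => by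
          simpa using (hpsd ω).isHermitian.apply i j)
      · rw [star_trivial, hE, integral_quadForm hintS v]
        exact integral_nonneg fun ω => by simpa using (hpsd ω).dotProduct_mulVec_nonneg v
    have hGle : ∀ v : ι → ℝ, v ⬝ᵥ G *ᵥ v ≤ c * (v ⬝ᵥ v) := fun v => by
      rw [hG, integral_quadForm (hint a) v]; exact hc a v
    have hEtr : E.trace = ∫ ω, (exp (∑ k ∈ s, F k (q k ω))).trace ∂P := by
      simp only [Matrix.trace, Matrix.diag_apply]
      rw [integral_finsetSum _ fun i _ => hintS i i]
      rfl
    have hmulE : ∫ ω, (exp (∑ k ∈ s, F k (q k ω)) * exp (F a (q a ω))).trace ∂P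
        = (E * G).trace := by
      simp only [Matrix.trace, Matrix.diag_apply, Matrix.mul_apply]
      rw [integral_finsetSum _ fun i _ => integrable_finsetSum _ fun j _ => hprod _ _ _ _]
      refine Finset.sum_congr rfl fun i _ => ?_
      rw [integral_finsetSum _ fun j _ => hprod _ _ _ _]
      refine Finset.sum_congr rfl fun j _ => ?_
      exact (hindep i j j i).integral_fun_mul_eq_mul_integral (hintS i j).aestronglyMeasurable
        (hint a j i).aestronglyMeasurable
    rcases isEmpty_or_nonempty ι with hι | ⟨⟨i₀⟩⟩
    · simp [Matrix.trace]
    -- The sign of `c` comes from testing `hc` on a basis vector, hence the separate case of an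
    -- empty index type.
    have hc0 : 0 ≤ c := by
      have h := hc a (Pi.single i₀ 1)
      have h2 : 0 ≤ ∫ ω, Pi.single i₀ 1 ⬝ᵥ exp (F a (q a ω)) *ᵥ Pi.single i₀ 1 ∂P :=
        integral_nonneg fun ω => by
          have h := (Matrix.posSemidef_exp (hsymm a (q a ω))).dotProduct_mulVec_nonneg
            (Pi.single i₀ 1)
          rw [star_trivial] at h
          exact h
      simpa using h2.trans h
    calc _ ≤ ∫ ω, (exp (∑ k ∈ s, F k (q k ω)) * exp (F a (q a ω))).trace ∂P :=
          integral_mono hI hmulint hGT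
      _ = (E * G).trace := hmulE
      _ ≤ c * E.trace := Matrix.trace_mul_le_of_posSemidef hEpsd hGle
      _ ≤ c * (Fintype.card ι * c ^ s.card) := by rw [hEtr]; gcongr
      _ = _ := by rw [Finset.card_insert_of_notMem ha]; ring

/-- A one-matrix bound for the exponential moment of a centered symmetric random matrix. -/
theorem integral_quadForm_exp_le {Z : Ω → Matrix ι ι ℝ} (hZ : ∀ i j, Measurable fun ω => Z ω i j)
    {b : Ω → ℝ} (hb : Measurable b) (hZb : ∀ ω, ‖Z ω‖ ≤ b ω)
    (hexp : Integrable (fun ω => Real.exp (b ω)) P)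
    (hmean : ∀ i j, ∫ ω, Z ω i j ∂P = 0) {ψ : ℝ}
    (hψ : ∫ ω, (Real.exp (b ω) - 1 - b ω) ∂P ≤ ψ) :
    (∀ i j, Integrable (fun ω => (exp (Z ω)) i j) P) ∧
    ∀ v : ι → ℝ, ∫ ω, v ⬝ᵥ exp (Z ω) *ᵥ v ∂P ≤ (1 + ψ) * (v ⬝ᵥ v) := by
  have hb0 : ∀ ω, 0 ≤ b ω := fun ω => (norm_nonneg _).trans (hZb ω)
  have hbint : Integrable b P := hexp.mono' hb.aestronglyMeasurable
    (Filter.Eventually.of_forall fun ω => by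
      rw [Real.norm_of_nonneg (hb0 ω)]; linarith [Real.add_one_le_exp (b ω)])
  have hentry : ∀ (M : Matrix ι ι ℝ) i j, |M i j| ≤ ‖M‖ := fun M i j => by
    have h := Matrix.l2_opNorm_mulVec M (EuclideanSpace.single j (1 : ℝ))
    have h2 := (PiLp.norm_apply_le ((EuclideanSpace.equiv ι ℝ).symm
      (M *ᵥ (EuclideanSpace.single j (1 : ℝ)).ofLp)) i).trans h
    simpa using h2
  have hZint : ∀ i j, Integrable (fun ω => Z ω i j) P := fun i j =>
    hbint.mono' (hZ i j).aestronglyMeasurable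
      (Filter.Eventually.of_forall fun ω => (hentry _ i j).trans (hZb ω))
  -- Monotonicity of `x ↦ e^x - 1 - x` on `[0, ∞)` lets the norm of `Z` be replaced by its scalar
  -- bound `b`. The linear term has mean zero and drops out.
  have hmono : ∀ {x y : ℝ}, 0 ≤ x → x ≤ y → Real.exp x - 1 - x ≤ Real.exp y - 1 - y := by
    intro x y hx hxy
    have h1 := Real.add_one_le_exp (y - x)
    have h2 : Real.exp y = Real.exp x * Real.exp (y - x) := by rw [← Real.exp_add]; ring_nf
    have h3 := Real.one_le_exp hx
    nlinarith
  have hrem : ∀ ω, ‖exp (Z ω) - 1 - Z ω‖ ≤ Real.exp (b ω) - 1 - b ω := fun ω =>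
    (norm_exp_sub_one_sub_le _).trans (hmono (norm_nonneg _) (hZb ω))
  have hremint : Integrable (fun ω => Real.exp (b ω) - 1 - b ω) P :=
    (hexp.sub (integrable_const 1)).sub hbint
  have hEm := Matrix.measurable_exp_apply hZ
  have hEint : ∀ i j, Integrable (fun ω => (exp (Z ω)) i j) P := fun i j => by
    have h1 : Integrable (fun ω => (exp (Z ω) - 1 - Z ω) i j) P :=
      hremint.mono' (((hEm i j).sub_const _).sub (hZ i j)).aestronglyMeasurable
        (Filter.Eventually.of_forall fun ω => (hentry _ i j).trans (hrem ω))
    refine ((h1.add (integrable_const ((1 : Matrix ι ι ℝ) i j))).add (hZint i j)).congr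
      (Filter.Eventually.of_forall fun ω => ?_)
    simp only [Matrix.sub_apply, Pi.add_apply]
    ring
  refine ⟨hEint, fun v => ?_⟩
  have hZ0 : ∫ ω, v ⬝ᵥ Z ω *ᵥ v ∂P = 0 := by
    simp only [dotProduct, Matrix.mulVec]
    rw [integral_finsetSum _ fun i _ => (integrable_finsetSum _ fun j _ =>
        (hZint i j).mul_const _).const_mul _]
    refine Finset.sum_eq_zero fun i _ => ?_
    rw [integral_const_mul, integral_finsetSum _ fun j _ => (hZint i j).mul_const _]
    simp [integral_mul_const, hmean]
  have hpt : ∀ ω, v ⬝ᵥ exp (Z ω) *ᵥ v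
      ≤ v ⬝ᵥ v + v ⬝ᵥ Z ω *ᵥ v + (Real.exp (b ω) - 1 - b ω) * (v ⬝ᵥ v) := fun ω => by
    have h1 := (abs_le.mp (Matrix.abs_dotProduct_mulVec_le (exp (Z ω) - 1 - Z ω) v)).2
    simp only [Matrix.sub_mulVec, Matrix.one_mulVec, dotProduct_sub] at h1
    have h2 : 0 ≤ v ⬝ᵥ v := by simpa using dotProduct_star_self_nonneg v
    have h3 := mul_le_mul_of_nonneg_right (hrem ω) h2
    linarith
  have hv : 0 ≤ v ⬝ᵥ v := by simpa using dotProduct_star_self_nonneg v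
  have hint1 : Integrable (fun ω => v ⬝ᵥ v + v ⬝ᵥ Z ω *ᵥ v) P :=
    (integrable_const _).add (integrable_quadForm hZint v)
  calc _ ≤ ∫ ω, (v ⬝ᵥ v + v ⬝ᵥ Z ω *ᵥ v + (Real.exp (b ω) - 1 - b ω) * (v ⬝ᵥ v)) ∂P :=
        integral_mono (integrable_quadForm hEint v) (hint1.add (hremint.mul_const _)) hpt
    _ = v ⬝ᵥ v + 0 + (∫ ω, (Real.exp (b ω) - 1 - b ω) ∂P) * (v ⬝ᵥ v) := by
        rw [integral_add hint1 (hremint.mul_const _),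
          integral_add (integrable_const _) (integrable_quadForm hZint v), hZ0, integral_mul_const]
        simp
    _ ≤ _ := by nlinarith

end MatrixConcentration

/-! ### Exponential moments of Gaussian squares -/

section GaussianSquare

theorem integral_exp_mul_sq_gaussianReal {s : ℝ} (hs : s < 1 / 2) :
    ∫ x : ℝ, Real.exp (s * x ^ 2) ∂(gaussianReal 0 1) = (√(1 - 2 * s))⁻¹ := by
  rw [integral_gaussianReal_eq_integral_smul (by norm_num)]
  have h : ∀ x : ℝ, gaussianPDFReal 0 1 x • Real.exp (s * x ^ 2)
      = (√(2 * Real.pi))⁻¹ * Real.exp (-(1 / 2 - s) * x ^ 2) := by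
    intro x
    rw [gaussianPDFReal_def]
    simp only [NNReal.coe_one, mul_one, sub_zero, smul_eq_mul]
    rw [mul_assoc, ← Real.exp_add]
    ring_nf
  simp_rw [h]
  rw [integral_const_mul, integral_gaussian, ← Real.sqrt_inv, ← Real.sqrt_mul (by positivity),
    ← Real.sqrt_inv]
  congr 1
  have : 1 - 2 * s ≠ 0 := by linarith
  have : 1 / 2 - s ≠ 0 := by linarith
  field_simp

theorem integrable_exp_mul_sq_gaussianReal {s : ℝ} (hs : s < 1 / 2) :
    Integrable (fun x : ℝ => Real.exp (s * x ^ 2)) (gaussianReal 0 1) := by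
  -- A non-integrable function has Bochner integral `0`, whereas the closed form is positive.
  by_contra h
  have h1 := integral_exp_mul_sq_gaussianReal hs
  rw [integral_undef h] at h1
  have : 0 < (√(1 - 2 * s))⁻¹ := inv_pos.2 (Real.sqrt_pos.2 (by linarith))
  linarith

end GaussianSquare

/-! ### Numerical bounds behind the exponents -/

section ScalarBounds

theorem exp_sub_one_sub_le_of_le_half {x : ℝ} (h0 : 0 ≤ x) (h1 : x ≤ 1 / 2) :
    Real.exp x - 1 - x ≤ 3 / 5 * x ^ 2 := by
  have h := Real.exp_bound' h0 (by linarith) (n := 4) (by norm_num)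
  simp [Finset.sum_range_succ, Nat.factorial] at h
  nlinarith [pow_nonneg h0 2, pow_nonneg h0 3, mul_nonneg (pow_nonneg h0 2) (sub_nonneg.2 h1), mul_nonneg (pow_nonneg h0 3) (sub_nonneg.2 h1)]

/-- Reduces an upper bound on `(1 - 2 θ)^(-1/2)` by a polynomial to a polynomial inequality. -/
theorem inv_sqrt_le_of_one_le_mul_sq {y z : ℝ} (hy : 0 < y) (hz : 0 ≤ z) (h : 1 ≤ y * z ^ 2) :
    (√y)⁻¹ ≤ z := by
  have h1 : 1 ≤ √y * z := by
    rw [← Real.sqrt_sq hz, ← Real.sqrt_mul hy.le]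
    exact Real.one_le_sqrt.2 h
  rw [inv_eq_one_div, div_le_iff₀ (Real.sqrt_pos.2 hy)]
  linarith

/-- A bound for `1 + E[e^b - 1 - b]` where `b = θ max(1, ξ²)`. -/
theorem psi_le_exp_of_le {u : ℝ} (h0 : 0 ≤ u) (h1 : u ≤ 1) :
    1 + ((Real.exp (9 / 20 * u) - 1 - 9 / 20 * u) + ((√(1 - 2 * (9 / 20 * u)))⁻¹ - 1 - 9 / 20 * u))
      ≤ Real.exp (7 / 6 * u ^ 2) := by
  obtain ⟨θ, hθ⟩ : ∃ θ, θ = 9 / 20 * u := ⟨_, rfl⟩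
  have hu : u = 20 / 9 * θ := by linarith
  rw [← hθ]
  have hu2 : 7 / 6 * u ^ 2 = 7 / 6 * (20 / 9 * θ) ^ 2 := by rw [← hu]
  rw [hu2]
  have t0 : 0 ≤ θ := by linarith
  have t1 : θ ≤ 9 / 20 := by linarith
  have hb1 := exp_sub_one_sub_le_of_le_half t0 (by linarith)
  have hb3 : 1 + 7 / 6 * (20 / 9 * θ) ^ 2 + (7 / 6 * (20 / 9 * θ) ^ 2) ^ 2 / 2 +
     (7 / 6 * (20 / 9 * θ) ^ 2) ^ 3 / 6 ≤ Real.exp (7 / 6 * (20 / 9 * θ) ^ 2) := by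
    have h := Real.sum_le_exp_of_nonneg (x := 7 / 6 * (20 / 9 * θ) ^ 2) (by positivity) 4
    simp [Finset.sum_range_succ, Nat.factorial] at h
    linarith
  -- The coefficients just fit under the Taylor coefficients of the target: `3/5 + 129/25 = 144/25 <
  -- 1400/243` at order two, and `33/2 < (1400/243)² / 2` at order four.
  have hb2 : (√(1 - 2 * θ))⁻¹ ≤ 1 + θ + 129 / 25 * θ ^ 2 + 33 / 2 * θ ^ 4 := by
    refine inv_sqrt_le_of_one_le_mul_sq (by linarith) (by positivity) ?_
    have hB : ∀ i j : ℕ, 0 ≤ u ^ i * (1 - u) ^ j := fun i j =>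
      mul_nonneg (pow_nonneg h0 i) (pow_nonneg (by linarith) j)
    have key : 0 ≤ ((1 - 2 * θ) * (1 + θ + 129 / 25 * θ ^ 2 + 33 / 2 * θ ^ 4) ^ 2 - 1) := by
      rw [hθ]
      -- Expansion in the Bernstein basis of degree nine on `[0, 1]`; every coefficient is
      -- nonnegative.
      have e : ((1 - 2 * (9 / 20 * u)) * (1 + 9 / 20 * u + 129 / 25 * (9 / 20 * u) ^ 2
        + 33 / 2 * (9 / 20 * u) ^ 4) ^ 2 - 1) = 14823 / 10000 * (u ^ 2 * (1 - u) ^ 7)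
        + 28917 / 3125 * (u ^ 3 * (1 - u) ^ 6)
        + 1299549663 / 50000000 * (u ^ 4 * (1 - u) ^ 5)
        + 82884578157 / 2000000000 * (u ^ 5 * (1 - u) ^ 4)
        + 319307523147 / 8000000000 * (u ^ 6 * (1 - u) ^ 3)
        + 352810409913 / 16000000000 * (u ^ 7 * (1 - u) ^ 2)
        + 2958080953221 / 512000000000 * (u ^ 8 * (1 - u) ^ 1)
        + 5983444161 / 1024000000000 * (u ^ 9 * (1 - u) ^ 0) := by ring
      rw [e]
      have := hB 2 7
      have := hB 3 6
      have := hB 4 5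
      have := hB 5 4
      have := hB 6 3
      have := hB 7 2
      have := hB 8 1
      have := hB 9 0
      linarith
    linarith
  have := pow_nonneg t0 2
  have := pow_nonneg t0 4
  have := pow_nonneg t0 6
  linarith

/-- The quadratic coefficients `3/5` and `17/5` add up to `4`. -/
theorem psi_le_exp_of_le_tenth {u : ℝ} (h0 : 0 ≤ u) (h1 : u ≤ 1 / 10) :
    1 + ((Real.exp u - 1 - u) + ((√(1 - 2 * u))⁻¹ - 1 - u)) ≤ Real.exp (4 * u ^ 2) := by
  have hb1 := exp_sub_one_sub_le_of_le_half h0 (by linarith)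
  have hb2 : (√(1 - 2 * u))⁻¹ ≤ 1 + u + 17 / 5 * u ^ 2 := by
    refine inv_sqrt_le_of_one_le_mul_sq (by linarith) (by positivity) ?_
    nlinarith [mul_nonneg (pow_nonneg h0 2) (sub_nonneg.2 h1),
      mul_nonneg (pow_nonneg h0 3) (sub_nonneg.2 h1), mul_nonneg (pow_nonneg h0 4) (sub_nonneg.2 h1),
      pow_nonneg h0 2, pow_nonneg h0 3, pow_nonneg h0 4]
  have := Real.add_one_le_exp (4 * u ^ 2)
  linarith

end ScalarBounds

set_option linter.unusedSectionVars false

/-! ### Tail bound for Gaussian-weighted sums of positive semidefinite matrices -/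

section GaussianWeightedSums

open Matrix NormedSpace

variable {ι : Type*} [Fintype ι] [DecidableEq ι] {Ω β κ : Type*} [MeasurableSpace Ω]
  [MeasurableSpace β] {P : Measure Ω} [IsProbabilityMeasure P] [Fintype κ]

theorem integral_sq_of_hasLaw_gaussianReal {g : Ω → ℝ} (hg : HasLaw g (gaussianReal 0 1) P) :
    Integrable (fun ω => g ω ^ 2) P ∧ ∫ ω, g ω ^ 2 ∂P = 1 := by
  constructor
  · have h := (memLp_id_gaussianReal (μ := 0) (v := 1) 2).integrable_sq
    rw [← hg.map_eq] at h
    exact h.comp_aemeasurable hg.aemeasurable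
  · have h := hg.integral_comp (f := fun x : ℝ => x ^ 2) (by fun_prop)
    have h2 : ∫ x : ℝ, x ^ 2 ∂(gaussianReal 0 1) = 1 := by
      have h3 := variance_id_gaussianReal (μ := 0) (v := 1)
      rw [variance_of_integral_eq_zero (by fun_prop) (by simp)] at h3
      simpa using h3
    rw [← h2]; exact h

/-- The exponential moment function of `max 1 ξ²` for a standard Gaussian `ξ`. -/
theorem integral_exp_max_one_sq_le {θ : ℝ} (h1 : θ < 1 / 2) {g : Ω → ℝ}
    (hg : HasLaw g (gaussianReal 0 1) P) :
    Integrable (fun ω => Real.exp (θ * max 1 (g ω ^ 2))) P ∧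
    ∫ ω, (Real.exp (θ * max 1 (g ω ^ 2)) - 1 - θ * max 1 (g ω ^ 2)) ∂P
      ≤ (Real.exp θ - 1 - θ) + ((√(1 - 2 * θ))⁻¹ - 1 - θ) := by
  have hgm := hg.aemeasurable
  have i1 : Integrable (fun ω => Real.exp (θ * g ω ^ 2)) P := by
    have := integrable_exp_mul_sq_gaussianReal h1
    rw [← hg.map_eq] at this
    exact this.comp_aemeasurable hgm
  have e1 : ∫ ω, Real.exp (θ * g ω ^ 2) ∂P = (√(1 - 2 * θ))⁻¹ := by
    rw [← integral_exp_mul_sq_gaussianReal h1]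
    exact hg.integral_comp (f := fun x => Real.exp (θ * x ^ 2)) (by fun_prop)
  obtain ⟨i2, e2⟩ := integral_sq_of_hasLaw_gaussianReal hg
  have hmaxm : AEMeasurable (fun ω => max 1 (g ω ^ 2)) P := by fun_prop
  have i3 : Integrable (fun ω => Real.exp (θ * max 1 (g ω ^ 2))) P := by
    refine (i1.add (integrable_const (Real.exp θ))).mono' (by fun_prop)
      (Filter.Eventually.of_forall fun ω => ?_)
    rw [Real.norm_of_nonneg (Real.exp_nonneg _)]
    have := Real.exp_pos θ
    have := Real.exp_pos (θ * g ω ^ 2)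
    rcases max_cases 1 (g ω ^ 2) with ⟨h, _⟩ | ⟨h, _⟩ <;> rw [h] <;>
      simp only [Pi.add_apply, mul_one] <;> linarith
  have i4 : Integrable (fun ω => max 1 (g ω ^ 2)) P := (integrable_const 1).sup i2
  refine ⟨i3, ?_⟩
  -- Since `e^x - 1 - x ≥ 0`, its value at a maximum is at most the sum of its values at both
  -- arguments.
  have hpt : ∀ ω, Real.exp (θ * max 1 (g ω ^ 2)) - 1 - θ * max 1 (g ω ^ 2)
      ≤ (Real.exp θ - 1 - θ) + (Real.exp (θ * g ω ^ 2) - 1 - θ * g ω ^ 2) := fun ω => by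
    have := Real.add_one_le_exp θ
    have := Real.add_one_le_exp (θ * g ω ^ 2)
    rcases max_cases 1 (g ω ^ 2) with ⟨h, _⟩ | ⟨h, _⟩ <;> rw [h] <;>
      (try simp only [mul_one]) <;> linarith
  have i5 : Integrable (fun ω => Real.exp (θ * g ω ^ 2) - 1) P := i1.sub (integrable_const 1)
  have i6 : Integrable (fun ω => θ * g ω ^ 2) P := i2.const_mul θ
  have i7 : Integrable (fun ω => Real.exp (θ * g ω ^ 2) - 1 - θ * g ω ^ 2) P := i5.sub i6
  refine (integral_mono ((i3.sub (integrable_const 1)).sub (i4.const_mul θ))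
    ((integrable_const _).add i7) hpt).trans (le_of_eq ?_)
  rw [integral_add' (integrable_const _) i7, integral_sub i5 i6, integral_sub i1 (integrable_const 1),
    integral_const_mul, e1, e2]
  simp

variable {q : κ → Ω → β} {A : β → Matrix ι ι ℝ} {α : β → ℝ} {M : ℝ}

/-- Independent `q k`, and a positive semidefinite matrix function `A` of them that is bounded by
`M` times the square of a standard Gaussian function `α` of them. -/
structure GaussianWeighted (P : Measure Ω) (q : κ → Ω → β) (A : β → Matrix ι ι ℝ) (α : β → ℝ)
    (M : ℝ) : Prop where
  meas_q : ∀ k, Measurable (q k)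
  indep : iIndepFun q P
  meas_A : ∀ i j, Measurable fun b => A b i j
  psd : ∀ b, (A b).PosSemidef
  meas_α : Measurable α
  law : ∀ k, HasLaw (fun ω => α (q k ω)) (gaussianReal 0 1) P
  pos : 0 < M
  bound : ∀ b (v : ι → ℝ), v ⬝ᵥ A b *ᵥ v ≤ α b ^ 2 * M * (v ⬝ᵥ v)

namespace GaussianWeighted

theorem integrable_apply (h : GaussianWeighted P q A α M) (k : κ) (i j : ι) :
    Integrable (fun ω => A (q k ω) i j) P := by
  refine ((integral_sq_of_hasLaw_gaussianReal (h.law k)).1.mul_const (M * Fintype.card ι)).mono'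
    ((h.meas_A i j).comp (h.meas_q k)).aestronglyMeasurable
    (Filter.Eventually.of_forall fun ω => ((h.psd _).abs_apply_le_trace i j).trans ?_)
  have h1 : (A (q k ω)).trace = ∑ i, Pi.single i 1 ⬝ᵥ A (q k ω) *ᵥ Pi.single i 1 := by
    simp [Matrix.trace]
  rw [h1]
  refine (Finset.sum_le_sum fun i _ => h.bound _ (Pi.single i 1)).trans (le_of_eq ?_)
  simp
  ring

/-- The mean of the `k`-th summand. -/
noncomputable def mean (P : Measure Ω) (q : κ → Ω → β) (A : β → Matrix ι ι ℝ) (k : κ) : Matrix ι ι ℝ :=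
  Matrix.of fun i j => ∫ ω, A (q k ω) i j ∂P

theorem mean_nonneg (h : GaussianWeighted P q A α M) (k : κ) (v : ι → ℝ) :
    0 ≤ v ⬝ᵥ mean P q A k *ᵥ v := by
  rw [mean, integral_quadForm (h.integrable_apply k) v]
  exact integral_nonneg fun ω => by simpa using (h.psd (q k ω)).dotProduct_mulVec_nonneg v

theorem mean_le (h : GaussianWeighted P q A α M) (k : κ) (v : ι → ℝ) :
    v ⬝ᵥ mean P q A k *ᵥ v ≤ M * (v ⬝ᵥ v) := by
  rw [mean, integral_quadForm (h.integrable_apply k) v]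
  have h2 := integral_sq_of_hasLaw_gaussianReal (h.law k)
  refine (integral_mono (integrable_quadForm (h.integrable_apply k) v)
    ((h2.1.mul_const M).mul_const (v ⬝ᵥ v)) fun ω => h.bound (q k ω) v).trans (le_of_eq ?_)
  simp only [integral_mul_const]
  rw [h2.2, one_mul]

theorem mean_transpose (h : GaussianWeighted P q A α M) (k : κ) :
    (mean P q A k)ᵀ = mean P q A k := by
  ext i j
  simp only [mean, Matrix.transpose_apply, Matrix.of_apply]
  exact integral_congr_ae (Filter.Eventually.of_forall fun ω => by
    simpa using (h.psd (q k ω)).isHermitian.apply i j)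

theorem transpose_apply_eq (h : GaussianWeighted P q A α M) (b : β) : (A b)ᵀ = A b := by
  simpa [Matrix.IsHermitian, Matrix.conjTranspose_eq_transpose_of_trivial]
    using (h.psd b).isHermitian

/-- Both matrices are positive semidefinite, so the eigenvalues of the difference lie between `-M`
and `α² M`. This gives a maximum where the triangle inequality would give a sum. -/
theorem norm_centered_le (h : GaussianWeighted P q A α M) (k : κ) (b : β) :
    ‖A b - mean P q A k‖ ≤ M * max 1 (α b ^ 2) := by
  have hM := h.pos
  rcases isEmpty_or_nonempty ι with hι | hι
  · rw [Subsingleton.elim (A b - mean P q A k) 0, norm_zero]; positivity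
  have hs : (A b - mean P q A k).IsHermitian := by
    rw [Matrix.IsHermitian, Matrix.conjTranspose_eq_transpose_of_trivial, Matrix.transpose_sub,
      h.transpose_apply_eq, h.mean_transpose]
  obtain ⟨μ, v, hv, hv1, hn⟩ := hs.exists_unit_eigenvector
  have hμ : v ⬝ᵥ (A b - mean P q A k) *ᵥ v = μ := by rw [hv]; simp [hv1]
  rw [Matrix.sub_mulVec, dotProduct_sub] at hμ
  have h1 := h.bound b v
  have h2 : 0 ≤ v ⬝ᵥ A b *ᵥ v := by simpa using (h.psd b).dotProduct_mulVec_nonneg v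
  have h3 := h.mean_nonneg k v
  have h4 := h.mean_le k v
  rw [hv1] at h1 h4
  have h5 : M * 1 ≤ M * max 1 (α b ^ 2) := by gcongr; exact le_max_left _ _
  have h6 : M * α b ^ 2 ≤ M * max 1 (α b ^ 2) := by gcongr; exact le_max_right _ _
  rw [hn, abs_le]
  constructor <;> linarith

/-- The centered sum. -/
noncomputable def centered (P : Measure Ω) (q : κ → Ω → β) (A : β → Matrix ι ι ℝ) (ω : Ω) : Matrix ι ι ℝ :=
  ∑ k, (A (q k ω) - mean P q A k)

theorem centered_transpose (h : GaussianWeighted P q A α M) (ω : Ω) :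
    (centered P q A ω)ᵀ = centered P q A ω := by
  rw [centered, Matrix.transpose_sum]
  exact Finset.sum_congr rfl fun k _ => by
    rw [Matrix.transpose_sub, h.transpose_apply_eq, h.mean_transpose]

/-- Markov's inequality for the trace of the exponential of the centered sum scaled by `ε θ / M`;
the sign `ε` selects an end of the spectrum. -/
theorem measure_eigenvalue_ge_le (h : GaussianWeighted P q A α M) {θ : ℝ} (h0 : 0 ≤ θ)
    (h1 : θ < 1 / 2) {ε : ℝ} (hε : |ε| = 1) (t : ℝ) :
    P.real {ω | ∃ (μ : ℝ) (v : ι → ℝ), centered P q A ω *ᵥ v = μ • v ∧ v ⬝ᵥ v = 1 ∧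
        M * t ≤ ε * μ}
      ≤ Fintype.card ι * (1 + ((Real.exp θ - 1 - θ) + ((√(1 - 2 * θ))⁻¹ - 1 - θ)))
          ^ Fintype.card κ * Real.exp (-(θ * t)) := by
  have hM := h.pos
  set ψ := (Real.exp θ - 1 - θ) + ((√(1 - 2 * θ))⁻¹ - 1 - θ) with hψ
  set F : κ → β → Matrix ι ι ℝ := fun k b => (ε * θ / M) • (A b - mean P q A k) with hF
  have hFm : ∀ k i j, Measurable fun b => F k b i j := fun k i j => by
    simp only [hF, Matrix.smul_apply, Matrix.sub_apply, smul_eq_mul]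
    exact ((h.meas_A i j).sub_const _).const_mul _
  have hFs : ∀ k b, (F k b)ᵀ = F k b := fun k b => by
    simp only [hF]
    rw [Matrix.transpose_smul, Matrix.transpose_sub, h.transpose_apply_eq, h.mean_transpose]
  have hquad := fun k => integral_quadForm_exp_le (P := P) (Z := fun ω => F k (q k ω))
    (fun i j => (hFm k i j).comp (h.meas_q k))
    (b := fun ω => θ * max 1 (α (q k ω) ^ 2))
    (((measurable_const.max ((h.meas_α.comp (h.meas_q k)).pow_const 2))).const_mul θ)
    (fun ω => by
      simp only [hF]
      rw [norm_smul, Real.norm_eq_abs, abs_div, abs_mul, hε, one_mul, abs_of_nonneg h0,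
        abs_of_pos hM]
      calc θ / M * ‖A (q k ω) - mean P q A k‖ ≤ θ / M * (M * max 1 (α (q k ω) ^ 2)) := by
            gcongr; exact h.norm_centered_le k _
        _ = _ := by field_simp)
    (integral_exp_max_one_sq_le h1 (h.law k)).1
    (fun i j => by
      simp only [hF, Matrix.smul_apply, Matrix.sub_apply, smul_eq_mul]
      rw [integral_const_mul, integral_sub (h.integrable_apply k i j) (integrable_const _)]
      simp [mean])
    (integral_exp_max_one_sq_le h1 (h.law k)).2
  have hmain := integral_trace_exp_sum_le h.meas_q h.indep hFm hFs (fun k => (hquad k).1)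
    (c := 1 + ψ) (fun k => (hquad k).2) Finset.univ
  have hsum : ∀ ω, ∑ k, F k (q k ω) = (ε * θ / M) • centered P q A ω := fun ω => by
    simp only [hF, centered, Finset.smul_sum]
  have hsub : {ω | ∃ (μ : ℝ) (v : ι → ℝ), centered P q A ω *ᵥ v = μ • v ∧ v ⬝ᵥ v = 1 ∧
        M * t ≤ ε * μ} ⊆ {ω | Real.exp (θ * t) ≤ (exp (∑ k, F k (q k ω))).trace} := by
    rintro ω ⟨μ, v, hv, hv1, hμ⟩
    simp only [Set.mem_ofPred_eq]
    refine le_trans ?_ (Matrix.exp_le_trace_exp (μ := ε * θ / M * μ) (v := v) ?_ ?_ hv1)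
    · rw [Real.exp_le_exp]
      calc θ * t = θ / M * (M * t) := by field_simp
        _ ≤ θ / M * (ε * μ) := by gcongr
        _ = _ := by ring
    · rw [hsum, Matrix.transpose_smul, h.centered_transpose]
    · rw [hsum, Matrix.smul_mulVec, hv, smul_smul]
  have hmk := mul_meas_ge_le_integral_of_nonneg (Filter.Eventually.of_forall fun ω =>
    (Matrix.posSemidef_exp (A := ∑ k, F k (q k ω)) (by
      rw [hsum, Matrix.transpose_smul, h.centered_transpose])).trace_nonneg) hmain.1
      (Real.exp (θ * t))
  have h3 : P.real {ω | Real.exp (θ * t) ≤ (exp (∑ k, F k (q k ω))).trace}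
      ≤ Fintype.card ι * (1 + ψ) ^ Fintype.card κ * Real.exp (-(θ * t)) := by
    rw [Real.exp_neg, ← div_eq_mul_inv, le_div_iff₀ (Real.exp_pos _), mul_comm]
    exact hmk.trans hmain.2
  exact (measureReal_mono hsub).trans h3

/-- For `u ≤ 1/10` both tails are estimated with `θ = u`, with much room. For `u > 1/10` the
threshold exceeds the deterministic lower bound on the spectrum, so only the upper tail remains and
no union bound is paid. -/
theorem measure_norm_centered_gt_le (h : GaussianWeighted P q A α M) (hcard : 2 ≤ Fintype.card ι)
    {u : ℝ} (hu0 : 0 ≤ u) (hu1 : u ≤ 1)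
    (hu : Fintype.card κ * u ^ 2 = Real.log (Fintype.card ι)) :
    P.real {ω | M * (10 * u * Fintype.card κ) < ‖centered P q A ω‖}
      ≤ (Fintype.card ι : ℝ) ^ (-(7 / 3) : ℝ) := by
  have hM := h.pos
  have hne : Nonempty ι := Fintype.card_pos_iff.1 (by omega)
  set N : ℝ := (Fintype.card ι : ℝ) with hN
  have hN2 : 2 ≤ N := by rw [hN]; exact_mod_cast hcard
  have hN0 : 0 < N := by linarith
  set d : ℝ := (Fintype.card κ : ℝ) with hd
  have hd0 : 0 ≤ d := Nat.cast_nonneg _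
  set E : ℝ → Set Ω := fun ε => {ω | ∃ (μ : ℝ) (v : ι → ℝ), centered P q A ω *ᵥ v = μ • v ∧
    v ⬝ᵥ v = 1 ∧ M * (10 * u * d) ≤ ε * μ} with hE
  have hherm : ∀ ω, (centered P q A ω).IsHermitian := fun ω => by
    rw [Matrix.IsHermitian, Matrix.conjTranspose_eq_transpose_of_trivial, h.centered_transpose]
  -- As `d u² = log N`, exponentials of multiples of `d u²` are powers of `N`.
  have hexpN : ∀ c : ℝ, N * Real.exp (d * (c * u ^ 2)) = N ^ (1 + c) := fun c => by
    rw [Real.rpow_add hN0, Real.rpow_one, Real.rpow_def_of_pos hN0, ← hu]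
    ring_nf
  have htail : ∀ {θ c e : ℝ}, 0 ≤ θ → θ < 1 / 2 → |e| = 1 →
      1 + ((Real.exp θ - 1 - θ) + ((√(1 - 2 * θ))⁻¹ - 1 - θ)) ≤ Real.exp (c * u ^ 2) →
      ∀ c', c * u ^ 2 - θ * (10 * u) = c' * u ^ 2 → P.real (E e) ≤ N ^ (1 + c') := by
    intro θ c e h0 h1 he hc c' hc'
    refine (h.measure_eigenvalue_ge_le h0 h1 he (10 * u * d)).trans ?_
    have hpos : 0 ≤ 1 + ((Real.exp θ - 1 - θ) + ((√(1 - 2 * θ))⁻¹ - 1 - θ)) := by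
      have := Real.add_one_le_exp θ
      have h2 : 1 + θ ≤ (√(1 - 2 * θ))⁻¹ := by
        rw [← one_div, le_div_iff₀ (Real.sqrt_pos.2 (by linarith))]
        have h3 := Real.sqrt_le_sqrt (show 1 - 2 * θ ≤ (1 - θ) ^ 2 by nlinarith)
        rw [Real.sqrt_sq (by linarith)] at h3
        nlinarith
      linarith
    calc _ ≤ N * Real.exp (c * u ^ 2) ^ Fintype.card κ * Real.exp (-(θ * (10 * u * d))) := by
          gcongr
      _ = N * Real.exp (d * (c' * u ^ 2)) := by
          rw [← Real.exp_nat_mul, mul_assoc, ← Real.exp_add, ← hc', ← hd]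
          ring_nf
      _ = _ := hexpN _
  by_cases hcase : u ≤ 1 / 10
  · have hsub : {ω | M * (10 * u * d) < ‖centered P q A ω‖} ⊆ E 1 ∪ E (-1) := by
      intro ω hω
      obtain ⟨μ, v, hv, hv1, hn⟩ := (hherm ω).exists_unit_eigenvector
      simp only [Set.mem_ofPred_eq, hn] at hω
      rcases abs_cases μ with ⟨h1, _⟩ | ⟨h1, _⟩
      · exact Or.inl ⟨μ, v, hv, hv1, by linarith⟩
      · exact Or.inr ⟨μ, v, hv, hv1, by linarith⟩
    have hb := psi_le_exp_of_le_tenth hu0 hcase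
    have t1 := htail (θ := u) (c := 4) (e := 1) hu0 (by linarith) (by simp) hb (-6) (by ring)
    have t2 := htail (θ := u) (c := 4) (e := -1) hu0 (by linarith) (by simp) hb (-6) (by ring)
    -- The factor `2` from the two tails is absorbed by `N ≥ 2`.
    have hfin : 2 * N ^ (1 + -6 : ℝ) ≤ N ^ (-(7 / 3) : ℝ) := by
      calc 2 * N ^ (1 + -6 : ℝ) ≤ N ^ (1 : ℝ) * N ^ (1 + -6 : ℝ) := by
            rw [Real.rpow_one]; gcongr
        _ = N ^ (-4 : ℝ) := by rw [← Real.rpow_add hN0]; norm_num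
        _ ≤ _ := Real.rpow_le_rpow_of_exponent_le (by linarith) (by norm_num)
    calc _ ≤ P.real (E 1 ∪ E (-1)) := measureReal_mono hsub
      _ ≤ P.real (E 1) + P.real (E (-1)) := measureReal_union_le _ _
      _ ≤ _ := (add_le_add t1 t2).trans (by rw [← two_mul]; exact hfin)
  · push Not at hcase
    have hsub : {ω | M * (10 * u * d) < ‖centered P q A ω‖} ⊆ E 1 := by
      intro ω hω
      obtain ⟨μ, v, hv, hv1, hn⟩ := (hherm ω).exists_unit_eigenvector
      simp only [Set.mem_ofPred_eq, hn] at hω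
      rcases abs_cases μ with ⟨h1, _⟩ | ⟨h1, _⟩
      · exact ⟨μ, v, hv, hv1, by linarith⟩
      · exfalso
        have hμ : v ⬝ᵥ centered P q A ω *ᵥ v = μ := by rw [hv]; simp [hv1]
        -- Each centered summand is at least minus its mean, hence at least `-M`.
        have hlow : -(d * M) ≤ v ⬝ᵥ centered P q A ω *ᵥ v := by
          rw [centered, Matrix.sum_mulVec, dotProduct_sum]
          have : ∑ _k : κ, (-M) = -(d * M) := by simp [hd]
          rw [← this]
          refine Finset.sum_le_sum fun k _ => ?_
          rw [Matrix.sub_mulVec, dotProduct_sub]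
          have h2 : 0 ≤ v ⬝ᵥ A (q k ω) *ᵥ v := by
            simpa using (h.psd (q k ω)).dotProduct_mulVec_nonneg v
          have h4 := h.mean_le k v
          rw [hv1] at h4
          linarith
        have : d * M ≤ M * (10 * u * d) := by
          have := mul_nonneg hM.le hd0
          nlinarith
        linarith
    -- Here `7/6 - 10 * (9/20) = -10/3`, and the dimension factor raises the exponent to `1 - 10/3 =
    -- -7/3`.
    have t1 := htail (θ := 9 / 20 * u) (c := 7 / 6) (e := 1) (by linarith) (by linarith) (by simp)
      (psi_le_exp_of_le hu0 hu1) (-(10 / 3)) (by ring)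
    refine (measureReal_mono hsub).trans (t1.trans (le_of_eq ?_))
    norm_num

end GaussianWeighted

end GaussianWeightedSums

/-! ### Gaussian concentration by the Maurey–Pisier rotation argument -/

section GaussianConcentration

open ENNReal

variable {m : ℕ}

/-- The standard Gaussian measure on `Fin m → ℝ`. -/
noncomputable abbrev stdGaussianPi (m : ℕ) : Measure (Fin m → ℝ) :=
  Measure.pi fun _ => gaussianReal 0 1

theorem integral_exp_linear_stdGaussianPi (c : Fin m → ℝ) :
    ∫ w, Real.exp (∑ k, c k * w k) ∂(stdGaussianPi m) = Real.exp ((∑ k, c k ^ 2) / 2) := by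
  have h1 : ∀ k, ∫ x, Real.exp (c k * x) ∂(gaussianReal 0 1) = Real.exp (c k ^ 2 / 2) := fun k => by
    have h := mgf_gaussianReal (p := gaussianReal 0 1) (X := id) (μ := 0) (v := 1) (by simp) (c k)
    simpa [mgf] using h
  simp_rw [Real.exp_sum]
  rw [integral_fintype_prod_eq_prod (fun k (x : ℝ) => Real.exp (c k * x))]
  simp_rw [h1]
  rw [← Real.exp_sum, Finset.sum_div]

theorem lintegral_exp_linear_stdGaussianPi (c : Fin m → ℝ) :
    ∫⁻ w, ENNReal.ofReal (Real.exp (∑ k, c k * w k)) ∂(stdGaussianPi m)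
      = ENNReal.ofReal (Real.exp ((∑ k, c k ^ 2) / 2)) := by
  rw [← integral_exp_linear_stdGaussianPi, ofReal_integral_eq_lintegral_ofReal]
  · by_contra h
    have h1 := integral_exp_linear_stdGaussianPi c
    rw [integral_undef h] at h1
    exact (Real.exp_pos _).ne h1
  · exact Filter.Eventually.of_forall fun _ => (Real.exp_pos _).le

instance isGaussian_stdGaussianPi : IsGaussian (stdGaussianPi m) := by
  have h1 : ∀ k : Fin m, HasGaussianLaw (fun w : Fin m → ℝ => w k) (stdGaussianPi m) := fun k =>
    ⟨by rw [(measurePreserving_eval (fun _ : Fin m => gaussianReal 0 1) k).map_eq]; infer_instance⟩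
  have h2 : iIndepFun (fun (k : Fin m) (w : Fin m → ℝ) => w k) (stdGaussianPi m) :=
    iIndepFun_pi (X := fun _ x => x) (fun _ => aemeasurable_id)
  have h3 := (iIndepFun.hasGaussianLaw h1 h2).isGaussian_map
  simpa using h3

theorem integral_id_stdGaussianPi : ∫ w, id w ∂(stdGaussianPi m) = 0 := by
  have hi : Integrable (id : (Fin m → ℝ) → Fin m → ℝ) (stdGaussianPi m) :=
    IsGaussian.integrable_id
  funext k
  rw [eval_integral (fun k => hi.eval k)]
  have h := (measurePreserving_eval (fun _ : Fin m => gaussianReal 0 1) k)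
  have h2 := h.hasLaw.integral_comp (f := fun x : ℝ => x) (by fun_prop)
  simpa using h2

/-- Jensen's inequality for the exponential on the unit interval. -/
theorem exp_intervalIntegral_le {g : ℝ → ℝ} (hg : Continuous g) :
    Real.exp (∫ t in (0 : ℝ)..1, g t) ≤ ∫ t in (0 : ℝ)..1, Real.exp (g t) := by
  set M := ∫ t in (0 : ℝ)..1, g t with hM
  -- The tangent line of `exp` at the mean `M` integrates to `exp M`.
  have h : ∫ t in (0 : ℝ)..1, Real.exp M * (1 + (g t - M)) = Real.exp M := by
    have i1 : IntervalIntegrable (fun t => g t - M) volume 0 1 :=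
      (hg.sub continuous_const).intervalIntegrable _ _
    rw [intervalIntegral.integral_const_mul, intervalIntegral.integral_add
      intervalIntegrable_const i1, intervalIntegral.integral_sub
      (hg.intervalIntegrable _ _) intervalIntegrable_const, ← hM]
    simp
  rw [← h]
  refine intervalIntegral.integral_mono_on (by norm_num)
    (Continuous.intervalIntegrable (by fun_prop) _ _)
    (Continuous.intervalIntegrable (by fun_prop) _ _) fun t _ => ?_
  have h1 := Real.add_one_le_exp (g t - M)
  calc Real.exp M * (1 + (g t - M)) ≤ Real.exp M * Real.exp (g t - M) := by
        gcongr; linarith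
    _ = _ := by rw [← Real.exp_add]; ring_nf

/-- Rotation of a pair of vectors by the angle `π t / 2`. -/
noncomputable def quarterRotation (t : ℝ) (p : (Fin m → ℝ) × (Fin m → ℝ)) :
    (Fin m → ℝ) × (Fin m → ℝ) :=
  (Real.cos (Real.pi / 2 * t) • p.1 + Real.sin (Real.pi / 2 * t) • p.2,
    -Real.sin (Real.pi / 2 * t) • p.1 + Real.cos (Real.pi / 2 * t) • p.2)

theorem continuous_quarterRotation :
    Continuous fun q : ℝ × ((Fin m → ℝ) × (Fin m → ℝ)) => quarterRotation q.1 q.2 := by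
  simp only [quarterRotation]
  fun_prop

theorem map_quarterRotation (t : ℝ) :
    ((stdGaussianPi m).prod (stdGaussianPi m)).map (quarterRotation t)
      = (stdGaussianPi m).prod (stdGaussianPi m) := by
  have h := IsGaussian.map_rotation_eq_self (μ := stdGaussianPi m) integral_id_stdGaussianPi
    (Real.pi / 2 * t)
  have e : quarterRotation t = ⇑(ContinuousLinearMap.rotation (E := Fin m → ℝ) (Real.pi / 2 * t)) := by
    funext p
    rw [ContinuousLinearMap.rotation_apply, quarterRotation]
  rw [e, h]

/-- The velocity is a multiple of the second rotated vector, which for a Gaussian pair is again an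
independent standard Gaussian. -/
theorem hasDerivAt_quarterRotation_fst (p : (Fin m → ℝ) × (Fin m → ℝ)) (t : ℝ) :
    HasDerivAt (fun t => (quarterRotation t p).1) ((Real.pi / 2) • (quarterRotation t p).2) t := by
  simp only [quarterRotation]
  have hθ : HasDerivAt (fun t : ℝ => Real.pi / 2 * t) (Real.pi / 2) t := by
    simpa using (hasDerivAt_id t).const_mul (Real.pi / 2)
  have h := (hθ.cos.smul_const p.1).add (hθ.sin.smul_const p.2)
  refine h.congr_deriv ?_
  simp only [smul_add, smul_smul]
  congr 2 <;> ring

section MaureyPisier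

variable {F : (Fin m → ℝ) → ℝ} {F' : (Fin m → ℝ) → (Fin m → ℝ) →L[ℝ] ℝ}

theorem continuous_apply_prod (hF' : Continuous F') :
    Continuous fun p : (Fin m → ℝ) × (Fin m → ℝ) => F' p.1 p.2 :=
  (hF'.comp continuous_fst).clm_apply continuous_snd

/-- The rotation carries `p.1` to `p.2` along a quarter turn; integrate the derivative of `F` along
it and apply Jensen's inequality. -/
theorem exp_sub_le_integral_rotation (hF : ∀ w, HasFDerivAt F (F' w) w) (hF' : Continuous F')
    (s : ℝ) (p : (Fin m → ℝ) × (Fin m → ℝ)) :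
    ENNReal.ofReal (Real.exp (s * (F p.2 - F p.1))) ≤ ∫⁻ t in Set.Ioc (0 : ℝ) 1,
      ENNReal.ofReal (Real.exp (s * (Real.pi / 2) *
        F' (quarterRotation t p).1 (quarterRotation t p).2)) := by
  have hq : Continuous fun t => quarterRotation t p := by
    simp only [quarterRotation]
    fun_prop
  have hgc : Continuous fun t => F' (quarterRotation t p).1 (quarterRotation t p).2 :=
    (continuous_apply_prod hF').comp hq
  have hd : ∀ t, HasDerivAt (fun t => F (quarterRotation t p).1)
      (Real.pi / 2 * F' (quarterRotation t p).1 (quarterRotation t p).2) t := fun t => by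
    have h := HasFDerivAt.comp_hasDerivAt (f := fun t => (quarterRotation t p).1) (l := F) t
      (hF (quarterRotation t p).1) (hasDerivAt_quarterRotation_fst p t)
    rw [map_smul, smul_eq_mul] at h
    exact h
  have hint : ∫ t in (0 : ℝ)..1, Real.pi / 2 * F' (quarterRotation t p).1 (quarterRotation t p).2
      = F (quarterRotation 1 p).1 - F (quarterRotation 0 p).1 :=
    intervalIntegral.integral_eq_sub_of_hasDerivAt (fun t _ => hd t)
      ((continuous_const.mul hgc).intervalIntegrable _ _)
  have e0 : (quarterRotation 0 p).1 = p.1 := by simp [quarterRotation]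
  have e1 : (quarterRotation 1 p).1 = p.2 := by simp [quarterRotation]
  rw [e0, e1] at hint
  have e2 : s * (F p.2 - F p.1) = ∫ t in (0 : ℝ)..1, s * (Real.pi / 2) *
      F' (quarterRotation t p).1 (quarterRotation t p).2 := by
    rw [← hint, ← intervalIntegral.integral_const_mul]
    simp only [mul_assoc]
  have hc : Continuous fun t => s * (Real.pi / 2) *
      F' (quarterRotation t p).1 (quarterRotation t p).2 := continuous_const.mul hgc
  rw [e2]
  refine (ENNReal.ofReal_le_ofReal (exp_intervalIntegral_le hc)).trans (le_of_eq ?_)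
  rw [intervalIntegral.integral_of_le (by norm_num), ofReal_integral_eq_lintegral_ofReal]
  · exact ((Real.continuous_exp.comp hc).intervalIntegrable 0 1).1
  · exact Filter.Eventually.of_forall fun _ => (Real.exp_pos _).le

/-- The Maurey–Pisier bound for a `C¹` function with bounded gradient. -/
theorem lintegral_exp_sub_prod_le (hF : ∀ w, HasFDerivAt F (F' w) w)
    (hF' : Continuous F') {K : ℝ} (hK : ∀ w, ∑ k, (F' w (Pi.single k 1)) ^ 2 ≤ K) (s : ℝ) :
    ∫⁻ p, ENNReal.ofReal (Real.exp (s * (F p.2 - F p.1))) ∂((stdGaussianPi m).prod (stdGaussianPi m))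
      ≤ ENNReal.ofReal (Real.exp (Real.pi ^ 2 / 8 * s ^ 2 * K)) := by
  obtain ⟨Ψ, hΨ⟩ : ∃ Ψ : (Fin m → ℝ) × (Fin m → ℝ) → ℝ≥0∞,
    Ψ = fun p => ENNReal.ofReal (Real.exp (s * (Real.pi / 2) * F' p.1 p.2)) := ⟨_, rfl⟩
  have hΨm : Measurable Ψ := by
    rw [hΨ]
    exact (ENNReal.continuous_ofReal.comp (Real.continuous_exp.comp
      (continuous_const.mul (continuous_apply_prod hF')))).measurable
  have hrot : ∀ t, ∫⁻ p, Ψ (quarterRotation t p) ∂((stdGaussianPi m).prod (stdGaussianPi m))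
      = ∫⁻ p, Ψ p ∂((stdGaussianPi m).prod (stdGaussianPi m)) := fun t => by
    conv_rhs => rw [← map_quarterRotation t]
    rw [lintegral_map hΨm]
    exact (continuous_quarterRotation.comp
      (Continuous.prodMk continuous_const continuous_id)).measurable
  -- For fixed `w` the exponent is linear in the Gaussian `w'`, with variance at most `s² (π/2)² K`;
  -- half of this is `π²/8 * s² K`.
  have hin : ∀ w, ∫⁻ w', Ψ (w, w') ∂(stdGaussianPi m)
      ≤ ENNReal.ofReal (Real.exp (Real.pi ^ 2 / 8 * s ^ 2 * K)) := by
    intro w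
    have e : ∀ w', Ψ (w, w') = ENNReal.ofReal (Real.exp (∑ k, (s * (Real.pi / 2) *
        F' w (Pi.single k 1)) * w' k)) := fun w' => by
      simp only [hΨ]
      congr 2
      conv_lhs => rw [pi_eq_sum_univ' w']
      simp only [map_sum, map_smul, Finset.mul_sum, smul_eq_mul]
      refine Finset.sum_congr rfl fun k _ => ?_
      ring
    simp_rw [e]
    rw [lintegral_exp_linear_stdGaussianPi]
    refine ENNReal.ofReal_le_ofReal (Real.exp_le_exp.2 ?_)
    have := hK w
    simp only [mul_pow, ← Finset.mul_sum]
    nlinarith [mul_nonneg (sq_nonneg s) (sq_nonneg Real.pi)]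
  have hΨle : ∫⁻ p, Ψ p ∂((stdGaussianPi m).prod (stdGaussianPi m))
      ≤ ENNReal.ofReal (Real.exp (Real.pi ^ 2 / 8 * s ^ 2 * K)) := by
    rw [lintegral_prod _ hΨm.aemeasurable]
    exact (lintegral_mono hin).trans (by simp)
  have hpath := exp_sub_le_integral_rotation hF hF' s
  calc _ ≤ ∫⁻ p, (∫⁻ t in Set.Ioc (0 : ℝ) 1, Ψ (quarterRotation t p))
          ∂((stdGaussianPi m).prod (stdGaussianPi m)) := by
        rw [hΨ]; exact lintegral_mono hpath
    _ = ∫⁻ t in Set.Ioc (0 : ℝ) 1, (∫⁻ p, Ψ (quarterRotation t p)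
          ∂((stdGaussianPi m).prod (stdGaussianPi m))) := by
        refine lintegral_lintegral_swap ?_
        exact ((hΨm.comp continuous_quarterRotation.measurable).comp measurable_swap).aemeasurable
    _ ≤ ∫⁻ _ in Set.Ioc (0 : ℝ) 1, ENNReal.ofReal (Real.exp (Real.pi ^ 2 / 8 * s ^ 2 * K)) := by
        refine lintegral_mono fun t => ?_
        rw [hrot]; exact hΨle
    _ = _ := by simp

end MaureyPisier

/-- Jensen's inequality in the first copy: the mean is replaced by an independent copy. Where the
inner integral is infinite there is nothing to prove. -/
theorem lintegral_exp_centered_le_prod {E : Type*} [MeasurableSpace E] {γ : Measure E}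
    [IsProbabilityMeasure γ] {F : E → ℝ} (hFm : Measurable F) (hFi : Integrable F γ) (s : ℝ) :
    ∫⁻ y, ENNReal.ofReal (Real.exp (s * (F y - ∫ x, F x ∂γ))) ∂γ
      ≤ ∫⁻ p, ENNReal.ofReal (Real.exp (s * (F p.2 - F p.1))) ∂(γ.prod γ) := by
  rw [lintegral_prod_symm _ (by fun_prop)]
  refine lintegral_mono fun y => ?_
  by_cases hfin : ∫⁻ x, ENNReal.ofReal (Real.exp (s * (F y - F x))) ∂γ = ∞
  · simp [hfin]
  have hi : Integrable (fun x => Real.exp (s * (F y - F x))) γ := by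
    refine ⟨by fun_prop, ?_⟩
    rw [hasFiniteIntegral_iff_ofReal (Filter.Eventually.of_forall fun _ => (Real.exp_pos _).le)]
    exact lt_top_iff_ne_top.2 hfin
  show _ ≤ ∫⁻ x, ENNReal.ofReal (Real.exp (s * (F y - F x))) ∂γ
  rw [← ofReal_integral_eq_lintegral_ofReal hi
    (Filter.Eventually.of_forall fun _ => (Real.exp_pos _).le)]
  refine ENNReal.ofReal_le_ofReal ?_
  set M := ∫ x, F x ∂γ with hM
  have h : ∫ x, Real.exp (s * (F y - M)) * (1 + s * (M - F x)) ∂γ = Real.exp (s * (F y - M)) := by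
    have i1 : Integrable (fun x => s * (M - F x)) γ := ((integrable_const _).sub hFi).const_mul _
    rw [integral_const_mul, integral_add (integrable_const _) i1, integral_const_mul,
      integral_sub (integrable_const _) hFi, ← hM]
    simp
  rw [← h]
  refine integral_mono (((integrable_const _).add
      (((integrable_const _).sub hFi).const_mul _)).const_mul _) hi fun x => ?_
  have h1 := Real.add_one_le_exp (s * (M - F x))
  calc Real.exp (s * (F y - M)) * (1 + s * (M - F x))
      ≤ Real.exp (s * (F y - M)) * Real.exp (s * (M - F x)) := by gcongr; linarith
    _ = _ := by rw [← Real.exp_add]; ring_nf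

end GaussianConcentration

/-! ### Extension to Lipschitz functions by smoothing -/

section Smoothing

open intervalIntegral

/-- The average of `σ` over `[x, x + ε]`. -/
noncomputable def slidingAverage (σ : ℝ → ℝ) (ε x : ℝ) : ℝ :=
  ε⁻¹ * ((∫ t in (0 : ℝ)..(x + ε), σ t) - ∫ t in (0 : ℝ)..x, σ t)

variable {σ : ℝ → ℝ} {lip : ℝ≥0} {ε : ℝ}

theorem hasDerivAt_slidingAverage (hσ : Continuous σ) (x : ℝ) :
    HasDerivAt (slidingAverage σ ε) (ε⁻¹ * (σ (x + ε) - σ x)) x := by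
  have h : ∀ y, HasDerivAt (fun y => ∫ t in (0 : ℝ)..y, σ t) (σ y) y := fun y =>
    hσ.integral_hasStrictDerivAt 0 y |>.hasDerivAt
  exact (((h (x + ε)).comp_add_const x ε).sub (h x)).const_mul _

theorem abs_slidingAverage_deriv_le (hσ : LipschitzWith lip σ) (hε : 0 < ε) (x : ℝ) :
    |ε⁻¹ * (σ (x + ε) - σ x)| ≤ lip := by
  have h := hσ.dist_le_mul (x + ε) x
  rw [Real.dist_eq, Real.dist_eq, add_sub_cancel_left, abs_of_pos hε] at h
  rw [abs_mul, abs_inv, abs_of_pos hε, inv_mul_le_iff₀ hε]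
  linarith

/-- By the mean value theorem the average equals `σ c` for some `c` in `(x, x + ε)`. -/
theorem abs_slidingAverage_sub_le (hσ : LipschitzWith lip σ) (hε : 0 < ε) (x : ℝ) :
    |slidingAverage σ ε x - σ x| ≤ lip * ε := by
  have h : ∀ y, HasDerivAt (fun y => ∫ t in (0 : ℝ)..y, σ t) (σ y) y := fun y =>
    hσ.continuous.integral_hasStrictDerivAt 0 y |>.hasDerivAt
  obtain ⟨c, hc, hce⟩ := exists_hasDerivAt_eq_slope (fun y => ∫ t in (0 : ℝ)..y, σ t) σ
    (show x < x + ε by linarith) (fun y _ => (h y).continuousAt.continuousWithinAt)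
    (fun y _ => h y)
  have e : slidingAverage σ ε x = σ c := by
    rw [hce, slidingAverage, add_sub_cancel_left, div_eq_inv_mul]
  rw [e]
  have h2 := hσ.dist_le_mul c x
  rw [Real.dist_eq, Real.dist_eq, abs_of_pos (by linarith [hc.1] : 0 < c - x)] at h2
  refine h2.trans ?_
  gcongr
  linarith [hc.2]

end Smoothing

section Ridge

variable {m n : ℕ}

/-- The function `w ↦ ∑ α, v α * τ (x_α · w)`, where the `x_α` are the columns of `X`. -/
noncomputable def ridgeSum (τ : ℝ → ℝ) (X : Matrix (Fin m) (Fin n) ℝ) (v : Fin n → ℝ)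
    (w : Fin m → ℝ) : ℝ :=
  ∑ α, v α * τ (∑ k, w k * X k α)

theorem sum_sq_mulVec_le (X : Matrix (Fin m) (Fin n) ℝ) (v : Fin n → ℝ) :
    ∑ k, (∑ α, X k α * v α) ^ 2 ≤ ‖X‖ ^ 2 * ∑ α, v α ^ 2 := by
  have h := Matrix.l2_opNorm_mulVec X (WithLp.toLp 2 v)
  have h2 : ‖WithLp.toLp 2 (X *ᵥ v)‖ ^ 2 ≤ (‖X‖ * ‖WithLp.toLp 2 v‖) ^ 2 :=
    pow_le_pow_left₀ (norm_nonneg _) h 2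
  rw [mul_pow, EuclideanSpace.norm_sq_eq, EuclideanSpace.norm_sq_eq] at h2
  simpa [Matrix.mulVec, dotProduct] using h2

/-- The gradient at `w` is `X` applied to the vector `v α * τ' (x_α · w)`, so only the spectral norm
of `X` enters. -/
theorem lintegral_exp_ridgeSum_sub_le {τ τ' : ℝ → ℝ} (hτ : ∀ x, HasDerivAt τ (τ' x) x)
    (hτ' : Continuous τ') {L : ℝ} (hL : ∀ x, |τ' x| ≤ L) (X : Matrix (Fin m) (Fin n) ℝ)
    (v : Fin n → ℝ) (s : ℝ) :
    ∫⁻ p, ENNReal.ofReal (Real.exp (s * (ridgeSum τ X v p.2 - ridgeSum τ X v p.1)))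
      ∂((stdGaussianPi m).prod (stdGaussianPi m))
      ≤ ENNReal.ofReal (Real.exp (Real.pi ^ 2 / 8 * s ^ 2 * (L ^ 2 * ‖X‖ ^ 2 * ∑ α, v α ^ 2))) := by
  set ℓ : Fin n → (Fin m → ℝ) →L[ℝ] ℝ := fun α => ∑ k, X k α • ContinuousLinearMap.proj k with hℓ
  have hℓapp : ∀ α w, ℓ α w = ∑ k, w k * X k α := fun α w => by
    simp [hℓ, mul_comm]
  refine lintegral_exp_sub_prod_le (F := ridgeSum τ X v)
    (F' := fun w => ∑ α, (v α * τ' (∑ k, w k * X k α)) • ℓ α) (fun w => ?_) (by fun_prop)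
    (fun w => ?_) s
  · unfold ridgeSum
    refine HasFDerivAt.fun_sum fun α _ => ?_
    have h1 : HasFDerivAt (fun w : Fin m → ℝ => ∑ k, w k * X k α) (ℓ α) w := by
      have := (ℓ α).hasFDerivAt (x := w)
      exact this.congr_of_eventuallyEq (Filter.Eventually.of_forall fun w => (hℓapp α w).symm)
    have h2 := ((hτ (∑ k, w k * X k α)).comp_hasFDerivAt w h1).const_mul (v α)
    rw [smul_smul] at h2
    exact h2
  · have e : ∀ k, (∑ α, (v α * τ' (∑ k, w k * X k α)) • ℓ α) (Pi.single k 1)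
        = ∑ α, X k α * (v α * τ' (∑ k, w k * X k α)) := fun k => by
      rw [sum_apply]
      refine Finset.sum_congr rfl fun α _ => ?_
      rw [smul_apply, hℓapp, smul_eq_mul]
      simp [Pi.single_apply, mul_comm]
    simp_rw [e]
    refine (sum_sq_mulVec_le X _).trans ?_
    have h2 : ∑ α, (v α * τ' (∑ k, w k * X k α)) ^ 2 ≤ L ^ 2 * ∑ α, v α ^ 2 := by
      rw [Finset.mul_sum]
      refine Finset.sum_le_sum fun α _ => ?_
      have h3 := sq_le_sq' (abs_le.mp (hL (∑ k, w k * X k α))).1 (abs_le.mp (hL _)).2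
      rw [mul_pow, mul_comm]
      exact mul_le_mul_of_nonneg_right h3 (sq_nonneg _)
    calc _ ≤ ‖X‖ ^ 2 * (L ^ 2 * ∑ α, v α ^ 2) := by gcongr
      _ = _ := by ring

theorem integrable_linear_stdGaussianPi (c : Fin m → ℝ) :
    Integrable (fun w : Fin m → ℝ => ∑ k, w k * c k) (stdGaussianPi m) := by
  have hi : Integrable (id : (Fin m → ℝ) → Fin m → ℝ) (stdGaussianPi m) :=
    IsGaussian.integrable_id
  exact integrable_finsetSum _ fun k _ => (hi.eval k).mul_const _

theorem abs_le_of_lipschitz {σ : ℝ → ℝ} {lip : ℝ≥0} (hσ : LipschitzWith lip σ) (x : ℝ) :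
    |σ x| ≤ |σ 0| + lip * |x| := by
  have h := hσ.dist_le_mul x 0
  rw [Real.dist_eq, Real.dist_eq, sub_zero] at h
  have := abs_sub_abs_le_abs_sub (σ x) (σ 0)
  linarith

theorem measurable_ridgeSum {σ : ℝ → ℝ} (hσ : Measurable σ) (X : Matrix (Fin m) (Fin n) ℝ)
    (v : Fin n → ℝ) : Measurable (ridgeSum σ X v) := by
  unfold ridgeSum
  fun_prop

theorem integrable_lipschitz_linear {σ : ℝ → ℝ} {lip : ℝ≥0} (hσ : LipschitzWith lip σ)
    (c : Fin m → ℝ) : Integrable (fun w : Fin m → ℝ => σ (∑ k, w k * c k)) (stdGaussianPi m) := by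
  have hm := hσ.continuous.measurable
  refine ((integrable_const |σ 0|).add
    ((integrable_linear_stdGaussianPi c).abs.const_mul lip)).mono'
    (hm.comp (by fun_prop)).aestronglyMeasurable (Filter.Eventually.of_forall fun w => ?_)
  exact abs_le_of_lipschitz hσ _

theorem integrable_ridgeSum {σ : ℝ → ℝ} {lip : ℝ≥0} (hσ : LipschitzWith lip σ)
    (X : Matrix (Fin m) (Fin n) ℝ) (v : Fin n → ℝ) :
    Integrable (ridgeSum σ X v) (stdGaussianPi m) :=
  integrable_finsetSum _ fun α _ => (integrable_lipschitz_linear hσ fun k => X k α).const_mul _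

/-- Gaussian concentration for `w ↦ ∑ α, v α * σ (x_α · w)` with `σ` Lipschitz. -/
theorem lintegral_exp_ridgeSum_centered_le {σ : ℝ → ℝ} {lip : ℝ≥0} (hσ : LipschitzWith lip σ)
    (X : Matrix (Fin m) (Fin n) ℝ) (v : Fin n → ℝ) (s : ℝ) :
    ∫⁻ w, ENNReal.ofReal (Real.exp (s * (ridgeSum σ X v w
        - ∫ w', ridgeSum σ X v w' ∂(stdGaussianPi m)))) ∂(stdGaussianPi m)
      ≤ ENNReal.ofReal (Real.exp (Real.pi ^ 2 / 8 * s ^ 2 *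
        ((lip : ℝ) ^ 2 * ‖X‖ ^ 2 * ∑ α, v α ^ 2))) := by
  refine (lintegral_exp_centered_le_prod (measurable_ridgeSum hσ.continuous.measurable X v)
    (integrable_ridgeSum hσ X v) s).trans ?_
  set Q := Real.pi ^ 2 / 8 * s ^ 2 * ((lip : ℝ) ^ 2 * ‖X‖ ^ 2 * ∑ α, v α ^ 2) with hQ
  set D := 2 * |s| * (lip * ∑ α, |v α|) with hD
  -- Replacing `σ` by its sliding average keeps the Lipschitz constant and moves the exponent by at
  -- most `D ε`; then `ε → 0`.
  have hstep : ∀ ε : ℝ, 0 < ε →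
      ∫⁻ p, ENNReal.ofReal (Real.exp (s * (ridgeSum σ X v p.2 - ridgeSum σ X v p.1)))
        ∂((stdGaussianPi m).prod (stdGaussianPi m)) ≤ ENNReal.ofReal (Real.exp (D * ε + Q)) := by
    intro ε hε
    have hclose : ∀ w, |ridgeSum (slidingAverage σ ε) X v w - ridgeSum σ X v w|
        ≤ (lip * ∑ α, |v α|) * ε := fun w => by
      rw [ridgeSum, ridgeSum, ← Finset.sum_sub_distrib]
      refine (Finset.abs_sum_le_sum_abs _ _).trans ?_
      rw [Finset.mul_sum, Finset.sum_mul]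
      refine Finset.sum_le_sum fun α _ => ?_
      rw [← mul_sub, abs_mul]
      calc _ ≤ |v α| * (lip * ε) := by gcongr; exact abs_slidingAverage_sub_le hσ hε _
        _ = _ := by ring
    have hpt : ∀ p : (Fin m → ℝ) × (Fin m → ℝ),
        ENNReal.ofReal (Real.exp (s * (ridgeSum σ X v p.2 - ridgeSum σ X v p.1)))
        ≤ ENNReal.ofReal (Real.exp (D * ε)) * ENNReal.ofReal (Real.exp (s *
          (ridgeSum (slidingAverage σ ε) X v p.2 - ridgeSum (slidingAverage σ ε) X v p.1))) := by
      intro p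
      rw [← ENNReal.ofReal_mul (Real.exp_pos _).le, ← Real.exp_add]
      refine ENNReal.ofReal_le_ofReal (Real.exp_le_exp.2 ?_)
      obtain ⟨a1, a2⟩ := abs_le.mp (hclose p.1)
      obtain ⟨b1, b2⟩ := abs_le.mp (hclose p.2)
      set x := ridgeSum σ X v p.2 - ridgeSum σ X v p.1 -
        (ridgeSum (slidingAverage σ ε) X v p.2 - ridgeSum (slidingAverage σ ε) X v p.1) with hx
      have h3 : |x| ≤ 2 * ((lip * ∑ α, |v α|) * ε) := abs_le.2 ⟨by linarith, by linarith⟩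
      have h4 : s * x ≤ |s| * (2 * ((lip * ∑ α, |v α|) * ε)) :=
        (le_abs_self _).trans (by rw [abs_mul]; gcongr)
      have h5 : s * x = s * (ridgeSum σ X v p.2 - ridgeSum σ X v p.1) - s *
        (ridgeSum (slidingAverage σ ε) X v p.2 - ridgeSum (slidingAverage σ ε) X v p.1) := by
        rw [hx]; ring
      rw [hD]
      linarith
    have hsa : Measurable (slidingAverage σ ε) :=
      (continuous_iff_continuousAt.2 fun x =>
        (hasDerivAt_slidingAverage hσ.continuous x).continuousAt).measurable
    have hm := measurable_ridgeSum hsa X v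
    have hcσ := hσ.continuous
    refine (lintegral_mono hpt).trans ?_
    rw [lintegral_const_mul _ (by fun_prop), Real.exp_add, ENNReal.ofReal_mul (Real.exp_pos _).le]
    gcongr
    exact lintegral_exp_ridgeSum_sub_le (hasDerivAt_slidingAverage hσ.continuous) (by fun_prop)
      (abs_slidingAverage_deriv_le hσ hε) X v s
  have hlim : Filter.Tendsto (fun ε : ℝ => ENNReal.ofReal (Real.exp (D * ε + Q)))
      (nhdsWithin 0 (Set.Ioi 0)) (nhds (ENNReal.ofReal (Real.exp Q))) := by
    have hc : Continuous (fun ε : ℝ => ENNReal.ofReal (Real.exp (D * ε + Q))) :=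
      ENNReal.continuous_ofReal.comp (by fun_prop)
    have := (hc.tendsto 0).mono_left (nhdsWithin_le_nhds (s := Set.Ioi 0))
    simpa using this
  exact ge_of_tendsto hlim (Filter.eventually_of_mem self_mem_nhdsWithin fun ε hε => hstep ε hε)

end Ridge

set_option linter.unusedSectionVars false

/-! ### Squares of sub-Gaussian variables and Chernoff bounds -/

section SubGaussian

variable {E : Type*} [MeasurableSpace E] {γ : Measure E} [IsProbabilityMeasure γ]

theorem integrable_of_lintegral_ofReal_le {f : E → ℝ} (hf : Measurable f) (h0 : ∀ x, 0 ≤ f x)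
    {c : ℝ} (hc : 0 ≤ c) (h : ∫⁻ x, ENNReal.ofReal (f x) ∂γ ≤ ENNReal.ofReal c) :
    Integrable f γ ∧ ∫ x, f x ∂γ ≤ c := by
  have hi : Integrable f γ := by
    refine ⟨hf.aestronglyMeasurable, ?_⟩
    rw [hasFiniteIntegral_iff_ofReal (Filter.Eventually.of_forall h0)]
    exact h.trans_lt ENNReal.ofReal_lt_top
  refine ⟨hi, ?_⟩
  rw [← ofReal_integral_eq_lintegral_ofReal hi (Filter.Eventually.of_forall h0)] at h
  exact (ENNReal.ofReal_le_ofReal_iff hc).1 h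

/-- The square of a sub-Gaussian variable has a bounded exponential moment. -/
theorem integral_exp_sq_div_le_two {h : E → ℝ} (hm : Measurable h) {Q : ℝ} (hQ : 0 < Q)
    (hs : ∀ s : ℝ, ∫⁻ x, ENNReal.ofReal (Real.exp (s * h x)) ∂γ
      ≤ ENNReal.ofReal (Real.exp (5 / 4 * s ^ 2 * Q))) :
    Integrable (fun x => Real.exp (h x ^ 2 / (8 * Q))) γ ∧
      ∫ x, Real.exp (h x ^ 2 / (8 * Q)) ∂γ ≤ 2 := by
  refine integrable_of_lintegral_ofReal_le (by fun_prop) (fun _ => (Real.exp_pos _).le)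
    (by norm_num) ?_
  -- Linearisation of the square: `exp (h² / (8 Q))` is the mean of `exp (r h z)` over an
  -- independent standard Gaussian `z`. After Tonelli the hypothesis leaves the moment of `5/16 *
  -- z²`, which is `(3/8)^(-1/2) ≤ 2`.
  set r := √(1 / (4 * Q)) with hr
  have hr2 : r ^ 2 = 1 / (4 * Q) := Real.sq_sqrt (by positivity)
  have hmgf : ∀ t : ℝ, ∫⁻ z, ENNReal.ofReal (Real.exp (t * z)) ∂(gaussianReal 0 1)
      = ENNReal.ofReal (Real.exp (t ^ 2 / 2)) := fun t => by
    rw [← ofReal_integral_eq_lintegral_ofReal (integrable_exp_mul_gaussianReal t)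
      (Filter.Eventually.of_forall fun _ => (Real.exp_pos _).le)]
    have h := mgf_gaussianReal (p := gaussianReal 0 1) (X := id) (μ := 0) (v := 1) (by simp) t
    simp only [mgf, id] at h
    rw [h]
    simp
  have e1 : ∀ x, ENNReal.ofReal (Real.exp (h x ^ 2 / (8 * Q)))
      = ∫⁻ z, ENNReal.ofReal (Real.exp ((r * h x) * z)) ∂(gaussianReal 0 1) := fun x => by
    rw [hmgf, mul_pow, hr2]
    congr 2
    field_simp
    ring
  simp_rw [e1]
  rw [lintegral_lintegral_swap (by fun_prop)]
  have e2 : ∀ z : ℝ, ∫⁻ x, ENNReal.ofReal (Real.exp ((r * h x) * z)) ∂γ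
      ≤ ENNReal.ofReal (Real.exp (5 / 16 * z ^ 2)) := fun z => by
    have h2 := hs (r * z)
    rw [mul_pow, hr2] at h2
    have ea : ∀ x, r * h x * z = r * z * h x := fun x => by ring
    have eb : 5 / 4 * (1 / (4 * Q) * z ^ 2) * Q = 5 / 16 * z ^ 2 := by field_simp; ring
    simp_rw [ea]
    rwa [eb] at h2
  refine (lintegral_mono e2).trans ?_
  rw [← ofReal_integral_eq_lintegral_ofReal (integrable_exp_mul_sq_gaussianReal (by norm_num))
    (Filter.Eventually.of_forall fun _ => (Real.exp_pos _).le),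
    integral_exp_mul_sq_gaussianReal (by norm_num)]
  exact ENNReal.ofReal_le_ofReal (inv_sqrt_le_of_one_le_mul_sq (by norm_num) (by norm_num)
    (by norm_num))

/-- From order two on, every term of the series of `e^(θ x)` is at most `θ²` times that of `e^|x|`.
-/
theorem exp_mul_le_of_abs_le_one {θ : ℝ} (hθ : |θ| ≤ 1) (x : ℝ) :
    Real.exp (θ * x) ≤ 1 + θ * x + θ ^ 2 * Real.exp |x| := by
  have hser : ∀ y : ℝ, HasSum (fun n : ℕ => y ^ (n + 2) / (n + 2).factorial)
      (Real.exp y - 1 - y) := fun y => by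
    have h := NormedSpace.expSeries_div_hasSum_exp y
    rw [← Real.exp_eq_exp_ℝ] at h
    have h2 := (hasSum_nat_add_iff' 2).mpr h
    simp [Finset.sum_range_succ] at h2
    rw [sub_sub]
    exact h2
  have h1 := hasSum_le (fun n => ?_) (hser (θ * x)) ((hser |x|).mul_left (θ ^ 2))
  · have := abs_nonneg x
    nlinarith [sq_nonneg θ]
  · rw [← mul_div_assoc]
    gcongr
    calc (θ * x) ^ (n + 2) ≤ |(θ * x) ^ (n + 2)| := le_abs_self _
      _ = θ ^ 2 * (|θ| ^ n * |x| ^ (n + 2)) := by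
          rw [abs_pow, abs_mul, ← sq_abs θ]; ring
      _ ≤ θ ^ 2 * (1 * |x| ^ (n + 2)) := by
          gcongr
          exact pow_le_one₀ (abs_nonneg _) hθ
      _ = _ := by ring

/-- The mean `M` is at most `1` because `V ≤ e^V - 1`. With `|V - M| ≤ V + M`, the second-order term
is at most `θ² e^M E e^V ≤ 3 * 2 * θ²`. -/
theorem integral_exp_centered_le {V : E → ℝ} (hm : Measurable V) (h0 : ∀ x, 0 ≤ V x)
    (hi : Integrable (fun x => Real.exp (V x)) γ) (h2 : ∫ x, Real.exp (V x) ∂γ ≤ 2) :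
    Integrable V γ ∧ ∀ θ : ℝ, |θ| ≤ 1 →
      Integrable (fun x => Real.exp (θ * (V x - ∫ y, V y ∂γ))) γ ∧
      ∫ x, Real.exp (θ * (V x - ∫ y, V y ∂γ)) ∂γ ≤ Real.exp (6 * θ ^ 2) := by
  have hV : Integrable V γ := hi.mono' hm.aestronglyMeasurable
    (Filter.Eventually.of_forall fun x => by
      rw [Real.norm_of_nonneg (h0 x)]; linarith [Real.add_one_le_exp (V x)])
  refine ⟨hV, fun θ hθ => ?_⟩
  set M := ∫ y, V y ∂γ with hM
  have hM0 : 0 ≤ M := integral_nonneg h0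
  have hM1 : M ≤ 1 := by
    have h3 : ∫ y, V y ∂γ ≤ ∫ y, (Real.exp (V y) - 1) ∂γ :=
      integral_mono hV (hi.sub (integrable_const _)) fun y => by
        linarith [Real.add_one_le_exp (V y)]
    rw [integral_sub hi (integrable_const _)] at h3
    simp at h3
    linarith
  have hpt : ∀ x, Real.exp (θ * (V x - M))
      ≤ 1 + θ * (V x - M) + θ ^ 2 * (Real.exp M * Real.exp (V x)) := fun x => by
    refine (exp_mul_le_of_abs_le_one hθ _).trans ?_
    rw [← Real.exp_add]
    have : |V x - M| ≤ M + V x := abs_le.2 ⟨by linarith [h0 x], by linarith⟩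
    gcongr
  have i1 : Integrable (fun x => θ * (V x - M)) γ := (hV.sub (integrable_const _)).const_mul _
  have i2 : Integrable (fun x => θ ^ 2 * (Real.exp M * Real.exp (V x))) γ :=
    (hi.const_mul _).const_mul _
  have i3 : Integrable (fun x => 1 + θ * (V x - M)) γ := (integrable_const _).add i1
  have i4 : Integrable (fun x => Real.exp (θ * (V x - M))) γ :=
    (i3.add i2).mono' (by fun_prop) (Filter.Eventually.of_forall fun x => by
      rw [Real.norm_of_nonneg (Real.exp_pos _).le]; exact hpt x)
  refine ⟨i4, ?_⟩
  calc _ ≤ ∫ x, (1 + θ * (V x - M) + θ ^ 2 * (Real.exp M * Real.exp (V x))) ∂γ :=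
        integral_mono i4 (i3.add i2) hpt
    _ = 1 + θ ^ 2 * (Real.exp M * ∫ x, Real.exp (V x) ∂γ) := by
        rw [integral_add i3 i2, integral_add (integrable_const _) i1, integral_const_mul,
          integral_const_mul, integral_const_mul, integral_sub hV (integrable_const _), ← hM]
        simp
    _ ≤ 1 + θ ^ 2 * (3 * 2) := by
        have : Real.exp M ≤ 3 := (Real.exp_le_exp.2 hM1).trans (by
          linarith [Real.exp_one_lt_d9])
        gcongr
    _ ≤ _ := by linarith [Real.add_one_le_exp (6 * θ ^ 2)]

end SubGaussian

section Chernoff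

variable {Ω κ : Type*} [MeasurableSpace Ω] {P : Measure Ω} [IsProbabilityMeasure P] [Fintype κ]

theorem measure_sum_ge_le_of_mgf_le {Z : κ → Ω → ℝ} (hZ : ∀ k, Measurable (Z k))
    (hind : iIndepFun Z P) {θ b : ℝ} (hθ : 0 ≤ θ)
    (hint : ∀ k, Integrable (fun ω => Real.exp (θ * Z k ω)) P)
    (hmgf : ∀ k, ∫ ω, Real.exp (θ * Z k ω) ∂P ≤ Real.exp b) (t : ℝ) :
    P.real {ω | Fintype.card κ * t ≤ ∑ k, Z k ω} ≤ Real.exp (Fintype.card κ * (b - θ * t)) := by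
  have h1 := measure_ge_le_exp_mul_mgf (μ := P) (X := ∑ k, Z k) (t := θ)
    (Fintype.card κ * t) hθ (hind.integrable_exp_mul_sum hZ fun k _ => hint k)
  rw [hind.mgf_sum hZ] at h1
  simp only [Finset.sum_apply] at h1
  refine h1.trans ?_
  have h2 : ∏ k, mgf (Z k) P θ ≤ Real.exp b ^ Fintype.card κ := by
    rw [← Finset.card_univ, ← Finset.prod_const]
    exact Finset.prod_le_prod (fun k _ => mgf_nonneg) fun k _ => hmgf k
  calc _ ≤ Real.exp (-θ * (Fintype.card κ * t)) * Real.exp b ^ Fintype.card κ := by gcongr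
    _ = _ := by
      rw [← Real.exp_nat_mul, ← Real.exp_add]; ring_nf

theorem measure_abs_sum_ge_le_of_mgf_le {Z : κ → Ω → ℝ} (hZ : ∀ k, Measurable (Z k))
    (hind : iIndepFun Z P) {θ b : ℝ} (hθ : 0 ≤ θ)
    (hmgf : ∀ e : ℝ, |e| = 1 → ∀ k, Integrable (fun ω => Real.exp (e * θ * Z k ω)) P ∧
      ∫ ω, Real.exp (e * θ * Z k ω) ∂P ≤ Real.exp b) (t : ℝ) :
    P.real {ω | Fintype.card κ * t ≤ |∑ k, Z k ω|}
      ≤ 2 * Real.exp (Fintype.card κ * (b - θ * t)) := by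
  have h1 := measure_sum_ge_le_of_mgf_le hZ hind hθ (b := b)
    (fun k => by simpa using (hmgf 1 (by simp) k).1)
    (fun k => by simpa using (hmgf 1 (by simp) k).2) t
  have h2 := measure_sum_ge_le_of_mgf_le (P := P) (Z := fun k ω => -Z k ω) (fun k => (hZ k).neg)
    (hind.comp (fun _ x => -x) fun _ => measurable_neg) hθ (b := b)
    (fun k => by simpa using (hmgf (-1) (by simp) k).1)
    (fun k => by simpa using (hmgf (-1) (by simp) k).2) t
  have hsub : {ω | Fintype.card κ * t ≤ |∑ k, Z k ω|} ⊆
      {ω | Fintype.card κ * t ≤ ∑ k, Z k ω} ∪ {ω | Fintype.card κ * t ≤ ∑ k, -Z k ω} := by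
    intro ω hω
    simp only [Set.mem_union, Set.mem_ofPred_eq, Finset.sum_neg_distrib] at hω ⊢
    exact le_abs.1 hω
  calc _ ≤ _ := measureReal_mono hsub
    _ ≤ _ := measureReal_union_le _ _
    _ ≤ _ := by linarith

end Chernoff

/-! ### Nets of the sphere and the spectral norm -/

section Net

open Matrix

variable {n : ℕ}

/-- A `1/2`-net of the unit sphere with at most `5 ^ n` points. -/
theorem exists_half_net (n : ℕ) : ∃ N : Finset (Fin n → ℝ), N.card ≤ 5 ^ n ∧
    (∀ v ∈ N, v ⬝ᵥ v = 1) ∧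
    ∀ w : Fin n → ℝ, w ⬝ᵥ w = 1 → ∃ v ∈ N, (v - w) ⬝ᵥ (v - w) ≤ 1 / 4 := by
  classical
  have hnorm : ∀ x : EuclideanSpace ℝ (Fin n), x.ofLp ⬝ᵥ x.ofLp = ‖x‖ ^ 2 := fun x => by
    rw [EuclideanSpace.norm_sq_eq]; simp [dotProduct, sq]
  -- Work on the sphere of radius `2` with separation `1`, the normalisation of the Besicovitch
  -- packing bound `5 ^ n`. A separated set of largest cardinality is a `1`-net, and halving it
  -- gives the claim.
  set Sep : Finset (EuclideanSpace ℝ (Fin n)) → Prop := fun s =>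
    (∀ c ∈ s, ‖c‖ = 2) ∧ ∀ c ∈ s, ∀ d ∈ s, c ≠ d → 1 ≤ ‖c - d‖ with hSep
  have hcard : ∀ s, Sep s → s.card ≤ 5 ^ n := fun s hs => by
    simpa using Besicovitch.card_le_of_separated s (fun c hc => (hs.1 c hc).le) hs.2
  obtain ⟨s, hs, hmax⟩ : ∃ s, Sep s ∧ ∀ t, Sep t → t.card ≤ s.card := by
    have hbdd : BddAbove {k | ∃ s, Sep s ∧ s.card = k} :=
      ⟨5 ^ n, by rintro k ⟨s, hs, rfl⟩; exact hcard s hs⟩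
    obtain ⟨s, hs, hk⟩ := Nat.sSup_mem (s := {k | ∃ s, Sep s ∧ s.card = k})
      ⟨0, ∅, ⟨by simp, by simp⟩, rfl⟩ hbdd
    exact ⟨s, hs, fun t ht => hk ▸ le_csSup hbdd ⟨t, ht, rfl⟩⟩
  refine ⟨s.image fun c => (1 / 2 : ℝ) • c.ofLp, Finset.card_image_le.trans (hcard s hs), ?_, ?_⟩
  · simp only [Finset.mem_image]
    rintro v ⟨c, hc, rfl⟩
    rw [smul_dotProduct, dotProduct_smul, hnorm, hs.1 c hc]
    norm_num
  · intro w hw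
    set x : EuclideanSpace ℝ (Fin n) := WithLp.toLp 2 ((2 : ℝ) • w) with hx
    have hx2 : ‖x‖ = 2 := by
      have h1 : ‖x‖ ^ 2 = 2 ^ 2 := by
        rw [← hnorm]
        simp [hx, smul_dotProduct, dotProduct_smul, hw]
        norm_num
      exact (pow_left_inj₀ (norm_nonneg _) (by norm_num) (by norm_num)).1 h1
    have hex : ∃ c ∈ s, ‖c - x‖ ≤ 1 := by
      by_contra! hcon
      have hxs : x ∉ s := fun h => by have := hcon x h; simp at this; linarith
      have hins : Sep (insert x s) := by
        refine ⟨fun c hc => ?_, fun c hc d hd hcd => ?_⟩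
        · rcases Finset.mem_insert.1 hc with rfl | hc
          · exact hx2
          · exact hs.1 c hc
        · rcases Finset.mem_insert.1 hc with rfl | hc <;>
            rcases Finset.mem_insert.1 hd with rfl | hd
          · exact absurd rfl hcd
          · rw [norm_sub_rev]; exact (hcon d hd).le
          · exact (hcon c hc).le
          · exact hs.2 c hc d hd hcd
      have := hmax _ hins
      rw [Finset.card_insert_of_notMem hxs] at this
      omega
    obtain ⟨c, hc, hcx⟩ := hex
    refine ⟨_, Finset.mem_image_of_mem _ hc, ?_⟩
    have e : (1 / 2 : ℝ) • c.ofLp - w = (1 / 2 : ℝ) • (c - x).ofLp := by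
      simp [hx, smul_sub, smul_smul]
    rw [e, smul_dotProduct, dotProduct_smul, hnorm]
    have : ‖c - x‖ ^ 2 ≤ 1 := pow_le_one₀ (norm_nonneg _) hcx
    simp only [smul_eq_mul]
    linarith

/-- Compare with an extremal unit eigenvector `w`. If `v = w + δ` is also a unit vector then `2 (w ·
δ) = -|δ|²`, so the term linear in `δ` becomes quadratic and `‖A‖ (1 - 2 |δ|²) ≤ T`. This is why a
net of mesh `1/2` suffices. -/
theorem norm_le_two_mul_of_net {A : Matrix (Fin n) (Fin n) ℝ} (hA : Aᵀ = A)
    {N : Finset (Fin n → ℝ)} (hN : ∀ v ∈ N, v ⬝ᵥ v = 1)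
    (hnet : ∀ w : Fin n → ℝ, w ⬝ᵥ w = 1 → ∃ v ∈ N, (v - w) ⬝ᵥ (v - w) ≤ 1 / 4)
    {T : ℝ} (hT0 : 0 ≤ T) (hT : ∀ v ∈ N, |v ⬝ᵥ A *ᵥ v| ≤ T) : ‖A‖ ≤ 2 * T := by
  rcases isEmpty_or_nonempty (Fin n) with hn | hn
  · rw [Subsingleton.elim A 0, norm_zero]; linarith
  have hH : A.IsHermitian := by
    rwa [Matrix.IsHermitian, Matrix.conjTranspose_eq_transpose_of_trivial]
  obtain ⟨μ, w, hw, hw1, hμ⟩ := hH.exists_unit_eigenvector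
  obtain ⟨v, hv, hvw⟩ := hnet w hw1
  have hv1 := hN v hv
  have hvT := hT v hv
  obtain ⟨δ, rfl⟩ : ∃ δ, v = w + δ := ⟨v - w, by abel⟩
  rw [add_sub_cancel_left] at hvw
  have h1 : w ⬝ᵥ A *ᵥ δ = μ * (w ⬝ᵥ δ) := by
    rw [Matrix.dotProduct_mulVec, ← Matrix.mulVec_transpose, hA, hw, smul_dotProduct, smul_eq_mul]
  have h2 : 2 * (w ⬝ᵥ δ) = -(δ ⬝ᵥ δ) := by
    rw [add_dotProduct, dotProduct_add, dotProduct_add, hw1, dotProduct_comm δ w] at hv1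
    linarith
  have h3 : (w + δ) ⬝ᵥ A *ᵥ (w + δ) = μ * (1 - δ ⬝ᵥ δ) + δ ⬝ᵥ A *ᵥ δ := by
    rw [Matrix.mulVec_add, add_dotProduct, dotProduct_add, dotProduct_add, h1, hw, dotProduct_smul,
      dotProduct_smul, hw1, dotProduct_comm δ w]
    simp only [smul_eq_mul]
    linear_combination μ * h2
  have h4 := Matrix.abs_dotProduct_mulVec_le A δ
  have h5 : 0 ≤ δ ⬝ᵥ δ := by simpa using dotProduct_star_self_nonneg δ
  have h6 : |μ * (1 - δ ⬝ᵥ δ)| ≤ T + ‖A‖ * (δ ⬝ᵥ δ) := by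
    have : μ * (1 - δ ⬝ᵥ δ) = (w + δ) ⬝ᵥ A *ᵥ (w + δ) - δ ⬝ᵥ A *ᵥ δ := by rw [h3]; ring
    rw [this]
    exact (abs_sub _ _).trans (add_le_add hvT h4)
  rw [abs_mul, ← hμ, abs_of_nonneg (by linarith)] at h6
  nlinarith [norm_nonneg A]

end Net

/-! ### The Gram matrix of the hidden layer -/

section HiddenLayer

open Matrix

variable {m n d : ℕ} {σ : ℝ → ℝ} {lip : ℝ≥0}

/-- The mean of `ridgeSum` under the standard Gaussian measure. -/
noncomputable def ridgeMean (σ : ℝ → ℝ) (X : Matrix (Fin m) (Fin n) ℝ) (v : Fin n → ℝ) : ℝ :=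
  ∫ w, ridgeSum σ X v w ∂(stdGaussianPi m)

theorem lintegral_exp_ridgeSum_sub_mean_le (hσ : LipschitzWith lip σ)
    (X : Matrix (Fin m) (Fin n) ℝ) (v : Fin n → ℝ) {Q : ℝ}
    (hQ : (lip : ℝ) ^ 2 * ‖X‖ ^ 2 * ∑ α, v α ^ 2 ≤ Q) (s : ℝ) :
    ∫⁻ w, ENNReal.ofReal (Real.exp (s * (ridgeSum σ X v w - ridgeMean σ X v))) ∂(stdGaussianPi m)
      ≤ ENNReal.ofReal (Real.exp (5 / 4 * s ^ 2 * Q)) := by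
  refine (lintegral_exp_ridgeSum_centered_le hσ X v s).trans
    (ENNReal.ofReal_le_ofReal (Real.exp_le_exp.2 ?_))
  have h1 : Real.pi ^ 2 / 8 ≤ 5 / 4 := by
    have := Real.pi_lt_d2
    have := Real.pi_pos
    nlinarith
  have h0 : 0 ≤ (lip : ℝ) ^ 2 * ‖X‖ ^ 2 * ∑ α, v α ^ 2 := by positivity
  gcongr

theorem integrable_ridgeSum_sq (hσ : LipschitzWith lip σ) (X : Matrix (Fin m) (Fin n) ℝ)
    (v : Fin n → ℝ) : Integrable (fun w => ridgeSum σ X v w ^ 2) (stdGaussianPi m) := by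
  have hm := measurable_ridgeSum hσ.continuous.measurable X v
  obtain ⟨Q, hQ⟩ : ∃ Q, Q = (lip : ℝ) ^ 2 * ‖X‖ ^ 2 * ∑ α, v α ^ 2 + 1 := ⟨_, rfl⟩
  have hQ0 : 0 < Q := by rw [hQ]; positivity
  have h1 := (integral_exp_sq_div_le_two (hm.sub_const _) hQ0
    (lintegral_exp_ridgeSum_sub_mean_le hσ X v (by linarith))).1
  refine ((h1.const_mul (16 * Q)).add (integrable_const (2 * ridgeMean σ X v ^ 2))).mono'
    (by fun_prop) (Filter.Eventually.of_forall fun w => ?_)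
  rw [Real.norm_of_nonneg (sq_nonneg _)]
  have h2 := Real.add_one_le_exp ((ridgeSum σ X v w - ridgeMean σ X v) ^ 2 / (8 * Q))
  have h3 : (ridgeSum σ X v w - ridgeMean σ X v) ^ 2
      = 8 * Q * ((ridgeSum σ X v w - ridgeMean σ X v) ^ 2 / (8 * Q)) := by field_simp
  have h4 : (ridgeSum σ X v w - ridgeMean σ X v) ^ 2
      ≤ 8 * Q * Real.exp ((ridgeSum σ X v w - ridgeMean σ X v) ^ 2 / (8 * Q)) := by
    rw [h3]; gcongr; rw [← h3]; linarith
  simp only [Pi.add_apply]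
  nlinarith [sq_nonneg (ridgeSum σ X v w - 2 * ridgeMean σ X v)]

theorem hasLaw_linear_stdGaussianPi (c : Fin m → ℝ) :
    HasLaw (fun w : Fin m → ℝ => ∑ k, w k * c k)
      (gaussianReal 0 (∑ k, c k ^ 2).toNNReal) (stdGaussianPi m) := by
  set ℓ : (Fin m → ℝ) →L[ℝ] ℝ := ∑ k, c k • ContinuousLinearMap.proj k with hℓ
  have hℓapp : ∀ w, ℓ w = ∑ k, w k * c k := fun w => by simp [hℓ, mul_comm]
  have hfun : (fun w : Fin m → ℝ => ∑ k, w k * c k) = ℓ := funext fun w => (hℓapp w).symm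
  rw [hfun]
  refine ⟨ℓ.continuous.measurable.aemeasurable, ?_⟩
  have h1 := IsGaussian.map_eq_gaussianReal (μ := stdGaussianPi m) ℓ
  have h2 := mgf_gaussianReal h1
  have h3 : ∀ t, mgf ℓ (stdGaussianPi m) t = Real.exp ((∑ k, (t * c k) ^ 2) / 2) := fun t => by
    rw [← integral_exp_linear_stdGaussianPi, mgf]
    congr 1
    funext w
    change Real.exp (t * ℓ w) = _
    rw [hℓapp, Finset.mul_sum]
    congr 1
    exact Finset.sum_congr rfl fun k _ => by ring
  -- The moment generating function at `1` and `-1` determines the mean and the variance.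
  have e1 := (h2 1).symm.trans (h3 1)
  have e2 := (h2 (-1)).symm.trans (h3 (-1))
  rw [Real.exp_eq_exp] at e1 e2
  simp at e1 e2
  rw [h1]
  congr 1
  · linarith
  · congr 1
    linarith

/-- The linear form is distributed as `√q ξ`. Subtracting `E σ(ξ) = 0` leaves at most `lip * |√q -
1| * E|ξ|`, with `E|ξ| ≤ 1` and `|√q - 1| ≤ |q - 1|`. -/
theorem abs_integral_lipschitz_linear_le (hσ : LipschitzWith lip σ)
    (h0 : ∫ x, σ x ∂(gaussianReal 0 1) = 0) (c : Fin m → ℝ) :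
    |∫ w, σ (∑ k, w k * c k) ∂(stdGaussianPi m)| ≤ lip * |∑ k, c k ^ 2 - 1| := by
  have hm := hσ.continuous.measurable
  set q := ∑ k, c k ^ 2 with hq
  have hq0 : 0 ≤ q := by positivity
  have hlaw : HasLaw (fun x : ℝ => √q * x) (gaussianReal 0 q.toNNReal) (gaussianReal 0 1) := by
    refine ⟨by fun_prop, ?_⟩
    rw [gaussianReal_map_const_mul]
    congr 1
    · simp
    · rw [mul_one]
      ext
      simp [Real.sq_sqrt hq0, hq0]
  have e1 : ∫ w, σ (∑ k, w k * c k) ∂(stdGaussianPi m)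
      = ∫ x, σ (√q * x) ∂(gaussianReal 0 1) := by
    have a1 := (hasLaw_linear_stdGaussianPi c).integral_comp (f := σ) hm.aestronglyMeasurable
    have a2 := hlaw.integral_comp (f := σ) hm.aestronglyMeasurable
    exact a1.trans a2.symm
  have hid : Integrable (fun x : ℝ => x) (gaussianReal 0 1) := IsGaussian.integrable_id
  have hsq : Integrable (fun x : ℝ => x ^ 2) (gaussianReal 0 1) ∧
      ∫ x : ℝ, x ^ 2 ∂(gaussianReal 0 1) = 1 := by
    have := integral_sq_of_hasLaw_gaussianReal (P := gaussianReal 0 1) (g := fun x => x)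
      ⟨by fun_prop, by simp⟩
    exact this
  have hint : ∀ r : ℝ, Integrable (fun x => σ (r * x)) (gaussianReal 0 1) := fun r =>
    ((integrable_const |σ 0|).add ((hid.const_mul r).abs.const_mul lip)).mono'
      (hm.comp (by fun_prop)).aestronglyMeasurable
      (Filter.Eventually.of_forall fun x => abs_le_of_lipschitz hσ _)
  have e2 : ∫ x, σ (√q * x) ∂(gaussianReal 0 1)
      = ∫ x, (σ (√q * x) - σ x) ∂(gaussianReal 0 1) := by
    rw [integral_sub (hint _) (by simpa using hint 1), h0, sub_zero]
  have habs : ∫ x : ℝ, |x| ∂(gaussianReal 0 1) ≤ 1 := by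
    have h1 : ∫ x : ℝ, |x| ∂(gaussianReal 0 1) ≤ ∫ x : ℝ, (1 / 2 + 1 / 2 * x ^ 2) ∂(gaussianReal 0 1) :=
      integral_mono hid.abs ((integrable_const _).add (hsq.1.const_mul _)) fun x => by
        nlinarith [sq_nonneg (|x| - 1), sq_abs x]
    rw [integral_add (integrable_const _) (hsq.1.const_mul _), integral_const_mul, hsq.2] at h1
    refine h1.trans (le_of_eq ?_)
    simp
    norm_num
  have hsqrt : |√q - 1| ≤ |q - 1| := by
    have h1 : q - 1 = (√q - 1) * (√q + 1) := by
      have := Real.sq_sqrt hq0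
      linear_combination -this
    rw [h1, abs_mul]
    have h2 : 1 ≤ |√q + 1| := by
      rw [abs_of_nonneg (by positivity)]; linarith [Real.sqrt_nonneg q]
    exact le_mul_of_one_le_right (abs_nonneg _) h2
  rw [e1, e2, ← Real.norm_eq_abs]
  calc _ ≤ ∫ x, (lip * |√q - 1|) * |x| ∂(gaussianReal 0 1) := by
        refine norm_integral_le_of_norm_le (hid.abs.const_mul _)
          (Filter.Eventually.of_forall fun x => ?_)
        have h1 := hσ.dist_le_mul (√q * x) x
        rw [Real.dist_eq, Real.dist_eq, ← sub_one_mul, abs_mul] at h1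
        rw [Real.norm_eq_abs, mul_assoc]
        exact h1
    _ = (lip * |√q - 1|) * ∫ x, |x| ∂(gaussianReal 0 1) := integral_const_mul _ _
    _ ≤ (lip * |q - 1|) * 1 := by gcongr
    _ = _ := mul_one _

theorem abs_ridgeMean_le (hσ : LipschitzWith lip σ) (h0 : ∫ x, σ x ∂(gaussianReal 0 1) = 0)
    (X : Matrix (Fin m) (Fin n) ℝ) {B : ℝ} (hB : 0 ≤ B)
    (hX : ∑ α, (∑ k, X k α ^ 2 - 1) ^ 2 ≤ B ^ 2) {v : Fin n → ℝ} (hv : v ⬝ᵥ v = 1) :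
    |ridgeMean σ X v| ≤ lip * B := by
  have e : ridgeMean σ X v = ∑ α, v α * ∫ w, σ (∑ k, w k * X k α) ∂(stdGaussianPi m) := by
    unfold ridgeMean ridgeSum
    rw [integral_finsetSum _ fun α _ => (integrable_lipschitz_linear hσ fun k => X k α).const_mul _]
    simp only [integral_const_mul]
  have hv' : ∑ α, v α ^ 2 = 1 := by rw [← hv]; simp [dotProduct, sq]
  refine abs_le_of_sq_le_sq ?_ (by positivity)
  rw [e]
  refine (Finset.sum_mul_sq_le_sq_mul_sq _ _ _).trans ?_
  rw [hv', one_mul, mul_pow]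
  calc _ ≤ ∑ α, (lip : ℝ) ^ 2 * (∑ k, X k α ^ 2 - 1) ^ 2 := by
        refine Finset.sum_le_sum fun α _ => ?_
        rw [← mul_pow]
        refine sq_le_sq.2 ?_
        rw [abs_mul, NNReal.abs_eq]
        exact abs_integral_lipschitz_linear_le hσ h0 fun k => X k α
    _ ≤ _ := by rw [← Finset.mul_sum]; gcongr

end HiddenLayer

section HiddenLayerConcentration

set_option linter.unusedSectionVars false

open Matrix

variable {m n d : ℕ} {σ : ℝ → ℝ} {lip : ℝ≥0} {Ω : Type*} [MeasurableSpace Ω] {P : Measure Ω}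
  [IsProbabilityMeasure P]

/-- Random matrices with independent standard Gaussian rows. -/
structure GaussianRows (P : Measure Ω) (W : Ω → Matrix (Fin d) (Fin m) ℝ) : Prop where
  meas : ∀ r, Measurable fun ω => W ω r
  indep : iIndepFun (fun r ω => W ω r) P
  law : ∀ r, HasLaw (fun ω => W ω r) (stdGaussianPi m) P

theorem Y_apply (σ : ℝ → ℝ) (X : Matrix (Fin m) (Fin n) ℝ) (W : Matrix (Fin d) (Fin m) ℝ)
    (r : Fin d) (α : Fin n) : TwoLayerNet.Y σ X W r α = σ (∑ k, W r k * X k α) := by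
  simp [TwoLayerNet.Y, Matrix.mul_apply]

theorem quadForm_gram_Y (σ : ℝ → ℝ) (X : Matrix (Fin m) (Fin n) ℝ) (W : Matrix (Fin d) (Fin m) ℝ)
    (v : Fin n → ℝ) : v ⬝ᵥ ((TwoLayerNet.Y σ X W)ᵀ * TwoLayerNet.Y σ X W) *ᵥ v
      = ∑ r, ridgeSum σ X v (W r) ^ 2 := by
  rw [← Matrix.mulVec_mulVec, Matrix.dotProduct_mulVec, ← Matrix.mulVec_transpose,
    Matrix.transpose_transpose, dotProduct]
  refine Finset.sum_congr rfl fun r _ => ?_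
  rw [sq]
  simp only [Matrix.mulVec, dotProduct, Y_apply, ridgeSum, mul_comm]

namespace GaussianRows

variable {W : Ω → Matrix (Fin d) (Fin m) ℝ}

theorem integrable_gram_Y (hW : GaussianRows P W) (hσ : LipschitzWith lip σ)
    (X : Matrix (Fin m) (Fin n) ℝ) (α β : Fin n) :
    Integrable (fun ω => ((TwoLayerNet.Y σ X (W ω))ᵀ * TwoLayerNet.Y σ X (W ω)) α β) P := by
  simp only [Matrix.mul_apply, Matrix.transpose_apply, Y_apply]
  refine integrable_finsetSum _ fun r _ => ?_
  have h : ∀ α, MemLp (fun w : Fin m → ℝ => σ (∑ k, w k * X k α)) 2 (stdGaussianPi m) := fun α => by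
    rw [memLp_two_iff_integrable_sq (integrable_lipschitz_linear hσ _).aestronglyMeasurable]
    have h1 := integrable_ridgeSum_sq hσ X (Pi.single α 1)
    simpa [ridgeSum, Pi.single_apply] using h1
  have h2 := (h α).integrable_mul (h β)
  rw [← (hW.law r).map_eq] at h2
  exact h2.comp_aemeasurable (hW.law r).aemeasurable

/-- The two deviation events of a single direction `v` are unlikely. -/
theorem measure_direction_le (hW : GaussianRows P W) (hσ : LipschitzWith lip σ)
    (X : Matrix (Fin m) (Fin n) ℝ) {Q : ℝ} (hQ0 : 0 < Q) {v : Fin n → ℝ}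
    (hQ : (lip : ℝ) ^ 2 * ‖X‖ ^ 2 * ∑ α, v α ^ 2 ≤ Q) {θ s : ℝ} (hθ0 : 0 ≤ θ) (hθ1 : θ ≤ 1)
    (hs : 0 ≤ s) (t₁ t₂ : ℝ) :
    P.real {ω | d * t₁ ≤ |∑ r, ((ridgeSum σ X v (W ω r) - ridgeMean σ X v) ^ 2 / (8 * Q) -
        ∫ w, (ridgeSum σ X v w - ridgeMean σ X v) ^ 2 / (8 * Q) ∂(stdGaussianPi m))|}
      ≤ 2 * Real.exp (d * (6 * θ ^ 2 - θ * t₁)) ∧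
    P.real {ω | d * t₂ ≤ |∑ r, (ridgeSum σ X v (W ω r) - ridgeMean σ X v)|}
      ≤ 2 * Real.exp (d * (5 / 4 * s ^ 2 * Q - s * t₂)) := by
  have hm := measurable_ridgeSum hσ.continuous.measurable X v
  have hsub := lintegral_exp_ridgeSum_sub_mean_le hσ X v hQ
  have hsq := integral_exp_sq_div_le_two (hm.sub_const _) hQ0 hsub
  have htrans : ∀ {f : (Fin m → ℝ) → ℝ}, Measurable f → Integrable f (stdGaussianPi m) →
      ∀ r, Integrable (fun ω => f (W ω r)) P ∧ ∫ ω, f (W ω r) ∂P = ∫ w, f w ∂(stdGaussianPi m) := by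
    intro f hf hfi r
    constructor
    · rw [← (hW.law r).map_eq] at hfi
      exact hfi.comp_aemeasurable (hW.law r).aemeasurable
    · exact (hW.law r).integral_comp hf.aestronglyMeasurable
  have hind : ∀ {f : (Fin m → ℝ) → ℝ}, Measurable f → iIndepFun (fun r ω => f (W ω r)) P :=
    fun hf => hW.indep.comp (fun _ => _) fun _ => hf
  constructor
  · obtain ⟨V, hV⟩ : ∃ V : (Fin m → ℝ) → ℝ,
      V = fun w => (ridgeSum σ X v w - ridgeMean σ X v) ^ 2 / (8 * Q) := ⟨_, rfl⟩
    have hVm : Measurable V := by rw [hV]; fun_prop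
    have hV0 : ∀ w, 0 ≤ V w := fun w => by rw [hV]; positivity
    have hexp := (integral_exp_centered_le hVm hV0 (by rw [hV]; exact hsq.1)
      (by rw [hV]; exact hsq.2)).2
    obtain ⟨M, hM⟩ : ∃ M, M = ∫ w, V w ∂(stdGaussianPi m) := ⟨_, rfl⟩
    rw [← hM] at hexp
    have hmain := measure_abs_sum_ge_le_of_mgf_le (P := P) (Z := fun r ω => V (W ω r) - M)
      (fun r => (hVm.comp (hW.meas r)).sub_const _) (hind (f := fun w => V w - M) (hVm.sub_const _))
      hθ0 (b := 6 * θ ^ 2) (fun e he r => by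
        have h := hexp (e * θ) (by rw [abs_mul, he, one_mul, abs_of_nonneg hθ0]; exact hθ1)
        have h2 := htrans (f := fun w => Real.exp (e * θ * (V w - M))) (by fun_prop) h.1 r
        refine ⟨h2.1, h2.2.trans_le (h.2.trans (le_of_eq ?_))⟩
        rw [mul_pow, ← sq_abs e, he, one_pow, one_mul]) t₁
    simp only [Fintype.card_fin, hM] at hmain
    simp only [hV] at hmain
    exact hmain
  · have hmain := measure_abs_sum_ge_le_of_mgf_le (P := P)
      (Z := fun r ω => ridgeSum σ X v (W ω r) - ridgeMean σ X v)
      (fun r => (hm.comp (hW.meas r)).sub_const _)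
      (hind (f := fun w => ridgeSum σ X v w - ridgeMean σ X v) (hm.sub_const _))
      hs (b := 5 / 4 * s ^ 2 * Q) (fun e he r => by
        have h := integrable_of_lintegral_ofReal_le (γ := stdGaussianPi m)
          (f := fun w => Real.exp (e * s * (ridgeSum σ X v w - ridgeMean σ X v))) (by fun_prop)
          (fun _ => (Real.exp_pos _).le) (Real.exp_pos _).le (hsub (e * s))
        have h2 := htrans (by fun_prop) h.1 r
        refine ⟨h2.1, h2.2.trans_le (h.2.trans (le_of_eq ?_))⟩
        rw [mul_pow, ← sq_abs e, he, one_pow, one_mul]) t₂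
    simp only [Fintype.card_fin] at hmain
    exact hmain

/-- Per row, `g² - E g² = ((g - μ)² - E (g - μ)²) + 2 μ (g - μ)`. The scale `8 Q` matches the
exponential moment bound for the squared deviation. -/
theorem quadForm_centered_gram (hW : GaussianRows P W) (hσ : LipschitzWith lip σ)
    (X : Matrix (Fin m) (Fin n) ℝ) {Q : ℝ} (hQ0 : 0 < Q) (v : Fin n → ℝ) (ω : Ω) :
    v ⬝ᵥ ((TwoLayerNet.Y σ X (W ω))ᵀ * TwoLayerNet.Y σ X (W ω)
      - TwoLayerNet.expect P fun ω' => (TwoLayerNet.Y σ X (W ω'))ᵀ * TwoLayerNet.Y σ X (W ω')) *ᵥ v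
      = 8 * Q * (∑ r, ((ridgeSum σ X v (W ω r) - ridgeMean σ X v) ^ 2 / (8 * Q) -
        ∫ w, (ridgeSum σ X v w - ridgeMean σ X v) ^ 2 / (8 * Q) ∂(stdGaussianPi m)))
        + 2 * ridgeMean σ X v * ∑ r, (ridgeSum σ X v (W ω r) - ridgeMean σ X v) := by
  have hi2 := integrable_ridgeSum_sq hσ X v
  have hi := integrable_ridgeSum hσ X v
  have hm := measurable_ridgeSum hσ.continuous.measurable X v
  obtain ⟨μ, hμ⟩ : ∃ μ, μ = ridgeMean σ X v := ⟨_, rfl⟩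
  have hmean : ∫ w, ridgeSum σ X v w ∂(stdGaussianPi m) = μ := hμ.symm
  rw [Matrix.sub_mulVec, dotProduct_sub, quadForm_gram_Y, TwoLayerNet.expect,
    integral_quadForm (hW.integrable_gram_Y hσ X) v]
  simp only [quadForm_gram_Y]
  have hI : ∀ r, Integrable (fun ω => ridgeSum σ X v (W ω r) ^ 2) P ∧
      ∫ ω, ridgeSum σ X v (W ω r) ^ 2 ∂P = ∫ w, ridgeSum σ X v w ^ 2 ∂(stdGaussianPi m) := fun r => by
    constructor
    · rw [← (hW.law r).map_eq] at hi2
      exact hi2.comp_aemeasurable (hW.law r).aemeasurable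
    · exact (hW.law r).integral_comp (f := fun w => ridgeSum σ X v w ^ 2)
        (hm.pow_const 2).aestronglyMeasurable
  rw [integral_finsetSum _ fun r _ => (hI r).1]
  simp only [(hI _).2]
  have hvar : ∫ w, (ridgeSum σ X v w - μ) ^ 2 / (8 * Q) ∂(stdGaussianPi m)
      = (∫ w, ridgeSum σ X v w ^ 2 ∂(stdGaussianPi m) - μ ^ 2) / (8 * Q) := by
    rw [integral_div]
    congr 1
    have e : ∀ w, (ridgeSum σ X v w - μ) ^ 2
        = ridgeSum σ X v w ^ 2 - (2 * μ * ridgeSum σ X v w - μ ^ 2) := fun w => by ring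
    simp_rw [e]
    have i1 : Integrable (fun w => 2 * μ * ridgeSum σ X v w - μ ^ 2) (stdGaussianPi m) :=
      (hi.const_mul _).sub (integrable_const _)
    rw [integral_sub hi2 i1, integral_sub (hi.const_mul _) (integrable_const _),
      integral_const_mul, hmean]
    simp
    ring
  rw [← hμ, hvar, Finset.mul_sum, Finset.mul_sum, ← Finset.sum_add_distrib,
    ← Finset.sum_sub_distrib]
  refine Finset.sum_congr rfl fun r _ => ?_
  field_simp
  ring

/-- Concentration of the Gram matrix of the hidden layer. -/
theorem measure_gram_Y_le (hW : GaussianRows P W) (hσ : LipschitzWith lip σ)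
    (X : Matrix (Fin m) (Fin n) ℝ) (hd : 0 < d) (hQ0 : 0 < (lip : ℝ) * ‖X‖)
    (h0 : ∫ x, σ x ∂(gaussianReal 0 1) = 0) {B : ℝ} (hB : 0 ≤ B)
    (hX : ∑ α, (∑ k, X k α ^ 2 - 1) ^ 2 ≤ B ^ 2) :
    P.real {ω | 160 * (√((n : ℝ) / d) + (n : ℝ) / d) * (lip : ℝ) ^ 2 * ‖X‖ ^ 2
        + 32 * B * (lip : ℝ) ^ 2 * ‖X‖ * √((n : ℝ) / d) <
      ‖(1 / (d : ℝ)) • ((TwoLayerNet.Y σ X (W ω))ᵀ * TwoLayerNet.Y σ X (W ω)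
      - TwoLayerNet.expect P fun ω' => (TwoLayerNet.Y σ X (W ω'))ᵀ * TwoLayerNet.Y σ X (W ω'))‖}
      ≤ 4 * Real.exp (-2 * n) := by
  obtain ⟨N, hNcard, hN1, hNnet⟩ := exists_half_net n
  obtain ⟨K, hK⟩ : ∃ K, K = (lip : ℝ) * ‖X‖ := ⟨_, rfl⟩
  obtain ⟨u, hu⟩ : ∃ u, u = √((n : ℝ) / d) := ⟨_, rfl⟩
  have hd0 : (0 : ℝ) < d := by exact_mod_cast hd
  have hK0 : 0 < K := hK ▸ hQ0
  have hu0 : 0 ≤ u := hu ▸ Real.sqrt_nonneg _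
  have hu2 : u ^ 2 = n / d := hu ▸ Real.sq_sqrt (by positivity)
  have hn : (n : ℝ) = d * u ^ 2 := by rw [hu2]; field_simp
  obtain ⟨t₁, ht₁⟩ : ∃ t, t = 10 * (u + u ^ 2) := ⟨_, rfl⟩
  obtain ⟨t₂, ht₂⟩ : ∃ t, t = 8 * K * u := ⟨_, rfl⟩
  set E₁ : (Fin n → ℝ) → Set Ω := fun v => {ω | d * t₁ ≤ |∑ r, ((ridgeSum σ X v (W ω r) -
    ridgeMean σ X v) ^ 2 / (8 * K ^ 2) - ∫ w, (ridgeSum σ X v w - ridgeMean σ X v) ^ 2 / (8 * K ^ 2)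
      ∂(stdGaussianPi m))|} with hE₁
  set E₂ : (Fin n → ℝ) → Set Ω := fun v =>
    {ω | d * t₂ ≤ |∑ r, (ridgeSum σ X v (W ω r) - ridgeMean σ X v)|} with hE₂
  -- Both exponents must beat `-4 u²`, that is `e^(-4n)` after summing over rows. The choice `θ =
  -- min(u, 1)` serves the quadratic part and `s = 3 u / K` the linear one, where the exponent is
  -- `45/4 - 24 = -51/4` times `u²`.
  obtain ⟨θ, hθ0, hθ1, hθ⟩ : ∃ θ : ℝ, 0 ≤ θ ∧ θ ≤ 1 ∧ 6 * θ ^ 2 - θ * t₁ ≤ -4 * u ^ 2 := by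
    rcases le_total u 1 with h | h
    · exact ⟨u, hu0, h, by rw [ht₁]; nlinarith [pow_nonneg hu0 3]⟩
    · exact ⟨1, by norm_num, le_rfl, by rw [ht₁]; nlinarith⟩
  have hs : 5 / 4 * (3 * u / K) ^ 2 * K ^ 2 - 3 * u / K * t₂ ≤ -4 * u ^ 2 := by
    have e : 5 / 4 * (3 * u / K) ^ 2 * K ^ 2 - 3 * u / K * t₂ = -(51 / 4) * u ^ 2 := by
      rw [ht₂]; field_simp; ring
    rw [e]; nlinarith [sq_nonneg u]
  have hexp : ∀ {x : ℝ}, x ≤ -4 * u ^ 2 → Real.exp (d * x) ≤ Real.exp (-4 * n) := by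
    intro x hx
    rw [Real.exp_le_exp, hn]
    nlinarith
  have hdir : ∀ v ∈ N, P.real (E₁ v ∪ E₂ v) ≤ 4 * Real.exp (-4 * n) := by
    intro v hv
    have hv1 : ∑ α, v α ^ 2 = 1 := by rw [← hN1 v hv]; simp [dotProduct, sq]
    have h := hW.measure_direction_le hσ X (Q := K ^ 2) (by positivity) (v := v)
      (by rw [hv1, hK, mul_one, mul_pow]) hθ0 hθ1 (s := 3 * u / K) (by positivity) t₁ t₂
    have h1 := h.1.trans (mul_le_mul_of_nonneg_left (hexp hθ) (by norm_num))
    have h2 := h.2.trans (mul_le_mul_of_nonneg_left (hexp hs) (by norm_num))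
    calc _ ≤ P.real (E₁ v) + P.real (E₂ v) := measureReal_union_le _ _
      _ ≤ _ := by linarith
  have hsub : {ω | 160 * (√((n : ℝ) / d) + (n : ℝ) / d) * (lip : ℝ) ^ 2 * ‖X‖ ^ 2
        + 32 * B * (lip : ℝ) ^ 2 * ‖X‖ * √((n : ℝ) / d) <
      ‖(1 / (d : ℝ)) • ((TwoLayerNet.Y σ X (W ω))ᵀ * TwoLayerNet.Y σ X (W ω)
      - TwoLayerNet.expect P fun ω' => (TwoLayerNet.Y σ X (W ω'))ᵀ * TwoLayerNet.Y σ X (W ω'))‖}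
      ⊆ ⋃ v ∈ N, (E₁ v ∪ E₂ v) := by
    intro ω hω
    by_contra hcon
    simp only [Set.mem_iUnion, Set.mem_union, not_exists, not_or] at hcon
    rw [Set.mem_ofPred_eq] at hω
    refine absurd hω (not_lt.2 ?_)
    have hT : ∀ v ∈ N, |v ⬝ᵥ ((1 / (d : ℝ)) • ((TwoLayerNet.Y σ X (W ω))ᵀ * TwoLayerNet.Y σ X (W ω)
        - TwoLayerNet.expect P fun ω' => (TwoLayerNet.Y σ X (W ω'))ᵀ * TwoLayerNet.Y σ X (W ω')))
          *ᵥ v| ≤ 8 * K ^ 2 * t₁ + 2 * (lip * B) * t₂ := by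
      intro v hv
      obtain ⟨c1, c2⟩ := hcon v hv
      simp only [hE₁, hE₂, Set.mem_ofPred_eq, not_le] at c1 c2
      have hmean := abs_ridgeMean_le hσ h0 X hB hX (hN1 v hv)
      rw [Matrix.smul_mulVec, dotProduct_smul,
        hW.quadForm_centered_gram hσ X (Q := K ^ 2) (by positivity), smul_eq_mul, abs_mul,
        abs_of_pos (by positivity), one_div, inv_mul_le_iff₀ hd0]
      refine (abs_add_le _ _).trans ?_
      rw [abs_mul (8 * K ^ 2), abs_mul (2 * ridgeMean σ X v), abs_mul (2 : ℝ),
        abs_of_pos (by positivity : 0 < 8 * K ^ 2), abs_two]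
      have ht₂0 : 0 ≤ t₂ := by rw [ht₂]; positivity
      calc _ ≤ 8 * K ^ 2 * (d * t₁) + 2 * (lip * B) * (d * t₂) := by gcongr
        _ = _ := by ring
    have hsymm : ((1 / (d : ℝ)) • ((TwoLayerNet.Y σ X (W ω))ᵀ * TwoLayerNet.Y σ X (W ω)
        - TwoLayerNet.expect P fun ω' => (TwoLayerNet.Y σ X (W ω'))ᵀ * TwoLayerNet.Y σ X (W ω')))ᵀ
        = (1 / (d : ℝ)) • ((TwoLayerNet.Y σ X (W ω))ᵀ * TwoLayerNet.Y σ X (W ω)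
        - TwoLayerNet.expect P fun ω' => (TwoLayerNet.Y σ X (W ω'))ᵀ * TwoLayerNet.Y σ X (W ω')) := by
      have : (TwoLayerNet.expect P fun ω' => (TwoLayerNet.Y σ X (W ω'))ᵀ * TwoLayerNet.Y σ X (W ω'))ᵀ
          = TwoLayerNet.expect P fun ω' => (TwoLayerNet.Y σ X (W ω'))ᵀ * TwoLayerNet.Y σ X (W ω') := by
        ext i j
        simp only [TwoLayerNet.expect, Matrix.transpose_apply, Matrix.of_apply, Matrix.mul_apply,
          mul_comm]
      rw [Matrix.transpose_smul, Matrix.transpose_sub, this, Matrix.transpose_mul,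
        Matrix.transpose_transpose]
    -- The net doubles the bound, giving `2 * 8 * 10 = 160` and `2 * 2 * 8 = 32`.
    have hfin := norm_le_two_mul_of_net hsymm hN1 hNnet (by rw [ht₁, ht₂]; positivity) hT
    refine hfin.trans (le_of_eq ?_)
    rw [← hu, ← hu2, ht₁, ht₂, hK]
    ring
  -- The `5 ^ n` directions cost at most `e^(2n)`, leaving `e^(-2n)` of `e^(-4n)`.
  have h5 : (5 : ℝ) ≤ Real.exp 2 := by
    have h := Real.sum_le_exp_of_nonneg (x := 2) (by norm_num) 3
    norm_num [Finset.sum_range_succ, Nat.factorial] at h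
    exact h
  calc _ ≤ P.real (⋃ v ∈ N, (E₁ v ∪ E₂ v)) := measureReal_mono hsub (measure_ne_top _ _)
    _ ≤ ∑ v ∈ N, P.real (E₁ v ∪ E₂ v) := measureReal_biUnion_finset_le _ _
    _ ≤ ∑ _v ∈ N, 4 * Real.exp (-4 * n) := Finset.sum_le_sum hdir
    _ = N.card * (4 * Real.exp (-4 * n)) := by rw [Finset.sum_const, nsmul_eq_mul]
    _ ≤ Real.exp 2 ^ n * (4 * Real.exp (-4 * n)) := by
        gcongr
        calc (N.card : ℝ) ≤ (5 : ℝ) ^ n := by exact_mod_cast hNcard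
          _ ≤ _ := by gcongr
    _ = _ := by
        rw [← Real.exp_nat_mul, mul_left_comm, ← Real.exp_add]
        ring_nf

end GaussianRows

end HiddenLayerConcentration

/-! ### Independence of the neurons -/

section Independence

/-- Independence says that the joint law is a product measure, and currying sends a product over
pairs to a product of products. -/
theorem ProbabilityTheory.iIndepFun.curry {Ω ι κ : Type*} [MeasurableSpace Ω] {P : Measure Ω}
    {β : Type*} [MeasurableSpace β] {f : ι × κ → Ω → β} (h : iIndepFun f P)
    (hf : ∀ p, Measurable (f p)) : iIndepFun (fun i ω k => f (i, k) ω) P := by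
  have := h.isProbabilityMeasure
  have : ∀ p, IsProbabilityMeasure (P.map (f p)) :=
    fun p => Measure.isProbabilityMeasure_map (hf p).aemeasurable
  have hrow : ∀ i, P.map (fun ω k => f (i, k) ω)
      = Measure.infinitePi fun k => P.map (f (i, k)) := fun i =>
    (iIndepFun_iff_map_fun_eq_infinitePi_map (fun k => hf (i, k))).1
      (h.precomp (g := fun k => (i, k)) (Prod.mk_right_injective i))
  rw [iIndepFun_iff_map_fun_eq_infinitePi_map (by fun_prop)]
  simp_rw [hrow]
  have hall := (iIndepFun_iff_map_fun_eq_infinitePi_map hf).1 h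
  have hcurry := Measure.infinitePi_map_curry (fun i k => P.map (f (i, k)))
  rw [← hcurry, ← hall, Measure.map_map (by fun_prop) (by fun_prop)]
  rfl

namespace TwoLayerNet

variable {Ω : Type*} [MeasurableSpace Ω] {d₀ d₁ : ℕ} {P : Measure Ω}
  {W : Ω → Matrix (Fin d₁) (Fin d₀) ℝ} {a : Ω → Fin d₁ → ℝ}

theorem GaussianWeights.iIndepFun_rows (h : GaussianWeights P W a)
    (hW : ∀ r k, Measurable fun ω => W ω r k) (ha : ∀ r, Measurable fun ω => a ω r) :
    iIndepFun (fun r ω => (W ω r, a ω r)) P := by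
  -- Weights regrouped by neuron: `none` is the output weight, `some k` the input weights.
  let g : Fin d₁ × Option (Fin d₀) → (Fin d₁ × Fin d₀) ⊕ Fin d₁ :=
    fun p => p.2.elim (Sum.inr p.1) fun k => Sum.inl (p.1, k)
  have hg : Function.Injective g := by
    rintro ⟨r, _ | k⟩ ⟨r', _ | k'⟩ hp <;> simp_all [g]
  have hm : ∀ q, Measurable (Sum.elim (fun (p : Fin d₁ × Fin d₀) (ω : Ω) => W ω p.1 p.2)
      (fun (r : Fin d₁) (ω : Ω) => a ω r) q) := by
    rintro (⟨r, k⟩ | r)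
    · exact hW r k
    · exact ha r
  have hrows := (h.indep.precomp hg).curry (fun p => hm (g p))
  exact hrows.comp (fun _ v => ((fun k => v (some k) : Fin d₀ → ℝ), v none)) (by fun_prop)

theorem GaussianWeights.gaussianRows (h : GaussianWeights P W a)
    (hW : ∀ r k, Measurable fun ω => W ω r k) (ha : ∀ r, Measurable fun ω => a ω r) :
    GaussianRows P W where
  meas r := measurable_pi_iff.2 (hW r)
  indep := (h.iIndepFun_rows hW ha).comp (fun _ p => p.1) (fun _ => measurable_fst)
  law r := by
    have := h.indep.isProbabilityMeasure
    refine ⟨(measurable_pi_iff.2 (hW r)).aemeasurable, ?_⟩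
    have hi : iIndepFun (fun k ω => W ω r k) P :=
      h.indep.precomp (g := fun k => Sum.inl (r, k)) fun k k' hk => by simpa using hk
    rw [stdGaussianPi]
    refine ((iIndepFun_iff_map_fun_eq_pi_map (fun k => (hW r k).aemeasurable)).1 hi).trans ?_
    simp_rw [(h.law_W r _).map_eq]

/-- Gaussian weights agree almost surely with everywhere measurable ones. -/
theorem GaussianWeights.exists_measurable (h : GaussianWeights P W a) :
    ∃ (W' : Ω → Matrix (Fin d₁) (Fin d₀) ℝ) (a' : Ω → Fin d₁ → ℝ), GaussianWeights P W' a' ∧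
      (∀ r k, Measurable fun ω => W' ω r k) ∧ (∀ r, Measurable fun ω => a' ω r) ∧
      W =ᵐ[P] W' ∧ a =ᵐ[P] a' := by
  have mW := fun r k => (h.law_W r k).aemeasurable
  have ma := fun r => (h.law_a r).aemeasurable
  have eW : ∀ r k, (fun ω => W ω r k) =ᵐ[P] (mW r k).mk := fun r k => (mW r k).ae_eq_mk
  have ea : ∀ r, (fun ω => a ω r) =ᵐ[P] (ma r).mk := fun r => (ma r).ae_eq_mk
  refine ⟨fun ω r k => (mW r k).mk _ ω, fun ω r => (ma r).mk _ ω, ⟨?_, ?_, ?_⟩, ?_, ?_, ?_, ?_⟩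
  · exact fun r k => (h.law_W r k).congr (eW r k).symm
  · exact fun r => (h.law_a r).congr (ea r).symm
  · refine h.indep.congr ?_
    rintro (⟨r, k⟩ | r)
    · exact eW r k
    · exact ea r
  · exact fun r k => (mW r k).measurable_mk
  · exact fun r => (ma r).measurable_mk
  · have : ∀ᵐ ω ∂P, ∀ r k, W ω r k = (mW r k).mk _ ω :=
      ae_all_iff.2 fun r => ae_all_iff.2 fun k => eW r k
    filter_upwards [this] with ω hω
    ext r k
    exact hω r k
  · have : ∀ᵐ ω ∂P, ∀ r, a ω r = (ma r).mk _ ω := ae_all_iff.2 ea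
    filter_upwards [this] with ω hω
    ext r
    exact hω r

end TwoLayerNet

end Independence

/-! ### The derivative part of the kernel -/

section DerivativePart

set_option linter.unusedSectionVars false

namespace TwoLayerNet

variable {d₀ d₁ n : ℕ} {σ : ℝ → ℝ} {lip : ℝ≥0} {X : Matrix (Fin d₀) (Fin n) ℝ}

/-- The contribution to `(Sᵀ S) ⊙ (Xᵀ X)` of one hidden neuron with input weights `b.1` and
output weight `b.2`. -/
noncomputable def neuronMatrix (σ : ℝ → ℝ) (X : Matrix (Fin d₀) (Fin n) ℝ)
    (b : (Fin d₀ → ℝ) × ℝ) : Matrix (Fin n) (Fin n) ℝ :=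
  (X * Matrix.diagonal fun α => deriv σ (∑ k, b.1 k * X k α) * b.2)ᵀ *
    (X * Matrix.diagonal fun α => deriv σ (∑ k, b.1 k * X k α) * b.2)

theorem neuronMatrix_apply (b : (Fin d₀ → ℝ) × ℝ) (α β : Fin n) :
    neuronMatrix σ X b α β = deriv σ (∑ k, b.1 k * X k α) * b.2 *
      (deriv σ (∑ k, b.1 k * X k β) * b.2) * (Xᵀ * X) α β := by
  rw [neuronMatrix, Matrix.mul_apply, Matrix.mul_apply, Finset.mul_sum]
  simp only [Matrix.transpose_apply, Matrix.mul_diagonal]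
  exact Finset.sum_congr rfl fun k _ => by ring

theorem measurable_neuronMatrix_apply (α β : Fin n) :
    Measurable fun b => neuronMatrix σ X b α β := by
  simp only [neuronMatrix_apply]
  have hm : ∀ γ, Measurable fun b : (Fin d₀ → ℝ) × ℝ => deriv σ (∑ k, b.1 k * X k γ) := fun γ =>
    (measurable_deriv σ).comp (by fun_prop)
  exact (((hm α).mul measurable_snd).mul ((hm β).mul measurable_snd)).mul_const _

theorem posSemidef_neuronMatrix (b : (Fin d₀ → ℝ) × ℝ) : (neuronMatrix σ X b).PosSemidef := by
  rw [neuronMatrix, ← Matrix.conjTranspose_eq_transpose_of_trivial]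
  exact Matrix.posSemidef_conjTranspose_mul_self _

/-- The form is `‖X D v‖²` with `D` diagonal and entries at most `lip * |b.2|`. The bound on `deriv
σ` holds at every point, its value being `0` where `σ` is not differentiable. -/
theorem quadForm_neuronMatrix_le (hσ : LipschitzWith lip σ) (b : (Fin d₀ → ℝ) × ℝ)
    (v : Fin n → ℝ) :
    v ⬝ᵥ neuronMatrix σ X b *ᵥ v ≤ b.2 ^ 2 * (lip ^ 2 * ‖X‖ ^ 2) * (v ⬝ᵥ v) := by
  set s : Fin n → ℝ := fun α => deriv σ (∑ k, b.1 k * X k α) * b.2 with hs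
  have h1 : v ⬝ᵥ neuronMatrix σ X b *ᵥ v = ∑ k, (∑ α, X k α * (s α * v α)) ^ 2 := by
    rw [neuronMatrix, ← Matrix.mulVec_mulVec, Matrix.dotProduct_mulVec, Matrix.vecMul_transpose]
    simp only [dotProduct, Matrix.mulVec, Matrix.mul_diagonal, ← sq, ← hs, mul_assoc]
  have hsq : ∀ α, (s α * v α) ^ 2 ≤ lip ^ 2 * b.2 ^ 2 * (v α * v α) := fun α => by
    have hd : deriv σ (∑ k, b.1 k * X k α) ^ 2 ≤ (lip : ℝ) ^ 2 :=
      sq_le_sq' (abs_le.1 (norm_deriv_le_of_lipschitz hσ)).1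
        (abs_le.1 (norm_deriv_le_of_lipschitz hσ)).2
    calc (s α * v α) ^ 2
        = deriv σ (∑ k, b.1 k * X k α) ^ 2 * (b.2 ^ 2 * (v α * v α)) := by rw [hs]; ring
      _ ≤ lip ^ 2 * (b.2 ^ 2 * (v α * v α)) :=
          mul_le_mul_of_nonneg_right hd (mul_nonneg (sq_nonneg _) (mul_self_nonneg _))
      _ = _ := by ring
  rw [h1]
  calc _ ≤ ‖X‖ ^ 2 * ∑ α, (s α * v α) ^ 2 := sum_sq_mulVec_le X _
    _ ≤ ‖X‖ ^ 2 * ∑ α, lip ^ 2 * b.2 ^ 2 * (v α * v α) := by gcongr with α; exact hsq α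
    _ = _ := by rw [← Finset.mul_sum, dotProduct]; ring

theorem gram_S_hadamard (W : Matrix (Fin d₁) (Fin d₀) ℝ) (a : Fin d₁ → ℝ) :
    ((S σ X W a)ᵀ * S σ X W a) ⊙ (Xᵀ * X) = ∑ r, neuronMatrix σ X (W r, a r) := by
  ext α β
  rw [Matrix.hadamard_apply, Matrix.mul_apply, Finset.sum_mul, Matrix.sum_apply]
  exact Finset.sum_congr rfl fun r _ => by
    rw [neuronMatrix_apply, Matrix.transpose_apply, S, Matrix.of_apply, Matrix.of_apply,
      Matrix.mul_apply, Matrix.mul_apply]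

variable {Ω : Type*} [MeasurableSpace Ω] {P : Measure Ω} [IsProbabilityMeasure P]
  {W : Ω → Matrix (Fin d₁) (Fin d₀) ℝ} {a : Ω → Fin d₁ → ℝ}

theorem GaussianWeights.gaussianWeighted (h : GaussianWeights P W a)
    (hW : ∀ r k, Measurable fun ω => W ω r k) (ha : ∀ r, Measurable fun ω => a ω r)
    (hσ : LipschitzWith lip σ) (hX : 0 < lip * ‖X‖) :
    GaussianWeighted P (fun r ω => (W ω r, a ω r)) (neuronMatrix σ X) (fun b => b.2)
      (lip ^ 2 * ‖X‖ ^ 2) where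
  meas_q r := (measurable_pi_iff.2 (hW r)).prodMk (ha r)
  indep := h.iIndepFun_rows hW ha
  meas_A := measurable_neuronMatrix_apply
  psd := posSemidef_neuronMatrix
  meas_α := measurable_snd
  law := h.law_a
  pos := by rw [← mul_pow]; positivity
  bound := quadForm_neuronMatrix_le hσ

/-- No integrability is needed: a constant factor always leaves the Bochner integral. -/
theorem expect_hadamard (M : Ω → Matrix (Fin n) (Fin n) ℝ) (G : Matrix (Fin n) (Fin n) ℝ) :
    expect P M ⊙ G = expect P fun ω => M ω ⊙ G := by
  ext i j
  simp only [expect, Matrix.hadamard_apply, Matrix.of_apply, integral_mul_const]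

theorem L_eq_smul_centered
    (hA : GaussianWeighted P (fun r ω => (W ω r, a ω r)) (neuronMatrix σ X) (fun b => b.2)
      (lip ^ 2 * ‖X‖ ^ 2)) (ω : Ω) :
    L P σ X W a ω = (1 / (d₁ : ℝ)) • GaussianWeighted.centered P (fun r ω => (W ω r, a ω r))
      (neuronMatrix σ X) ω := by
  have hsub : ∀ A B G : Matrix (Fin n) (Fin n) ℝ, (A - B) ⊙ G = A ⊙ G - B ⊙ G := fun A B G => by
    ext i j
    simp [sub_mul]
  rw [L, GaussianWeighted.centered, Finset.sum_sub_distrib, ← gram_S_hadamard, hsub,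
    expect_hadamard]
  congr 2
  ext i j
  simp only [gram_S_hadamard, expect, Matrix.of_apply, Matrix.sum_apply, GaussianWeighted.mean]
  exact integral_finsetSum _ fun r _ => hA.integrable_apply r i j

/-- The degenerate case, excluded from `GaussianWeighted` by the positivity of its bound `M`. -/
theorem L_eq_zero (hσ : LipschitzWith lip σ) (hX : (lip : ℝ) * ‖X‖ = 0) (ω : Ω) :
    L P σ X W a ω = 0 := by
  rcases mul_eq_zero.1 hX with h0 | h0
  · have hd : ∀ x, deriv σ x = 0 := fun x => by
      have := norm_deriv_le_of_lipschitz (x₀ := x) hσ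
      rw [h0] at this
      exact norm_le_zero_iff.1 this
    have hS : ∀ W a, S σ X W a = (0 : Matrix (Fin d₁) (Fin n) ℝ) := fun W a => by
      ext r α
      simp [S, hd]
    have hE : expect P (fun _ : Ω => (0 : Matrix (Fin n) (Fin n) ℝ)) = 0 := by
      ext i j
      simp [expect]
    simp [L, hS, hE]
  · rw [norm_eq_zero] at h0
    simp [L, h0]

theorem GaussianWeights.measure_norm_L_gt_le_of_measurable (h : GaussianWeights P W a)
    (hW : ∀ r k, Measurable fun ω => W ω r k) (ha : ∀ r, Measurable fun ω => a ω r)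
    (hσ : LipschitzWith lip σ) (hn : 2 ≤ n) (hd : Real.log n ≤ d₁) :
    P.real {ω | 10 * (lip : ℝ) ^ 2 * ‖X‖ ^ 2 * √(Real.log n / d₁) < ‖L P σ X W a ω‖}
      ≤ (n : ℝ) ^ (-(7 / 3) : ℝ) := by
  rcases (show 0 ≤ (lip : ℝ) * ‖X‖ by positivity).eq_or_lt' with h0 | h0
  · have : {ω | 10 * (lip : ℝ) ^ 2 * ‖X‖ ^ 2 * √(Real.log n / d₁) < ‖L P σ X W a ω‖} = ∅ := by
      refine Set.eq_empty_of_forall_notMem fun ω hω => ?_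
      rw [Set.mem_ofPred_eq, L_eq_zero hσ h0, norm_zero] at hω
      exact absurd hω (not_lt.2 (by positivity))
    rw [this, measureReal_empty]
    positivity
  have hA := h.gaussianWeighted hW ha hσ h0
  have hlog : 0 < Real.log n := Real.log_pos (by exact_mod_cast hn)
  have hd0 : (0 : ℝ) < d₁ := hlog.trans_le hd
  have hu : (Fintype.card (Fin d₁) : ℝ) * √(Real.log n / d₁) ^ 2
      = Real.log (Fintype.card (Fin n)) := by
    rw [Real.sq_sqrt (by positivity), Fintype.card_fin, Fintype.card_fin]
    field_simp
  have := hA.measure_norm_centered_gt_le (by simpa using hn) (Real.sqrt_nonneg (Real.log n / d₁))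
    (Real.sqrt_le_one.2 ((div_le_one hd0).2 hd)) hu
  rw [Fintype.card_fin, Fintype.card_fin] at this
  refine (measureReal_mono (fun ω hω => ?_) (measure_ne_top _ _)).trans this
  rw [Set.mem_ofPred_eq, L_eq_smul_centered hA, norm_smul, Real.norm_of_nonneg (by positivity),
    one_div, lt_inv_mul_iff₀ hd0] at hω
  rw [Set.mem_ofPred_eq]
  refine lt_of_eq_of_lt ?_ hω
  ring

end TwoLayerNet

end DerivativePart

/-! ### The whole tangent kernel -/

section TangentKernel

set_option linter.unusedSectionVars false

namespace TwoLayerNet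

variable {d₀ d₁ n : ℕ} {σ : ℝ → ℝ} {lip : ℝ≥0} {X : Matrix (Fin d₀) (Fin n) ℝ}
  {Ω : Type*} [MeasurableSpace Ω] {P : Measure Ω} [IsProbabilityMeasure P]
  {W : Ω → Matrix (Fin d₁) (Fin d₀) ℝ} {a : Ω → Fin d₁ → ℝ}

theorem expect_congr_ae {m k : Type*} {M N : Ω → Matrix m k ℝ} (h : M =ᵐ[P] N) :
    expect P M = expect P N := by
  ext i j
  exact integral_congr_ae (h.mono fun ω hω => congrFun (congrFun hω i) j)

/-- Subadditivity alone gives this direction, so the events need not be measurable. -/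
theorem one_sub_measureReal_lt_le (f : Ω → ℝ) (c : ℝ) :
    1 - P.real {ω | c < f ω} ≤ P.real {ω | f ω ≤ c} := by
  have h := measureReal_union_le (μ := P) {ω | c < f ω} {ω | f ω ≤ c}
  have hu : {ω | c < f ω} ∪ {ω | f ω ≤ c} = Set.univ :=
    Set.eq_univ_of_forall fun ω => lt_or_ge c (f ω)
  rw [hu, probReal_univ] at h
  linarith

theorem H_eq_const (hσ : LipschitzWith lip σ) (hX : (lip : ℝ) * ‖X‖ = 0)
    (W : Matrix (Fin d₁) (Fin d₀) ℝ) (a : Fin d₁ → ℝ) : H σ X W a = H σ X (0 : Matrix (Fin d₁) (Fin d₀) ℝ) 0 := by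
  rcases mul_eq_zero.1 hX with h0 | h0
  · have hd : ∀ x, deriv σ x = 0 := fun x => by
      have := norm_deriv_le_of_lipschitz (x₀ := x) hσ
      rw [h0] at this
      exact norm_le_zero_iff.1 this
    have hS : ∀ W a, S σ X W a = (0 : Matrix (Fin d₁) (Fin n) ℝ) := fun W a => by
      ext r α
      simp [S, hd]
    have hY : Y σ X W = Y σ X 0 := by
      ext r α
      have := hσ.dist_le_mul ((W * X) r α) (((0 : Matrix (Fin d₁) (Fin d₀) ℝ) * X) r α)
      rw [h0, zero_mul] at this
      exact dist_le_zero.1 this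
    rw [H, H, hS, hS, hY]
  · rw [norm_eq_zero] at h0
    subst h0
    simp [H, Y]

theorem H_sub_expect_eq (hW : GaussianRows P W) (hσ : LipschitzWith lip σ)
    (hA : GaussianWeighted P (fun r ω => (W ω r, a ω r)) (neuronMatrix σ X) (fun b => b.2)
      (lip ^ 2 * ‖X‖ ^ 2)) (ω : Ω) :
    H σ X (W ω) (a ω) - expect P (fun ω' => H σ X (W ω') (a ω'))
      = (1 / (d₁ : ℝ)) • ((Y σ X (W ω))ᵀ * Y σ X (W ω)
          - expect P fun ω' => (Y σ X (W ω'))ᵀ * Y σ X (W ω')) + L P σ X W a ω := by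
  rw [L_eq_smul_centered hA, GaussianWeighted.centered, Finset.sum_sub_distrib, ← gram_S_hadamard,
    ← smul_add, sub_add_sub_comm, smul_sub, H]
  congr 1
  ext i j
  simp only [expect, H, gram_S_hadamard, Matrix.of_apply, Matrix.smul_apply, Matrix.add_apply,
    Matrix.sum_apply, GaussianWeighted.mean, smul_eq_mul, integral_const_mul]
  rw [integral_add (hW.integrable_gram_Y hσ X i j)
    (integrable_finsetSum _ fun r _ => hA.integrable_apply r i j),
    integral_finsetSum _ fun r _ => hA.integrable_apply r i j]

theorem GaussianWeights.measure_norm_L_gt_le (h : GaussianWeights P W a)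
    (hσ : LipschitzWith lip σ) (hn : 2 ≤ n) (hd : Real.log n ≤ d₁) :
    P.real {ω | 10 * (lip : ℝ) ^ 2 * ‖X‖ ^ 2 * √(Real.log n / d₁) < ‖L P σ X W a ω‖}
      ≤ (n : ℝ) ^ (-(7 / 3) : ℝ) := by
  obtain ⟨W', a', h', hW', ha', eW, ea⟩ := h.exists_measurable
  have hE : expect P (fun ω' => (S σ X (W ω') (a ω'))ᵀ * S σ X (W ω') (a ω'))
      = expect P (fun ω' => (S σ X (W' ω') (a' ω'))ᵀ * S σ X (W' ω') (a' ω')) :=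
    expect_congr_ae (by filter_upwards [eW, ea] with ω h1 h2; rw [h1, h2])
  refine le_of_eq_of_le (measureReal_congr ?_)
    (h'.measure_norm_L_gt_le_of_measurable hW' ha' hσ hn hd (X := X))
  filter_upwards [eW, ea] with ω h1 h2
  change (_ < ‖L P σ X W a ω‖) = (_ < ‖L P σ X W' a' ω‖)
  rw [L, L, hE, h1, h2]

theorem GaussianWeights.measure_norm_H_gt_le_of_measurable (h : GaussianWeights P W a)
    (hW : ∀ r k, Measurable fun ω => W ω r k) (ha : ∀ r, Measurable fun ω => a ω r)
    (hσ : LipschitzWith lip σ) (hn : 2 ≤ n) (hd : Real.log n ≤ d₁)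
    (h0 : ∫ x, σ x ∂(gaussianReal 0 1) = 0) {B : ℝ} (hB : 0 ≤ B)
    (hX : ∑ α, (∑ k, X k α ^ 2 - 1) ^ 2 ≤ B ^ 2) :
    P.real {ω | 170 * (√((n : ℝ) / d₁) + (n : ℝ) / d₁) * (lip : ℝ) ^ 2 * ‖X‖ ^ 2
        + 32 * B * (lip : ℝ) ^ 2 * ‖X‖ * √((n : ℝ) / d₁) <
      ‖H σ X (W ω) (a ω) - expect P (fun ω' => H σ X (W ω') (a ω'))‖}
      ≤ (n : ℝ) ^ (-(7 / 3) : ℝ) + 4 * Real.exp (-2 * n) := by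
  rcases (show 0 ≤ (lip : ℝ) * ‖X‖ by positivity).eq_or_lt' with hQ | hQ
  · refine le_of_eq_of_le ((measureReal_congr (ae_eq_empty.2 ?_)).trans measureReal_empty) (by positivity)
    refine measure_mono_null (fun ω hω => ?_) measure_empty
    have hE : expect P (fun ω' => H σ X (W ω') (a ω')) = H σ X (0 : Matrix (Fin d₁) _ ℝ) 0 := by
      ext i j
      simp [expect, fun ω => H_eq_const hσ hQ (W ω) (a ω)]
    rw [Set.mem_ofPred_eq, hE, H_eq_const hσ hQ, sub_self, norm_zero] at hω
    exact absurd hω (not_lt.2 (by positivity))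
  have hlog : 0 < Real.log n := Real.log_pos (by exact_mod_cast hn)
  have hd0 : (0 : ℝ) < d₁ := hlog.trans_le hd
  have hrows := h.gaussianRows hW ha
  have hA := h.gaussianWeighted hW ha hσ hQ
  have h1 := hrows.measure_gram_Y_le hσ X (by exact_mod_cast hd0) hQ h0 hB hX
  have h2 := h.measure_norm_L_gt_le_of_measurable hW ha hσ hn hd (X := X)
  refine ((measureReal_mono (fun ω hω => ?_) (measure_ne_top _ _)).trans
    (measureReal_union_le _ _)).trans (add_le_add h2 h1)
  rw [Set.mem_ofPred_eq, H_sub_expect_eq hrows hσ hA] at hω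
  by_contra hcon
  rw [Set.mem_union, not_or, Set.mem_ofPred_eq, Set.mem_ofPred_eq, not_lt, not_lt] at hcon
  refine absurd hω (not_lt.2 ((norm_add_le _ _).trans ((add_le_add hcon.2 hcon.1).trans ?_)))
  -- Since `log n ≤ n`, the derivative error `10 λ² ‖X‖² √(log n / d₁)` fits into the main term and
  -- raises `160` to `170`.
  have hsqrt : √(Real.log n / d₁) ≤ √((n : ℝ) / d₁) + (n : ℝ) / d₁ := by
    refine (Real.sqrt_le_sqrt (div_le_div_of_nonneg_right ?_ hd0.le)).trans
      (le_add_of_nonneg_right (by positivity))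
    exact (Real.log_le_sub_one_of_pos (by positivity)).trans (by linarith)
  have := mul_le_mul_of_nonneg_left hsqrt (show 0 ≤ 10 * (lip : ℝ) ^ 2 * ‖X‖ ^ 2 by positivity)
  linarith

theorem GaussianWeights.measure_norm_H_gt_le (h : GaussianWeights P W a)
    (hσ : LipschitzWith lip σ) (hn : 2 ≤ n) (hd : Real.log n ≤ d₁)
    (h0 : ∫ x, σ x ∂(gaussianReal 0 1) = 0) {B : ℝ} (hB : 0 ≤ B)
    (hX : ∑ α, (∑ k, X k α ^ 2 - 1) ^ 2 ≤ B ^ 2) :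
    P.real {ω | 170 * (√((n : ℝ) / d₁) + (n : ℝ) / d₁) * (lip : ℝ) ^ 2 * ‖X‖ ^ 2
        + 32 * B * (lip : ℝ) ^ 2 * ‖X‖ * √((n : ℝ) / d₁) <
      ‖H σ X (W ω) (a ω) - expect P (fun ω' => H σ X (W ω') (a ω'))‖}
      ≤ (n : ℝ) ^ (-(7 / 3) : ℝ) + 4 * Real.exp (-2 * n) := by
  obtain ⟨W', a', h', hW', ha', eW, ea⟩ := h.exists_measurable
  have hE : expect P (fun ω' => H σ X (W ω') (a ω'))
      = expect P (fun ω' => H σ X (W' ω') (a' ω')) :=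
    expect_congr_ae (by filter_upwards [eW, ea] with ω h1 h2; rw [h1, h2])
  refine le_of_eq_of_le (measureReal_congr ?_)
    (h'.measure_norm_H_gt_le_of_measurable hW' ha' hσ hn hd h0 hB hX)
  filter_upwards [eW, ea] with ω h1 h2
  change (_ < ‖H σ X (W ω) (a ω) - expect P fun ω' => H σ X (W ω') (a ω')‖)
    = (_ < ‖H σ X (W' ω) (a' ω) - expect P fun ω' => H σ X (W' ω') (a' ω')‖)
  rw [hE, h1, h2]

end TwoLayerNet

end TangentKernel

theorem mainTheorem7 :
    ∃ C : ℝ, 0 < C ∧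
      ∀ {Ω : Type*} [MeasurableSpace Ω] (P : Measure Ω) [IsProbabilityMeasure P]
        (d₀ d₁ n : ℕ) (X : Matrix (Fin d₀) (Fin n) ℝ)
        (W : Ω → Matrix (Fin d₁) (Fin d₀) ℝ) (a : Ω → Fin d₁ → ℝ)
        (σ : ℝ → ℝ) (lip : ℝ≥0),
        TwoLayerNet.GaussianWeights P W a →
        LipschitzWith lip σ →
        Real.log n ≤ d₁ →
        -- the bound on the derivative part, in its homogeneous form
        (1 - (n : ℝ) ^ (-(7 / 3) : ℝ) ≤
          P.real {ω | ‖TwoLayerNet.L P σ X W a ω‖ ≤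
            10 * (lip : ℝ) ^ 2 * ‖X‖ ^ 2 * √(Real.log n / d₁)}) ∧
        -- the same bound with fourth powers, in the range `1 ≤ lip * ‖X‖`
        (1 ≤ (lip : ℝ) * ‖X‖ →
          1 - (n : ℝ) ^ (-(7 / 3) : ℝ) ≤
            P.real {ω | ‖TwoLayerNet.L P σ X W a ω‖ ≤
              10 * (lip : ℝ) ^ 4 * ‖X‖ ^ 4 * √(Real.log n / d₁)}) ∧
        -- the bound on the whole kernel
        (∀ B : ℝ, 0 ≤ B →
          ∑ i, (‖WithLp.toLp 2 (X.col i)‖ ^ 2 - 1) ^ 2 ≤ B ^ 2 →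
          ∫ x, σ x ∂(gaussianReal 0 1) = 0 →
          1 - (n : ℝ) ^ (-(7 / 3) : ℝ) - 4 * Real.exp (-2 * n) ≤
            P.real {ω | ‖TwoLayerNet.H σ X (W ω) (a ω)
                - TwoLayerNet.expect P (fun ω' => TwoLayerNet.H σ X (W ω') (a ω'))‖ ≤
              C * (√((n : ℝ) / d₁) + (n : ℝ) / d₁) * (lip : ℝ) ^ 2 * ‖X‖ ^ 2
                + 32 * B * (lip : ℝ) ^ 2 * ‖X‖ * √((n : ℝ) / d₁)
                + 10 * (lip : ℝ) ^ 4 * ‖X‖ ^ 4 * √(Real.log n / d₁)}) := by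
  refine ⟨170, by norm_num, fun {Ω} _ P _ d₀ d₁ n X W a σ lip h hσ hd => ?_⟩
  have hL : 1 - (n : ℝ) ^ (-(7 / 3) : ℝ) ≤ P.real {ω | ‖TwoLayerNet.L P σ X W a ω‖ ≤
      10 * (lip : ℝ) ^ 2 * ‖X‖ ^ 2 * √(Real.log n / d₁)} := by
    rcases lt_or_ge n 2 with hn | hn
    · interval_cases n
      · have hnorm : ∀ ω, ‖TwoLayerNet.L P σ X W a ω‖ = 0 := fun ω => by
          rw [Subsingleton.elim (TwoLayerNet.L P σ X W a ω) 0, norm_zero]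
        simp [hnorm, Real.zero_rpow]
      · simp
    · exact (sub_le_sub_left (h.measure_norm_L_gt_le hσ hn hd) 1).trans
        (TwoLayerNet.one_sub_measureReal_lt_le _ _)
  refine ⟨hL, fun h1 => hL.trans (measureReal_mono (fun ω hω => ?_) (measure_ne_top _ _)),
    fun B hB hX h0 => ?_⟩
  · rw [Set.mem_ofPred_eq] at hω ⊢
    refine hω.trans ?_
    have hpow := pow_le_pow_right₀ h1 (show 2 ≤ 4 by norm_num)
    rw [mul_pow, mul_pow] at hpow
    exact mul_le_mul_of_nonneg_right (by linarith) (Real.sqrt_nonneg _)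
  · rcases lt_or_ge n 2 with hn | hn
    -- For `n ≤ 1` the left-hand side is negative: `1 - 0 - 4` or `1 - 1 - 4 e⁻²`.
    · refine le_trans ?_ measureReal_nonneg
      interval_cases n
      · norm_num [Real.zero_rpow]
      · norm_num
        positivity
    have hX' : ∑ α, (∑ k, X k α ^ 2 - 1) ^ 2 ≤ B ^ 2 := by
      simpa only [EuclideanSpace.norm_sq_eq, Matrix.col_apply, Real.norm_eq_abs, sq_abs] using hX
    have hH := h.measure_norm_H_gt_le hσ hn hd h0 hB hX'
    rw [sub_sub]
    refine ((sub_le_sub_left hH 1).trans (TwoLayerNet.one_sub_measureReal_lt_le _ _)).trans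
      (measureReal_mono (fun ω hω => ?_) (measure_ne_top _ _))
    rw [Set.mem_ofPred_eq] at hω ⊢
    -- The quartic term is pure slack, the derivative part being already inside the constant `170`.
    exact hω.trans (le_add_of_nonneg_right (by positivity))
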